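/- **Setting.** Let $X,Y$ be Hilbert spaces, $x^\dagger\in X$, $\rho>0$, and let $F:D(F)\subset X\to Y$ be Fréchet differentiable with $B_\rho(x^\dagger)\subset D(F)$ (open ball); put $y=F(x^\dagger)$. Let $\tau>1$, let $q\ge 1$, let $(n_k)_{k\ge0}$ be positive integers with $0\le n_{k+1}-n_k\le q$ and $n_k\to\infty$, and let $\alpha_k=1/n_k$. Let $g_\alpha$ be either the Landweber or the Lardy filter, $$g_\alpha(\lambda)=\sum_{i=0}^{[1/\alpha]}(1-\lambda)^i\qquad\text{or}\qquad g_\alpha(\lambda)=\sum_{i=1}^{[1/\alpha]}(1+\lambda)^{-i},$$ and $r_\alpha(\lambda)=1-\lambda g_\alpha(\lambda)$. Assume the scaling condition $$\|F'(x)\|\le\min\Big\{\tfrac{\sqrt2}{3}\,\alpha_0^{1/2},\ \beta_0^{1/2}\Big\},\qquad x\in B_\rho(x^\dagger),$$ for some $0<\beta_0\le\frac12$ with $r_{\alpha_0}\ge\frac34$ on $[0,\beta_0]$. Given an initial guess $x_0\in X$, $\delta>0$ and $y^\delta\in Y$ with $\|y^\delta-y\|\le\delta$, let $x_0^\delta=x_0$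 and $$x_{k+1}^\delta=x_0-g_{\alpha_k}\big(F'(x_k^\delta)^*F'(x_k^\delta)\big)F'(x_k^\delta)^*\big(F(x_k^\delta)-y^\delta-F'(x_k^\delta)(x_k^\delta-x_0)\big),$$ and let $k_\delta$ be the first integer $k\ge0$ with $\|F(x_{k}^\delta)-y^\delta\|\le\tau\delta$. We say that the method is well defined for $(\delta,y^\delta)$ if $k_\delta$ exists and $x_k^\delta\in B_\rho(x^\dagger)$ for all $0\le k\le k_\delta$. Write $A=F'(x^\dagger)^*F'(x^\dagger)$. **(i)** There are $\eta_0>0$, depending only on $\tau,q$, and for each $\nu\ge\frac12$ a constant $C_\nu>0$, depending only on $\tau,q,\nu$, such that the following holds. Let $\|F'(x)-F'(z)\|\le L\|x-z\|$ for all $x,z\in B_\rho(x^\dagger)$, let $\rho>4\|x_0-x^\dagger\|$, let $x_0-x^\dagger=A^\nu\omega$ for some $\omega\in X$ and $\nu\ge\frac12$, and let $L\|u\|\le\eta_0$, where $u\in\mathcal N(F'(x^\dagger)^*)^\perp$ is the unique element with $x_0-x^\dagger=F'(x^\dagger)^*u$. Then the method is well defined for all sufficiently small $\delta>0$ (uniformly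 in $y^\delta$), and whenever it is well defined, $$\|x_{k_\delta}^\delta-x^\dagger\|\le C_\nu\|\omega\|^{1/(1+2\nu)}\delta^{2\nu/(1+2\nu)}.$$ **(ii)** Fix $\gamma_1>\frac{\sqrt2}{3}\sqrt{1+q}/(\tau-1)$ as a function of $\tau$ and $q$. There are $\eta_1>0$, depending only on $\tau,q$, and constants $C_\nu,C'_\mu>0$ $(\nu,\mu>0)$, depending only on $\tau,q,\nu$ and on $\tau,q,\mu$ respectively, such that the following holds. Let $K_0,K_1,K_2>0$ be such that for all $x,z\in B_\rho(x^\dagger)$ there is a bounded operator $R(x,z)$ on $X$ with $F'(x)=F'(z)R(x,z)$ and $\|I-R(x,z)\|\le K_0\|x-z\|$, and such that $$\|[F'(x)-F'(z)]w\|\le K_1\|x-z\|\,\|F'(z)w\|+K_2\|F'(z)(x-z)\|\,\|w\|\qquad\text{for all } w\in X.$$ Let $\rho>2(1+\sqrt2\,\gamma_1)\|x_0-x^\dagger\|$, $x_0-x^\dagger\in\mathcal N(F'(x^\dagger))^\perp$ and $(K_0+K_1+K_2)\|x_0-x^\dagger\|\le\eta_1$. Then the method is well defined for all $\delta>0$ and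 all $y^\delta$, and * $x_{k_\delta}^\delta\to x^\dagger$ as $\delta\to0$, uniformly in $y^\delta$; * if $x_0-x^\dagger=A^\nu\omega$ for some $\omega\in X$ and $\nu>0$, then $\|x_{k_\delta}^\delta-x^\dagger\|\le C_\nu\|\omega\|^{1/(1+2\nu)}\delta^{2\nu/(1+2\nu)}$; * if $x_0-x^\dagger=(-\log A)^{-\mu}\omega$ for some $\omega\in X$ and $\mu>0$, then for $0<\delta\le\|\omega\|$ $$\|x_{k_\delta}^\delta-x^\dagger\|\le C'_\mu\|\omega\|\Big(1+\Big|\ln\frac{\delta}{\|\omega\|}\Big|\Big)^{-\mu}.$$ -/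

import Mathlib

open Filter Topology

universe u v

/-- The two linear regularization methods under consideration. -/
inductive NewtonFilter where
  | landweber
  | lardy

/-- The filter `g_α(a)` of the method, as an element of the (real) algebra in which `a` lives:
`∑_{i=0}^{[1/α]} (1 - a)^i` for Landweber and `∑_{i=1}^{[1/α]} (1 + a)^{-i}` for Lardy.
It is used for real numbers `a = λ` and for operators `a = A* A`
(where `1 + A* A` is invertible, so that `Ring.inverse` is its inverse). -/
noncomputable def NewtonFilter.g {R : Type*} [Ring R] (m : NewtonFilter) (α : ℝ) (a : R) : R :=
  match m with
  | .landweber => ∑ i ∈ Finset.range (⌊1 / α⌋₊ + 1), (1 - a) ^ i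
  | .lardy => ∑ i ∈ Finset.Icc 1 ⌊1 / α⌋₊, Ring.inverse (1 + a) ^ i

/-- The residual function `r_α(λ) = 1 - λ g_α(λ)`. -/
noncomputable def NewtonFilter.r (m : NewtonFilter) (α lam : ℝ) : ℝ :=
  1 - lam * m.g α lam

/-- The conditions on the integers `n_k`; the regularization parameters are `α_k = 1 / n_k`. -/
structure StepIntegers (q : ℕ) (n : ℕ → ℕ) : Prop where
  pos : ∀ k, 0 < n k
  mono : ∀ k, n k ≤ n (k + 1)
  step : ∀ k, n (k + 1) ≤ n k + q
  tendsto : Tendsto n atTop atTop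

section Hilbert

variable {X Y : Type*} [NormedAddCommGroup X] [InnerProductSpace ℝ X] [CompleteSpace X]
  [NormedAddCommGroup Y] [InnerProductSpace ℝ Y] [CompleteSpace Y]

/-- `A* A` for a bounded operator `A` between Hilbert spaces. -/
noncomputable def normalOp (A : X →L[ℝ] Y) : X →L[ℝ] X :=
  (ContinuousLinearMap.adjoint A).comp A

/-- `S = f(T)` in the continuous functional calculus of a bounded positive self-adjoint operator
`T`: the operator `S` is the norm limit of `p_j(T)` for real polynomials `p_j` that converge to `f`
uniformly on `[0, ‖T‖]`, an interval that contains the spectrum of `T`. -/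
def IsFunctionOfOp (T : X →L[ℝ] X) (f : ℝ → ℝ) (S : X →L[ℝ] X) : Prop :=
  ∃ p : ℕ → Polynomial ℝ,
    TendstoUniformlyOn (fun j t => (p j).eval t) f atTop (Set.Icc 0 ‖T‖) ∧
      Tendsto (fun j => Polynomial.aeval T (p j)) atTop (𝓝 S)

/-- The Hölder source condition `e = (A* A)^ν ω`. -/
def HolderSource (A : X →L[ℝ] Y) (ν : ℝ) (e ω : X) : Prop :=
  ∃ S : X →L[ℝ] X, IsFunctionOfOp (normalOp A) (fun t => t ^ ν) S ∧ e = S ω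

/-- The logarithmic source condition `e = (-log (A* A))^{-μ} ω`; the function
`t ↦ (-log t)^{-μ}` is extended to `t = 0` by continuity, with the value `0`. -/
def LogSource (A : X →L[ℝ] Y) (μ : ℝ) (e ω : X) : Prop :=
  ∃ S : X →L[ℝ] X,
    IsFunctionOfOp (normalOp A) (fun t => if t = 0 then 0 else (-Real.log t) ^ (-μ)) S ∧ e = S ω

/-- The standing conditions on the operator: `F` is Fréchet differentiable on the ball `B_ρ(x†)`
with derivative `F'`, and the derivative is scaled so that
`‖F'(x)‖ ≤ min {c₃ α₀^{1/2}, β₀^{1/2}}` there, with `c₃ = √2 / 3`, for a number `0 < β₀ ≤ 1/2` such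
that `r_{α₀} ≥ 3/4` on `[0, β₀]`. The values of `F` and `F'` off the ball are irrelevant. -/
structure OperatorConditions (m : NewtonFilter) (α₀ : ℝ) (F : X → Y) (F' : X → X →L[ℝ] Y)
    (xd : X) (ρ : ℝ) : Prop where
  radius_pos : 0 < ρ
  hasFDerivAt : ∀ x ∈ Metric.ball xd ρ, HasFDerivAt F (F' x) x
  scaling : ∃ β₀ : ℝ, 0 < β₀ ∧ β₀ ≤ 1 / 2 ∧ (∀ lam ∈ Set.Icc 0 β₀, 3 / 4 ≤ m.r α₀ lam) ∧
    ∀ x ∈ Metric.ball xd ρ, ‖F' x‖ ≤ min (√2 / 3 * √α₀) (√β₀)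

/-- Lipschitz continuity of the derivative on `B_ρ(x†)`. -/
def LipschitzDeriv (F' : X → X →L[ℝ] Y) (xd : X) (ρ L : ℝ) : Prop :=
  ∀ x ∈ Metric.ball xd ρ, ∀ z ∈ Metric.ball xd ρ, ‖F' x - F' z‖ ≤ L * ‖x - z‖

/-- `F'(x) = F'(z) R(x, z)` with `‖I - R(x, z)‖ ≤ K₀ ‖x - z‖` on `B_ρ(x†)`. -/
def RangeInvariance (F' : X → X →L[ℝ] Y) (xd : X) (ρ K₀ : ℝ) : Prop :=
  ∀ x ∈ Metric.ball xd ρ, ∀ z ∈ Metric.ball xd ρ, ∃ R : X →L[ℝ] X,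
    F' x = (F' z).comp R ∧ ‖ContinuousLinearMap.id ℝ X - R‖ ≤ K₀ * ‖x - z‖

/-- `‖[F'(x) - F'(z)] w‖ ≤ K₁ ‖x - z‖ ‖F'(z) w‖ + K₂ ‖F'(z) (x - z)‖ ‖w‖` on `B_ρ(x†)`. -/
def DerivBound (F' : X → X →L[ℝ] Y) (xd : X) (ρ K₁ K₂ : ℝ) : Prop :=
  ∀ x ∈ Metric.ball xd ρ, ∀ z ∈ Metric.ball xd ρ, ∀ w : X,
    ‖(F' x - F' z) w‖ ≤ K₁ * ‖x - z‖ * ‖F' z w‖ + K₂ * ‖F' z (x - z)‖ * ‖w‖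

/-- The iterates `x_{k+1} = x₀ - g_{α_k}(F'(x_k)* F'(x_k)) F'(x_k)* (F(x_k) - y^δ - F'(x_k)(x_k - x₀))`
with `α_k = 1 / n_k`. -/
noncomputable def newtonIterate (m : NewtonFilter) (n : ℕ → ℕ) (F : X → Y) (F' : X → X →L[ℝ] Y)
    (x₀ : X) (yδ : Y) : ℕ → X
  | 0 => x₀
  | k + 1 =>
    let x := newtonIterate m n F F' x₀ yδ k
    x₀ - m.g (1 / (n k : ℝ)) (normalOp (F' x))
      (ContinuousLinearMap.adjoint (F' x) (F x - yδ - F' x (x - x₀)))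

/-- `k` is the stopping index of the discrepancy principle, the first index with
`‖F(x_k) - y^δ‖ ≤ τ δ`, and the iterates up to `k` are well defined, as they lie in `B_ρ(x†)`. -/
def IsDiscrepancyIndex (m : NewtonFilter) (n : ℕ → ℕ) (F : X → Y) (F' : X → X →L[ℝ] Y)
    (x₀ xd : X) (ρ τ δ : ℝ) (yδ : Y) (k : ℕ) : Prop :=
  ‖F (newtonIterate m n F F' x₀ yδ k) - yδ‖ ≤ τ * δ ∧
    (∀ j < k, τ * δ < ‖F (newtonIterate m n F F' x₀ yδ j) - yδ‖) ∧
    ∀ j ≤ k, newtonIterate m n F F' x₀ yδ j ∈ Metric.ball xd ρ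

end Hilbert

/-! Write `e_k = x_k - x†`, `T = F'(x†)`, `A = T*T`, `A_k = F'(x_k)*F'(x_k)` and `N_k = m.order (n
k)`. For both filters the residual function is a power `s^N` of a single function with `1 - t ≤ s(t)
≤ 1/(1 + t)`, and one Newton step reads `e_{k+1} = s(A_k)^{N_k} e_0 + g(A_k) F'(x_k)* (noise -
Taylor remainder)` (`newtonIterate_succ_sub`). Replacing `A_k` by `A` costs only a small multiple of
`‖e_k‖`, uniformly in the power: under range invariance by `norm_base_pow_sub_base_pow_apply_le`,
and under a Lipschitz condition with `e_0` in the range of `T*` by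
`norm_base_pow_sub_base_pow_adjoint_apply_le`. Both rest on telescoping sums whose apparent
logarithmic divergence is removed by summation by parts (`norm_sum_left_le`). Hence in both settings
`e_{k+1} = s(A)^{N_k} e_0 + O(θ ‖e_k‖ + √n_k δ)` with `θ` small.

Put `σ_j = ‖s(A)^j e_0‖`. The recursion and the discrepancy principle give an oracle inequality
(`oracleBound_of_recursion`). Stopping at `K ≥ 1` yields `‖T e_K‖ = O(δ)`, which bounds `‖e_K‖` by
`C (σ_j + √j δ)` for every `j ≥ N_{K-1}`. Not having stopped earlier yields, because `τ > 1`, an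
index `M` with `√(M+1) δ ≤ C σ_M`, and `N_{K-1} ≤ C (M+1)` because `n_k` grows by at most `q` per
step. So the stopping rule is as good as an optimal a priori choice, and convergence, Hölder rates
and logarithmic rates follow from the decay of `σ_j` alone (`OracleBound.tendsto_zero`,
`OracleBound.holder_rate`, `OracleBound.log_rate`).

The stopping index exists because the discrepancy is already below `τδ` at the first index where the
noise dominates, that is, where `√n_k δ` exceeds `γ ‖e_0‖` (structural case) or `n_k δ` exceeds `Γ
‖u‖` (Lipschitz case). Up to that index the iterates stay in the ball (`structural_bounds`, and
`lipschitz_mem_ball` for small `δ`).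

All spectral estimates reduce to scalar inequalities on `[0, ‖A‖]`, since a polynomial that is
nonnegative there gives a positive operator (`Polynomial.form_aeval_nonneg`). -/

/-! ### Positivity of polynomials in a symmetric operator. -/

section PolynomialPositivity

open Polynomial

theorem nonneg_on_Icc_of_nonneg_on_Ioo {f : ℝ → ℝ} (hf : Continuous f) {a c : ℝ} (hac : a < c)
    (h : ∀ t ∈ Set.Ioo a c, 0 ≤ f t) : ∀ t ∈ Set.Icc a c, 0 ≤ f t := by
  have hc : IsClosed {t | 0 ≤ f t} := isClosed_le continuous_const hf
  have := hc.closure_subset_iff.2 (show Set.Ioo a c ⊆ {t | 0 ≤ f t} from h)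
  rw [closure_Ioo hac.ne] at this
  exact this

/-- Cauchy–Schwarz for the semidefinite form `B (A ·) ·`, applied to `x` and `A x`: it upgrades `A ≤
b` to `A² ≤ b A`. As `B` is only semidefinite, the case `B (A x) (A x) = 0` has to be split off
before cancelling. -/
theorem form_sq_le {V : Type*} [AddCommGroup V] [Module ℝ V] {b : ℝ} (hb : 0 ≤ b)
    {B : V →ₗ[ℝ] V →ₗ[ℝ] ℝ} {A : Module.End ℝ V} (hp : ∀ x, 0 ≤ B x x)
    (hA : ∀ x y, B (A x) y = B x (A y)) (hA0 : ∀ x, 0 ≤ B (A x) x)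
    (hAb : ∀ x, B (A x) x ≤ b * B x x) (x : V) : B (A x) (A x) ≤ b * B (A x) x := by
  have cs := LinearMap.BilinForm.apply_mul_apply_le_of_forall_zero_le (B ∘ₗ A)
    (fun y => hA0 y) x (A x)
  simp only [LinearMap.comp_apply] at cs
  have e : B (A (A x)) x = B (A x) (A x) := hA _ _
  rw [e] at cs
  have h1 := hAb (A x)
  have h2 := hA0 x
  rcases (hp (A x)).eq_or_lt with h | h
  · rw [← h]
    positivity
  · have : B (A x) (A x) * B (A x) (A x) ≤ (b * B (A x) x) * B (A x) (A x) := by nlinarith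
    exact le_of_mul_le_mul_right this h

/-- Induction on the degree, splitting off real or complex roots. The form `B` is quantified inside
the induction because linear factors are absorbed into it: `t Q(t)` is tested with `B (A ·) ·`, and
`(b - t) Q(t)` with `B ((b - A) ·) ·`. A root `r ≤ 0` is handled by `t - r = t + (-r)`, a root `r ≥
b` by `r - t = (b - t) + (r - b)`, an interior root as a square, and a nonreal pair by `(t - Re z)²
+ (Im z)²`. -/
theorem Polynomial.form_aeval_nonneg {V : Type*} [AddCommGroup V] [Module ℝ V] {b : ℝ}
    (hb : 0 < b) (d : ℕ) : ∀ (p : ℝ[X]), p.natDegree ≤ d → (∀ t ∈ Set.Icc 0 b, 0 ≤ p.eval t) →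
    ∀ (B : V →ₗ[ℝ] V →ₗ[ℝ] ℝ) (A : Module.End ℝ V), (∀ x y, B x y = B y x) →
    (∀ x, 0 ≤ B x x) → (∀ x y, B (A x) y = B x (A y)) → (∀ x, 0 ≤ B (A x) x) →
    (∀ x, B (A x) x ≤ b * B x x) → ∀ x, 0 ≤ B (aeval A p x) x := by
  induction d using Nat.strong_induction_on with
  | _ d ih =>
  intro p hpd hp B A hs hpos hA hA0 hAb x
  by_cases hd0 : p.natDegree = 0
  · rw [natDegree_eq_zero] at hd0
    obtain ⟨c, rfl⟩ := hd0
    have := hp 0 ⟨le_rfl, hb.le⟩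
    simp only [eval_C] at this
    simp only [aeval_C, Module.algebraMap_end_apply, map_smul, LinearMap.smul_apply, smul_eq_mul]
    exact mul_nonneg this (hpos x)
  have hp0 : p ≠ 0 := by rintro rfl; simp at hd0
  have hdeg : p.degree ≠ 0 := by
    rw [degree_eq_natDegree hp0]; exact_mod_cast hd0
  have step : ∀ y, B (A (A y)) y = B (A y) (A y) := fun y => hA _ _
  by_cases hr : ∃ r, p.eval r = 0
  · obtain ⟨r, hr⟩ := hr
    obtain ⟨Q, rfl⟩ := dvd_iff_isRoot.2 hr
    have hQ0 : Q ≠ 0 := right_ne_zero_of_mul hp0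
    have hQd : Q.natDegree < d := by
      rw [natDegree_mul (X_sub_C_ne_zero r) hQ0, natDegree_X_sub_C] at hpd
      omega
    have hev : ∀ t ∈ Set.Icc 0 b, 0 ≤ (t - r) * Q.eval t := fun t ht => by
      simpa using hp t ht
    rcases le_or_gt r 0 with h0 | h0
    · have hQ : ∀ t ∈ Set.Icc 0 b, 0 ≤ Q.eval t :=
        nonneg_on_Icc_of_nonneg_on_Ioo Q.continuous hb fun t ht =>
          nonneg_of_mul_nonneg_right (hev t ⟨ht.1.le, ht.2.le⟩) (by linarith [ht.1])
      have h1 := ih _ hQd Q le_rfl hQ B A hs hpos hA hA0 hAb x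
      have h2 := ih _ hQd Q le_rfl hQ (B ∘ₗ A) A (fun x y => by simp [hA, hs x])
        (fun y => hA0 y) (fun y z => by simp [hA]) (fun y => by simpa [step] using hpos (A y))
        (fun y => by simpa [step] using form_sq_le hb.le hpos hA hA0 hAb y) x
      simp only [LinearMap.comp_apply] at h2
      simp only [aeval_mul, map_sub, aeval_X, aeval_C, Module.End.mul_apply,
        LinearMap.sub_apply, Module.algebraMap_end_apply, map_smul, LinearMap.smul_apply,
        smul_eq_mul]
      nlinarith
    rcases le_or_gt b r with h0' | h0'
    · have hQ : ∀ t ∈ Set.Icc 0 b, 0 ≤ (-Q).eval t :=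
        nonneg_on_Icc_of_nonneg_on_Ioo (-Q).continuous hb fun t ht => by
          have h := hev t ⟨ht.1.le, ht.2.le⟩
          have h' : 0 ≤ (r - t) * (-Q).eval t := by rw [eval_neg]; linarith
          exact nonneg_of_mul_nonneg_right h' (by linarith [ht.2])
      have hQd' : (-Q).natDegree < d := by rwa [natDegree_neg]
      have h1 := ih _ hQd' (-Q) le_rfl hQ B A hs hpos hA hA0 hAb x
      have h2 := ih _ hQd' (-Q) le_rfl hQ (B ∘ₗ (b • LinearMap.id - A)) A
        (fun x y => by simp [hA, hs x]) (fun y => by simpa using hAb y) (fun y z => by simp [hA])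
        (fun y => by simpa [step] using form_sq_le hb.le hpos hA hA0 hAb y)
        (fun y => by
          have h := hpos (b • y - A y)
          simp only [map_sub, map_smul, LinearMap.sub_apply, LinearMap.smul_apply, smul_eq_mul,
            ← hA y y] at h
          simp only [LinearMap.comp_apply, LinearMap.sub_apply, LinearMap.smul_apply,
            LinearMap.id_apply, map_sub, map_smul, smul_eq_mul, step]
          linarith) x
      simp only [LinearMap.comp_apply, LinearMap.sub_apply, LinearMap.smul_apply,
        LinearMap.id_apply, map_sub, map_smul, smul_eq_mul, map_neg, LinearMap.neg_apply] at h1 h2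
      simp only [aeval_mul, map_sub, aeval_X, aeval_C, Module.End.mul_apply,
        LinearMap.sub_apply, Module.algebraMap_end_apply, map_smul, LinearMap.smul_apply,
        smul_eq_mul]
      nlinarith
    -- At an interior root `Q` is nonpositive to the left and nonnegative to the right, so `r` is a
    -- double root. The square `(A - r)²` can then be distributed over both slots of the form.
    · have hQr : Q.eval r = 0 := by
        apply le_antisymm
        · have := nonneg_on_Icc_of_nonneg_on_Ioo (-Q).continuous h0 (fun t ht => by
            have h := hev t ⟨ht.1.le, by linarith [ht.2]⟩
            have h' : 0 ≤ (r - t) * (-Q).eval t := by rw [eval_neg]; linarith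
            exact nonneg_of_mul_nonneg_right h' (by linarith [ht.2])) r ⟨h0.le, le_rfl⟩
          simpa using this
        · exact nonneg_on_Icc_of_nonneg_on_Ioo Q.continuous h0' (fun t ht =>
            nonneg_of_mul_nonneg_right (hev t ⟨by linarith [ht.1], ht.2.le⟩)
              (by linarith [ht.1])) r ⟨le_rfl, h0'.le⟩
      obtain ⟨R, rfl⟩ := dvd_iff_isRoot.2 hQr
      have hR0 : R ≠ 0 := right_ne_zero_of_mul hQ0
      have hRd : R.natDegree < d := by
        rw [natDegree_mul (X_sub_C_ne_zero r) hR0, natDegree_X_sub_C] at hQd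
        omega
      have hev' : ∀ t ∈ Set.Icc 0 b, t ≠ r → 0 ≤ R.eval t := fun t ht hne => by
        have h := hev t ht
        simp only [eval_mul, eval_sub, eval_X, eval_C, ← mul_assoc] at h
        exact nonneg_of_mul_nonneg_right h (mul_self_pos.2 (sub_ne_zero.2 hne))
      have hR : ∀ t ∈ Set.Icc 0 b, 0 ≤ R.eval t := by
        intro t ht
        rcases le_total t r with h | h
        · exact nonneg_on_Icc_of_nonneg_on_Ioo R.continuous h0 (fun t ht =>
            hev' t ⟨ht.1.le, by linarith [ht.2]⟩ ht.2.ne) t ⟨ht.1, h⟩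
        · exact nonneg_on_Icc_of_nonneg_on_Ioo R.continuous h0' (fun t ht =>
            hev' t ⟨by linarith [ht.1], ht.2.le⟩ ht.1.ne') t ⟨h, ht.2⟩
      have h1 := ih _ hRd R le_rfl hR B A hs hpos hA hA0 hAb (A x - r • x)
      have e : (X - C r) * ((X - C r) * R) = (X - C r) * (R * (X - C r)) := by ring
      rw [e]
      simp only [aeval_mul, map_sub, aeval_X, aeval_C, Module.End.mul_apply,
        LinearMap.sub_apply, Module.algebraMap_end_apply, map_smul, LinearMap.smul_apply,
        smul_eq_mul, hA] at h1 ⊢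
      linarith
  · push Not at hr
    obtain ⟨z, hz⟩ := IsAlgClosed.exists_aeval_eq_zero ℂ p hdeg
    have him : z.im ≠ 0 := by
      intro h
      apply hr z.re
      have hzre : z = (algebraMap ℝ ℂ) z.re := by
        apply Complex.ext <;> simp [h]
      rw [hzre, aeval_algebraMap_apply] at hz
      simpa using hz
    obtain ⟨Q, hQ⟩ := p.quadratic_dvd_of_aeval_eq_zero_im_ne_zero hz him
    have hq : (X ^ 2 - C (2 * z.re) * X + C (‖z‖ ^ 2) : ℝ[X])
        = (X - C z.re) * (X - C z.re) + C (z.im ^ 2) := by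
      have : ‖z‖ ^ 2 = z.re ^ 2 + z.im ^ 2 := by
        rw [← Complex.normSq_eq_norm_sq, Complex.normSq_apply]; ring
      rw [this, C_add, C_pow, C_mul]
      have : (C 2 : ℝ[X]) = 2 := rfl
      rw [this]
      ring
    rw [hq] at hQ
    have hQ0 : Q ≠ 0 := by rintro rfl; simp [hQ] at hp0
    have hmon : ((X - C z.re) * (X - C z.re) + C (z.im ^ 2) : ℝ[X]).natDegree = 2 := by
      rw [natDegree_add_C, natDegree_mul (X_sub_C_ne_zero _) (X_sub_C_ne_zero _),
        natDegree_X_sub_C]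
    have hQd : Q.natDegree < d := by
      rw [hQ, natDegree_mul (by rintro h; rw [h, natDegree_zero] at hmon; omega) hQ0, hmon] at hpd
      omega
    have hQp : ∀ t ∈ Set.Icc 0 b, 0 ≤ Q.eval t := fun t ht => by
      have h := hp t ht
      rw [hQ] at h
      simp only [eval_mul, eval_add, eval_sub, eval_X, eval_C] at h
      exact nonneg_of_mul_nonneg_right h (by
        have := mul_self_nonneg (t - z.re)
        positivity)
    have h1 := ih _ hQd Q le_rfl hQp B A hs hpos hA hA0 hAb (A x - z.re • x)
    have h2 := ih _ hQd Q le_rfl hQp B A hs hpos hA hA0 hAb x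
    have e : ((X - C z.re) * (X - C z.re) + C (z.im ^ 2)) * Q
        = (X - C z.re) * (Q * (X - C z.re)) + C (z.im ^ 2) * Q := by ring
    rw [hQ, e]
    simp only [aeval_mul, map_sub, map_add, aeval_X, aeval_C, Module.End.mul_apply,
      LinearMap.sub_apply, LinearMap.add_apply, Module.algebraMap_end_apply, map_smul, LinearMap.smul_apply, smul_eq_mul, hA] at h1 ⊢
    nlinarith [mul_nonneg (sq_nonneg z.im) h2]

end PolynomialPositivity

/-! ### Functional calculus of `normalOp T` by uniform limits of polynomials. -/

section FunctionalCalculus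

set_option linter.unusedSectionVars false

open Polynomial

variable {X Y : Type*} [NormedAddCommGroup X] [InnerProductSpace ℝ X] [CompleteSpace X]
  [NormedAddCommGroup Y] [InnerProductSpace ℝ Y] [CompleteSpace Y]

theorem inner_normalOp_left (T : X →L[ℝ] Y) (x y : X) :
    inner ℝ (normalOp T x) y = inner ℝ (T x) (T y) := by
  simp [normalOp, ContinuousLinearMap.adjoint_inner_left]

theorem inner_normalOp_right (T : X →L[ℝ] Y) (x y : X) :
    inner ℝ x (normalOp T y) = inner ℝ (T x) (T y) := by
  simp [normalOp, ContinuousLinearMap.adjoint_inner_right]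

theorem norm_normalOp (T : X →L[ℝ] Y) : ‖normalOp T‖ = ‖T‖ * ‖T‖ :=
  ContinuousLinearMap.norm_adjoint_comp_self T

theorem ContinuousLinearMap.aeval_apply_eq (A : X →L[ℝ] X) (p : ℝ[X]) (x : X) :
    aeval A p x = aeval (A : Module.End ℝ X) p x := by
  have hpow : ∀ (n : ℕ) (x : X), (A ^ n) x = ((A : Module.End ℝ X) ^ n) x := by
    intro n
    induction n with
    | zero => simp
    | succ n ih => intro x; rw [pow_succ, pow_succ]; exact ih (A x)
  induction p using Polynomial.induction_on' with
  | add p q hp hq => simp [hp, hq]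
  | monomial n a => simp [aeval_monomial, hpow, Algebra.algebraMap_eq_smul_one]

theorem inner_aeval_normalOp_nonneg (T : X →L[ℝ] Y) (p : ℝ[X])
    (hp : ∀ t ∈ Set.Icc 0 ‖normalOp T‖, 0 ≤ p.eval t) (x : X) :
    0 ≤ inner ℝ (aeval (normalOp T) p x) x := by
  -- The polynomial lemma needs an interval of positive length, so the zero operator is separate.
  rcases (norm_nonneg (normalOp T)).eq_or_lt with h | h
  · have h0 : normalOp T = 0 := norm_eq_zero.1 h.symm
    have h1 := hp 0 ⟨le_rfl, norm_nonneg _⟩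
    have h2 : aeval (0 : X →L[ℝ] X) p = algebraMap ℝ _ (p.eval 0) := by
      rw [← coeff_zero_eq_eval_zero, aeval_def, eval₂_at_zero]
    rw [h0, h2, Algebra.algebraMap_eq_smul_one]
    simp only [smul_apply, one_apply_eq_self, inner_smul_left]
    exact mul_nonneg h1 real_inner_self_nonneg
  · rw [ContinuousLinearMap.aeval_apply_eq]
    exact p.form_aeval_nonneg h p.natDegree le_rfl hp (innerₗ X) (normalOp T : X →ₗ[ℝ] X)
      (fun x y => real_inner_comm _ _) (fun x => real_inner_self_nonneg)
      (fun x y => by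
        simp only [ContinuousLinearMap.coe_coe, innerₗ_apply_apply, inner_normalOp_left,
          inner_normalOp_right])
      (fun x => by
        simp only [ContinuousLinearMap.coe_coe, innerₗ_apply_apply, inner_normalOp_left]
        exact real_inner_self_nonneg)
      (fun x => by
        simp only [ContinuousLinearMap.coe_coe, innerₗ_apply_apply]
        refine (real_inner_le_norm _ _).trans ?_
        rw [real_inner_self_eq_norm_mul_norm, ← mul_assoc]
        gcongr
        exact (normalOp T).le_opNorm x) x

namespace IsFunctionOfOp

variable {A : X →L[ℝ] X} {f g : ℝ → ℝ} {S R : X →L[ℝ] X}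

theorem polynomial (A : X →L[ℝ] X) (p : ℝ[X]) :
    IsFunctionOfOp A (fun t => p.eval t) (aeval A p) :=
  ⟨fun _ => p, fun _ hu => Eventually.of_forall fun _ _ _ => refl_mem_uniformity hu,
    tendsto_const_nhds⟩

theorem const (A : X →L[ℝ] X) (c : ℝ) : IsFunctionOfOp A (fun _ => c) (c • 1) := by
  simpa [Algebra.algebraMap_eq_smul_one] using polynomial A (C c)

theorem one (A : X →L[ℝ] X) : IsFunctionOfOp A (fun _ => 1) 1 := by
  simpa using const A 1

theorem self (A : X →L[ℝ] X) : IsFunctionOfOp A (fun t => t) A := by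
  simpa using polynomial A Polynomial.X

theorem continuousOn (hf : IsFunctionOfOp A f S) : ContinuousOn f (Set.Icc 0 ‖A‖) := by
  obtain ⟨p, hp, -⟩ := hf
  exact hp.continuousOn (Frequently.of_forall fun n => (p n).continuous.continuousOn)

theorem add (hf : IsFunctionOfOp A f S) (hg : IsFunctionOfOp A g R) :
    IsFunctionOfOp A (fun t => f t + g t) (S + R) := by
  obtain ⟨p, hp, hS⟩ := hf
  obtain ⟨r, hr, hR⟩ := hg
  exact ⟨fun j => p j + r j, (hp.add hr).congr (Eventually.of_forall fun j t _ => by simp), by simpa using hS.add hR⟩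

theorem sub (hf : IsFunctionOfOp A f S) (hg : IsFunctionOfOp A g R) :
    IsFunctionOfOp A (fun t => f t - g t) (S - R) := by
  obtain ⟨p, hp, hS⟩ := hf
  obtain ⟨r, hr, hR⟩ := hg
  exact ⟨fun j => p j - r j, (hp.sub hr).congr (Eventually.of_forall fun j t _ => by simp), by simpa using hS.sub hR⟩

theorem mul (hf : IsFunctionOfOp A f S) (hg : IsFunctionOfOp A g R) :
    IsFunctionOfOp A (fun t => f t * g t) (S * R) := by
  have hfc := hf.continuousOn
  have hgc := hg.continuousOn
  obtain ⟨p, hp, hS⟩ := hf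
  obtain ⟨r, hr, hR⟩ := hg
  refine ⟨fun j => p j * r j, ?_, by simpa using hS.mul hR⟩
  have h := hp.tendstoLocallyUniformlyOn.mul₀ hr.tendstoLocallyUniformlyOn hfc hgc
  have h' := (tendstoLocallyUniformlyOn_iff_tendstoUniformlyOn_of_compact isCompact_Icc).1 h
  refine h'.congr (Eventually.of_forall fun j t _ => ?_)
  simp

theorem const_mul (hf : IsFunctionOfOp A f S) (c : ℝ) :
    IsFunctionOfOp A (fun t => c * f t) (c • S) := by
  simpa using (const A c).mul hf

theorem pow (hf : IsFunctionOfOp A f S) (n : ℕ) :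
    IsFunctionOfOp A (fun t => f t ^ n) (S ^ n) := by
  induction n with
  | zero => simpa using one A
  | succ n ih => simpa [pow_succ] using ih.mul hf

theorem sum {ι : Type*} (s : Finset ι) {f : ι → ℝ → ℝ} {S : ι → X →L[ℝ] X}
    (h : ∀ i ∈ s, IsFunctionOfOp A (f i) (S i)) :
    IsFunctionOfOp A (fun t => ∑ i ∈ s, f i t) (∑ i ∈ s, S i) := by
  classical
  induction s using Finset.induction_on with
  | empty => simpa using const A 0
  | insert a s ha ih =>
    simp only [Finset.sum_insert ha]
    exact (h a (Finset.mem_insert_self a s)).add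
      (ih fun i hi => h i (Finset.mem_insert_of_mem hi))

/-- The approximating polynomials are partial sums of the Neumann series, which converges uniformly
on `[0, ‖A‖]` and in operator norm because `‖A‖ < 1`. -/
theorem ring_inverse_one_add (hA : ‖A‖ < 1) :
    IsFunctionOfOp A (fun t => Ring.inverse (1 + t)) (Ring.inverse (1 + A)) := by
  have hu : IsUnit (1 + A) := by
    have h : ‖-A‖ < 1 := by simpa using hA
    have := (Units.oneSub (-A) h).isUnit
    rwa [Units.val_oneSub, sub_neg_eq_add] at this
  refine ⟨fun j => ∑ i ∈ Finset.range j, (-Polynomial.X) ^ i, ?_, ?_⟩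
  · rw [Metric.tendstoUniformlyOn_iff]
    intro ε hε
    have h := (tendsto_pow_atTop_nhds_zero_of_lt_one (norm_nonneg A) hA).eventually
      (gt_mem_nhds hε)
    filter_upwards [h] with j hj t ht
    have h1 : (0 : ℝ) < 1 + t := by linarith [ht.1]
    have e : (∑ i ∈ Finset.range j, (-Polynomial.X : ℝ[X]) ^ i).eval t
        = (1 - (-t) ^ j) / (1 + t) := by
      rw [eval_finsetSum]
      simp only [eval_pow, eval_neg, eval_X]
      rw [eq_div_iff h1.ne']
      linarith [geom_sum_mul (-t) j]
    simp only [e, Ring.inverse_eq_inv', Real.dist_eq]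
    have e2 : (1 + t)⁻¹ - (1 - (-t) ^ j) / (1 + t) = (-t) ^ j / (1 + t) := by
      field_simp
      ring
    rw [e2, abs_div, abs_pow, abs_neg, abs_of_nonneg ht.1, abs_of_pos h1]
    refine lt_of_le_of_lt ?_ hj
    rw [div_le_iff₀ h1]
    have h2 : t ^ j ≤ ‖A‖ ^ j := pow_le_pow_left₀ ht.1 ht.2 j
    have h3 : (0 : ℝ) ≤ t ^ j := pow_nonneg ht.1 j
    nlinarith [ht.1]
  · have e : ∀ j, aeval A (∑ i ∈ Finset.range j, (-Polynomial.X : ℝ[X]) ^ i)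
        = Ring.inverse (1 + A) - (-A) ^ j * Ring.inverse (1 + A) := by
      intro j
      have h1 : (∑ i ∈ Finset.range j, (-A) ^ i) * (1 + A) = 1 - (-A) ^ j := by
        have := geom_sum_mul (-A) j
        rw [show (-A - 1 : X →L[ℝ] X) = -(1 + A) by abel, mul_neg, neg_eq_iff_eq_neg] at this
        rw [this]
        abel
      have h2 := congrArg (· * Ring.inverse (1 + A)) h1
      simp only [mul_assoc, Ring.mul_inverse_cancel _ hu, mul_one, sub_mul, one_mul] at h2
      simpa using h2
    simp only [e]
    have h0 : Tendsto (fun j : ℕ => (-A) ^ j) atTop (𝓝 0) :=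
      tendsto_pow_atTop_nhds_zero_of_norm_lt_one (by simpa using hA)
    simpa using tendsto_const_nhds.sub (h0.mul_const (Ring.inverse (1 + A)))

theorem commute (hf : IsFunctionOfOp A f S) (hg : IsFunctionOfOp A g R) : S * R = R * S := by
  obtain ⟨p, -, hS⟩ := hf
  obtain ⟨r, -, hR⟩ := hg
  refine tendsto_nhds_unique (hS.mul hR) ((hR.mul hS).congr fun j => ?_)
  rw [← map_mul, ← map_mul, mul_comm]

section Normal

variable {T : X →L[ℝ] Y}

/-- The approximating polynomials are nonnegative only up to a uniformly small error. Adding the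
constant `ε / (‖x‖² + 1)` repairs this and changes the quadratic form by at most `ε`. -/
theorem inner_nonneg (hf : IsFunctionOfOp (normalOp T) f S)
    (h : ∀ t ∈ Set.Icc 0 ‖normalOp T‖, 0 ≤ f t) (x : X) : 0 ≤ inner ℝ (S x) x := by
  obtain ⟨p, hp, hS⟩ := hf
  have hlim : Tendsto (fun j => inner ℝ (aeval (normalOp T) (p j) x) x) atTop
      (𝓝 (inner ℝ (S x) x)) := by
    have h1 : Tendsto (fun j => aeval (normalOp T) (p j) x) atTop (𝓝 (S x)) :=
      ((ContinuousLinearMap.apply ℝ X x).continuous.tendsto S).comp hS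
    exact h1.inner tendsto_const_nhds
  refine le_of_forall_pos_le_add fun ε hε => ?_
  have hε' : 0 < ε / (‖x‖ ^ 2 + 1) := by positivity
  rw [Metric.tendstoUniformlyOn_iff] at hp
  have hev : ∀ᶠ j in atTop, -ε ≤ inner ℝ (aeval (normalOp T) (p j) x) x := by
    filter_upwards [hp _ hε'] with j hj
    have h1 := inner_aeval_normalOp_nonneg T (p j + C (ε / (‖x‖ ^ 2 + 1)))
      (fun t ht => by
        have h2 := hj t ht
        have h3 := h t ht
        rw [Real.dist_eq, abs_lt] at h2
        simp only [eval_add, eval_C]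
        linarith) x
    simp only [map_add, aeval_C, add_apply, inner_add_left,
      Algebra.algebraMap_eq_smul_one, smul_apply,
      one_apply_eq_self, real_inner_smul_left, real_inner_self_eq_norm_sq] at h1
    have h4 : ε / (‖x‖ ^ 2 + 1) * ‖x‖ ^ 2 ≤ ε := by
      rw [div_mul_eq_mul_div, div_le_iff₀ (by positivity)]
      nlinarith
    linarith
  linarith [ge_of_tendsto hlim hev]

theorem inner_comm (hf : IsFunctionOfOp (normalOp T) f S) (x y : X) :
    inner ℝ (S x) y = inner ℝ x (S y) := by
  have key : ∀ (p : ℝ[X]) (x y : X), inner ℝ (aeval (normalOp T) p x) y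
      = inner ℝ x (aeval (normalOp T) p y) := by
    have hpow : ∀ (n : ℕ) (x y : X), inner ℝ ((normalOp T ^ n) x) y
        = inner ℝ x ((normalOp T ^ n) y) := by
      intro n
      induction n with
      | zero => simp
      | succ n ih =>
        intro x y
        rw [pow_succ', mul_apply_eq_comp, inner_normalOp_left, ← inner_normalOp_right,
          ih, ← mul_apply_eq_comp, ← pow_succ, pow_succ']
    intro p x y
    induction p using Polynomial.induction_on' with
    | add p q hp hq => simp [hp, hq, inner_add_left, inner_add_right]
    | monomial n a =>
      simp only [aeval_monomial, Algebra.algebraMap_eq_smul_one, mul_apply_eq_comp, smul_apply,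
        one_apply_eq_self, real_inner_smul_left, real_inner_smul_right, hpow]
  obtain ⟨p, -, hS⟩ := hf
  have h1 : ∀ z, Tendsto (fun j => aeval (normalOp T) (p j) z) atTop (𝓝 (S z)) := fun z =>
    ((ContinuousLinearMap.apply ℝ X z).continuous.tendsto S).comp hS
  exact tendsto_nhds_unique ((h1 x).inner tendsto_const_nhds)
    ((tendsto_const_nhds.inner (h1 y)).congr fun j => (key _ _ _).symm)

theorem norm_sq_eq (hf : IsFunctionOfOp (normalOp T) f S) (x : X) :
    ‖S x‖ ^ 2 = inner ℝ ((S * S) x) x := by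
  rw [mul_apply_eq_comp, hf.inner_comm, real_inner_self_eq_norm_sq]

theorem norm_map_sq_eq (hf : IsFunctionOfOp (normalOp T) f S) (x : X) :
    ‖T (S x)‖ ^ 2 = inner ℝ ((S * (normalOp T * S)) x) x := by
  rw [mul_apply_eq_comp, hf.inner_comm, mul_apply_eq_comp,
    inner_normalOp_left, real_inner_self_eq_norm_sq]

theorem inner_le_inner (hf : IsFunctionOfOp (normalOp T) f S)
    (hg : IsFunctionOfOp (normalOp T) g R)
    (h : ∀ t ∈ Set.Icc 0 ‖normalOp T‖, f t ≤ g t) (x : X) :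
    inner ℝ (S x) x ≤ inner ℝ (R x) x := by
  have := (hg.sub hf).inner_nonneg (fun t ht => sub_nonneg.2 (h t ht)) x
  rw [sub_apply, inner_sub_left] at this
  linarith

/-- Since `‖S x‖² = ⟨S² x, x⟩`, comparing norms amounts to comparing squares of scalar functions. In
the variants below, each `T` in front contributes a factor `t` to the square. -/
theorem norm_le_norm (hf : IsFunctionOfOp (normalOp T) f S)
    (hg : IsFunctionOfOp (normalOp T) g R)
    (h : ∀ t ∈ Set.Icc 0 ‖normalOp T‖, f t ^ 2 ≤ g t ^ 2) (x : X) : ‖S x‖ ≤ ‖R x‖ := by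
  refine (sq_le_sq₀ (norm_nonneg _) (norm_nonneg _)).1 ?_
  rw [hf.norm_sq_eq, hg.norm_sq_eq]
  exact (hf.mul hf).inner_le_inner (hg.mul hg) (fun t ht => by linarith [h t ht]) x

theorem norm_map_le_norm (hf : IsFunctionOfOp (normalOp T) f S)
    (hg : IsFunctionOfOp (normalOp T) g R)
    (h : ∀ t ∈ Set.Icc 0 ‖normalOp T‖, t * f t ^ 2 ≤ g t ^ 2) (x : X) : ‖T (S x)‖ ≤ ‖R x‖ := by
  refine (sq_le_sq₀ (norm_nonneg _) (norm_nonneg _)).1 ?_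
  rw [hf.norm_map_sq_eq, hg.norm_sq_eq]
  exact (hf.mul ((self _).mul hf)).inner_le_inner (hg.mul hg)
    (fun t ht => by linarith [h t ht]) x

theorem norm_le_norm_map (hf : IsFunctionOfOp (normalOp T) f S)
    (hg : IsFunctionOfOp (normalOp T) g R)
    (h : ∀ t ∈ Set.Icc 0 ‖normalOp T‖, f t ^ 2 ≤ t * g t ^ 2) (x : X) : ‖S x‖ ≤ ‖T (R x)‖ := by
  refine (sq_le_sq₀ (norm_nonneg _) (norm_nonneg _)).1 ?_
  rw [hf.norm_sq_eq, hg.norm_map_sq_eq]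
  exact (hf.mul hf).inner_le_inner (hg.mul ((self _).mul hg))
    (fun t ht => by linarith [h t ht]) x

theorem norm_map_le_norm_map (hf : IsFunctionOfOp (normalOp T) f S)
    (hg : IsFunctionOfOp (normalOp T) g R)
    (h : ∀ t ∈ Set.Icc 0 ‖normalOp T‖, f t ^ 2 ≤ g t ^ 2) (x : X) :
    ‖T (S x)‖ ≤ ‖T (R x)‖ := by
  refine (sq_le_sq₀ (norm_nonneg _) (norm_nonneg _)).1 ?_
  rw [hf.norm_map_sq_eq, hg.norm_map_sq_eq]
  exact (hf.mul ((self _).mul hf)).inner_le_inner (hg.mul ((self _).mul hg))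
    (fun t ht => by nlinarith [h t ht, ht.1]) x

theorem norm_apply_le {M : ℝ} (hM : 0 ≤ M) (hf : IsFunctionOfOp (normalOp T) f S)
    (h : ∀ t ∈ Set.Icc 0 ‖normalOp T‖, |f t| ≤ M) (x : X) : ‖S x‖ ≤ M * ‖x‖ := by
  have := hf.norm_le_norm (const _ M) (fun t ht => sq_le_sq.2 (by
    rw [abs_of_nonneg hM]; exact h t ht)) x
  simpa [norm_smul, abs_of_nonneg hM] using this

theorem norm_map_apply_le {M : ℝ} (hM : 0 ≤ M) (hf : IsFunctionOfOp (normalOp T) f S)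
    (h : ∀ t ∈ Set.Icc 0 ‖normalOp T‖, t * f t ^ 2 ≤ M ^ 2) (x : X) :
    ‖T (S x)‖ ≤ M * ‖x‖ := by
  have := hf.norm_map_le_norm (const _ M) h x
  simpa [norm_smul, abs_of_nonneg hM] using this

/-- The bound for `S T*` dual to `norm_map_apply_le`. -/
theorem norm_adjoint_apply_le {M : ℝ} (hM : 0 ≤ M) (hf : IsFunctionOfOp (normalOp T) f S)
    (h : ∀ t ∈ Set.Icc 0 ‖normalOp T‖, t * f t ^ 2 ≤ M ^ 2) (y : Y) :
    ‖S (ContinuousLinearMap.adjoint T y)‖ ≤ M * ‖y‖ := by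
  set w := S (ContinuousLinearMap.adjoint T y) with hw
  have h1 : ‖w‖ ^ 2 = inner ℝ y (T (S w)) := by
    rw [← ContinuousLinearMap.adjoint_inner_left, ← hf.inner_comm, ← hw,
      real_inner_self_eq_norm_sq]
  have h2 : ‖w‖ ^ 2 ≤ ‖y‖ * (M * ‖w‖) := by
    rw [h1]
    exact (real_inner_le_norm _ _).trans
      (mul_le_mul_of_nonneg_left (hf.norm_map_apply_le hM h w) (norm_nonneg _))
  rcases (norm_nonneg w).eq_or_lt with h0 | h0
  · rw [← h0]
    positivity
  · exact le_of_mul_le_mul_right (by nlinarith) h0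

/-- With `w = T* y`, the scalar bound `f · t f ≤ M f` (this uses `f ≥ 0`) gives `‖T S w‖² ≤ M ⟨S w,
w⟩ = M ⟨T S w, y⟩`. One factor `‖T S w‖` then cancels, so no calculus of `T T*` is needed. -/
theorem norm_map_adjoint_apply_le {M : ℝ} (hM : 0 ≤ M) (hf : IsFunctionOfOp (normalOp T) f S)
    (h0 : ∀ t ∈ Set.Icc 0 ‖normalOp T‖, 0 ≤ f t)
    (h : ∀ t ∈ Set.Icc 0 ‖normalOp T‖, t * f t ≤ M) (y : Y) :
    ‖T (S (ContinuousLinearMap.adjoint T y))‖ ≤ M * ‖y‖ := by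
  set w := ContinuousLinearMap.adjoint T y with hw
  have h1 : ‖T (S w)‖ ^ 2 ≤ inner ℝ ((M • S) w) w := by
    rw [hf.norm_map_sq_eq]
    exact (hf.mul ((self _).mul hf)).inner_le_inner (hf.const_mul M)
      (fun t ht => by nlinarith [h t ht, h0 t ht]) w
  have h2 : inner ℝ ((M • S) w) w = M * inner ℝ (T (S w)) y := by
    rw [smul_apply, real_inner_smul_left, hw, ContinuousLinearMap.adjoint_inner_right]
  rw [h2] at h1
  have h3 := real_inner_le_norm (T (S w)) y
  rcases (norm_nonneg (T (S w))).eq_or_lt with h4 | h4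
  · rw [← h4]
    positivity
  · exact le_of_mul_le_mul_right (by nlinarith) h4

/-- For `z = T S T* y`, the condition `0 ≤ t f ≤ 2` gives `‖z‖² ≤ 2 ⟨z, y⟩`, which is equivalent to
`‖y - z‖ ≤ ‖y‖`. -/
theorem norm_sub_map_adjoint_apply_le (hf : IsFunctionOfOp (normalOp T) f S)
    (h0 : ∀ t ∈ Set.Icc 0 ‖normalOp T‖, 0 ≤ f t)
    (h : ∀ t ∈ Set.Icc 0 ‖normalOp T‖, t * f t ≤ 2) (y : Y) :
    ‖y - T (S (ContinuousLinearMap.adjoint T y))‖ ≤ ‖y‖ := by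
  set w := ContinuousLinearMap.adjoint T y with hw
  have h1 : ‖T (S w)‖ ^ 2 ≤ inner ℝ (((2 : ℝ) • S) w) w := by
    rw [hf.norm_map_sq_eq]
    exact (hf.mul ((self _).mul hf)).inner_le_inner (hf.const_mul 2)
      (fun t ht => by nlinarith [h t ht, h0 t ht]) w
  have h2 : inner ℝ (((2 : ℝ) • S) w) w = 2 * inner ℝ (T (S w)) y := by
    rw [smul_apply, real_inner_smul_left, hw, ContinuousLinearMap.adjoint_inner_right]
  refine (sq_le_sq₀ (norm_nonneg _) (norm_nonneg _)).1 ?_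
  rw [norm_sub_sq_real, real_inner_comm]
  linarith

end Normal

end IsFunctionOfOp

end FunctionalCalculus

/-! ### The two filters as geometric sums, with their scalar and operator bounds. -/

namespace NewtonFilter

/-- The residual function of the method is a power of this base function. -/
noncomputable def base {R : Type*} [Ring R] (m : NewtonFilter) (a : R) : R :=
  match m with
  | .landweber => 1 - a
  | .lardy => Ring.inverse (1 + a)

/-- The factor `p` in `1 - s(a) = a p(a)`, where `s` is the base function. -/
noncomputable def factor {R : Type*} [Ring R] (m : NewtonFilter) (a : R) : R :=
  match m with
  | .landweber => 1
  | .lardy => Ring.inverse (1 + a)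

/-- The exponent `N` in `r_α = s ^ N` for `α = 1 / n`. -/
def order (m : NewtonFilter) (n : ℕ) : ℕ :=
  match m with
  | .landweber => n + 1
  | .lardy => n

theorem le_order (m : NewtonFilter) (n : ℕ) : n ≤ m.order n := by
  cases m <;> simp [order]

theorem order_le (m : NewtonFilter) (n : ℕ) : m.order n ≤ n + 1 := by
  cases m <;> simp [order]

theorem order_mono (m : NewtonFilter) {n k : ℕ} (h : n ≤ k) : m.order n ≤ m.order k := by
  cases m <;> simpa [order]

theorem order_add (m : NewtonFilter) (n k : ℕ) : m.order (n + k) = m.order n + k := by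
  cases m <;> simp [order]
  omega

theorem g_eq {R : Type*} [Ring R] (m : NewtonFilter) (n : ℕ) (a : R) :
    m.g (1 / (n : ℝ)) a = (∑ i ∈ Finset.range (m.order n), m.base a ^ i) * m.factor a := by
  cases m with
  | landweber => simp [g, base, factor, order]
  | lardy =>
    simp only [g, base, factor, order, one_div, inv_inv, Nat.floor_natCast, Finset.sum_mul,
      ← pow_succ]
    rw [Finset.range_eq_Ico, Finset.sum_Ico_add' (fun i => Ring.inverse (1 + a) ^ i) 0 n 1]
    congr 1

theorem one_sub_base {R : Type*} [Ring R] (m : NewtonFilter) {a : R} (ha : IsUnit (1 + a)) :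
    1 - m.base a = a * m.factor a := by
  cases m with
  | landweber => simp [base, factor]
  | lardy =>
    simp only [base, factor]
    nth_rewrite 1 [← Ring.mul_inverse_cancel _ ha]
    rw [add_mul, one_mul, add_sub_cancel_left]

/-! ### Scalar estimates on `[0, 2/9]`; the endpoint is `(√2/3)²` from the scaling condition. -/

section Real

variable {t : ℝ} (m : NewtonFilter) (h0 : 0 ≤ t) (h1 : t ≤ 2 / 9)
include h0

theorem isUnit_one_add : IsUnit (1 + t) := isUnit_iff_ne_zero.2 (by positivity)

theorem factor_nonneg : 0 ≤ m.factor t := by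
  cases m with
  | landweber => simp [factor]
  | lardy => simp only [factor, Ring.inverse_eq_inv']; positivity

theorem factor_le_one : m.factor t ≤ 1 := by
  cases m with
  | landweber => simp [factor]
  | lardy => simp only [factor, Ring.inverse_eq_inv']; exact inv_le_one_of_one_le₀ (by linarith)

theorem one_sub_le_base : 1 - t ≤ m.base t := by
  have := m.one_sub_base (isUnit_one_add h0)
  nlinarith [m.factor_le_one h0]

/-- The Lardy base dominates the Landweber base, so every decay estimate can be proved once, with
`(1 + t)⁻¹`. Lower bounds come from `one_sub_le_base`. -/
theorem base_le : m.base t ≤ (1 + t)⁻¹ := by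
  cases m with
  | landweber =>
    simp only [base]
    rw [← one_div, le_div_iff₀ (by positivity)]
    nlinarith
  | lardy => simp [base]

theorem base_le_one : m.base t ≤ 1 :=
  (m.base_le h0).trans (inv_le_one_of_one_le₀ (by linarith))

theorem mul_g (n : ℕ) : t * m.g (1 / (n : ℝ)) t = 1 - m.base t ^ m.order n := by
  rw [m.g_eq, mul_left_comm, ← m.one_sub_base (isUnit_one_add h0)]
  linarith [geom_sum_mul (m.base t) (m.order n)]

include h1

theorem half_le_base : 1 / 2 ≤ m.base t := by linarith [m.one_sub_le_base h0]

theorem base_nonneg : 0 ≤ m.base t := by linarith [m.half_le_base h0 h1]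

theorem base_pow_le_one (j : ℕ) : m.base t ^ j ≤ 1 :=
  pow_le_one₀ (m.base_nonneg h0 h1) (m.base_le_one h0)

theorem base_pow_nonneg (j : ℕ) : 0 ≤ m.base t ^ j := pow_nonneg (m.base_nonneg h0 h1) j

theorem base_pow_le (j : ℕ) : m.base t ^ j ≤ ((1 + t) ^ j)⁻¹ := by
  rw [← inv_pow]
  exact pow_le_pow_left₀ (m.base_nonneg h0 h1) (m.base_le h0) j

theorem mul_base_pow_le (j : ℕ) : t * m.base t ^ j ≤ 1 / (j + 1) := by
  have h2 := m.base_pow_le h0 h1 j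
  have h3 := one_add_mul_le_pow (show (-2 : ℝ) ≤ t by linarith) j
  have h4 : (0 : ℝ) ≤ j := Nat.cast_nonneg j
  have h5 : 0 < 1 + j * t := by positivity
  calc t * m.base t ^ j ≤ t * ((1 + t) ^ j)⁻¹ := by gcongr
    _ ≤ t * (1 + j * t)⁻¹ := by gcongr
    _ ≤ 1 / (j + 1) := by
      rw [← div_eq_mul_inv, div_le_div_iff₀ h5 (by positivity)]
      nlinarith

theorem mul_base_pow_sq_le (j : ℕ) : t * (m.base t ^ j) ^ 2 ≤ 1 / (j + 1) := by
  have h2 := m.mul_base_pow_le h0 h1 j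
  have h3 := m.base_pow_le_one h0 h1 j
  have h4 := m.base_pow_nonneg h0 h1 j
  nlinarith [mul_nonneg h0 h4]

/-- The constant `2/9` has to be this sharp because its root `√2/3` enters the admissible range of
`γ₁`. Bernoulli's inequality would only give `1/2`, hence the second-order binomial bound `hb`. -/
theorem mul_base_order_sq_le {n : ℕ} (hn : 0 < n) :
    t * (m.base t ^ m.order n) ^ 2 ≤ 2 / 9 / n := by
  have hb : ∀ k : ℕ, 1 + k * t + k * (k - 1) / 2 * t ^ 2 ≤ (1 + t) ^ k := by
    intro k
    induction k with
    | zero => simp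
    | succ k ih =>
      rw [pow_succ (1 + t)]
      push_cast
      have hk : (0 : ℝ) ≤ k * (k - 1) := by
        rcases k with _ | k
        · simp
        · push_cast
          rw [add_sub_cancel_right]
          positivity
      have h2 : 0 ≤ k * (k - 1) * t ^ 3 := by positivity
      nlinarith [mul_le_mul_of_nonneg_right ih (show 0 ≤ 1 + t by positivity)]
  have h2 : (m.base t ^ m.order n) ^ 2 ≤ ((1 + t) ^ (2 * n))⁻¹ := by
    calc (m.base t ^ m.order n) ^ 2 ≤ (m.base t ^ n) ^ 2 := by
          gcongr ?_ ^ 2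
          · exact m.base_pow_nonneg h0 h1 _
          · exact pow_le_pow_of_le_one (m.base_nonneg h0 h1) (m.base_le_one h0) (m.le_order n)
      _ ≤ (((1 + t) ^ n)⁻¹) ^ 2 := by
          gcongr ?_ ^ 2
          · exact m.base_pow_nonneg h0 h1 _
          · exact m.base_pow_le h0 h1 n
      _ = _ := by rw [inv_pow, ← pow_mul, mul_comm]
  have h3 := hb (2 * n)
  push_cast at h3
  have hn' : (0 : ℝ) < n := by exact_mod_cast hn
  have h4 : 0 < (1 + t) ^ (2 * n) := by positivity
  calc t * (m.base t ^ m.order n) ^ 2 ≤ t * ((1 + t) ^ (2 * n))⁻¹ := by gcongr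
    _ ≤ 2 / 9 / n := by
      rw [← div_eq_mul_inv, div_le_div_iff₀ h4 hn']
      have h5 : t * n * t ≤ t * n * (2 / 9) := by gcongr
      -- With `x = n t` and `t ≤ 2/9` the claim becomes `4x² - (49/9) x + 2 ≥ 0`, a quadratic that
      -- is positive at its vertex `x = 49/72`.
      nlinarith [sq_nonneg (t * n - 49 / 72)]

theorem g_nonneg (n : ℕ) : 0 ≤ m.g (1 / (n : ℝ)) t := by
  rw [m.g_eq]
  exact mul_nonneg (Finset.sum_nonneg fun i _ => m.base_pow_nonneg h0 h1 i) (m.factor_nonneg h0)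

theorem g_le {n : ℕ} (hn : 0 < n) : m.g (1 / (n : ℝ)) t ≤ 2 * n := by
  rw [m.g_eq]
  have h2 : ∑ i ∈ Finset.range (m.order n), m.base t ^ i ≤ m.order n := by
    simpa using Finset.sum_le_sum (s := Finset.range (m.order n))
      fun i _ => m.base_pow_le_one h0 h1 i
  have h3 : (m.order n : ℝ) ≤ 2 * n := by
    have := m.order_le n
    exact_mod_cast (show m.order n ≤ 2 * n by omega)
  have h4 := m.factor_le_one h0
  have h5 := m.factor_nonneg h0
  have h6 : (0 : ℝ) ≤ m.order n := Nat.cast_nonneg _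
  nlinarith

theorem mul_g_sq_le {n : ℕ} (hn : 0 < n) : t * m.g (1 / (n : ℝ)) t ^ 2 ≤ 2 * n := by
  have h2 := m.mul_g h0 n
  have h3 := m.g_nonneg h0 h1 n
  have h4 := m.g_le h0 h1 hn
  have h5 := m.base_pow_nonneg h0 h1 (m.order n)
  nlinarith

/-- Here `(n + 1) t ≤ 4/9`, so the residual does not fall below `1/2`. Applied with `n = n₀`, this
makes the initial error comparable to its residual and starts the error induction. -/
theorem half_le_base_order {n : ℕ} (hn : 0 < n) (ht : t ≤ 2 / 9 / n) :
    1 / 2 ≤ m.base t ^ m.order n := by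
  have hn' : (1 : ℝ) ≤ n := by exact_mod_cast hn
  have h2 : t * n ≤ 2 / 9 := by rwa [le_div_iff₀ (by positivity)] at ht
  have h3 : (1 - t) ^ m.order n ≤ m.base t ^ m.order n :=
    pow_le_pow_left₀ (by linarith) (m.one_sub_le_base h0) _
  have h4 : (1 - t) ^ (n + 1) ≤ (1 - t) ^ m.order n :=
    pow_le_pow_of_le_one (by linarith) (by linarith) (m.order_le n)
  have h5 := one_add_mul_le_pow (show (-2 : ℝ) ≤ -t by linarith) (n + 1)
  push_cast at h5
  rw [← sub_eq_add_neg] at h5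
  nlinarith

/-- The number `1 - s^j` lies in `[0, 1]`, so its square is at most itself, and Bernoulli bounds it
by `j (1 - s) ≤ j t`. -/
theorem one_sub_base_pow_sq_le (j : ℕ) : (1 - m.base t ^ j) ^ 2 ≤ t * j := by
  have h2 := one_add_mul_le_pow (show (-2 : ℝ) ≤ m.base t - 1 by
    linarith [m.base_nonneg h0 h1]) j
  rw [add_sub_cancel] at h2
  have h3 := m.one_sub_le_base h0
  have h4 := m.base_pow_le_one h0 h1 j
  have h5 := m.base_pow_nonneg h0 h1 j
  have h6 : (0 : ℝ) ≤ j := Nat.cast_nonneg j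
  nlinarith

end Real

/-! ### Transfer of the scalar estimates to `normalOp T`. -/

section Operator

set_option linter.unusedSectionVars false

variable {X Y : Type*} [NormedAddCommGroup X] [InnerProductSpace ℝ X] [CompleteSpace X]
  [NormedAddCommGroup Y] [InnerProductSpace ℝ Y] [CompleteSpace Y]

open ContinuousLinearMap (adjoint)

variable (m : NewtonFilter)

theorem isUnit_one_add_op {A : X →L[ℝ] X} (hA : ‖A‖ < 1) : IsUnit (1 + A) := by
  have h : ‖-A‖ < 1 := by simpa using hA
  have := (Units.oneSub (-A) h).isUnit
  rwa [Units.val_oneSub, sub_neg_eq_add] at this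

theorem isFunctionOfOp_base {A : X →L[ℝ] X} (hA : ‖A‖ < 1) :
    IsFunctionOfOp A (fun t => m.base t) (m.base A) := by
  cases m with
  | landweber => exact (IsFunctionOfOp.one A).sub (IsFunctionOfOp.self A)
  | lardy => exact IsFunctionOfOp.ring_inverse_one_add hA

theorem isFunctionOfOp_factor {A : X →L[ℝ] X} (hA : ‖A‖ < 1) :
    IsFunctionOfOp A (fun t => m.factor t) (m.factor A) := by
  cases m with
  | landweber => exact IsFunctionOfOp.one A
  | lardy => exact IsFunctionOfOp.ring_inverse_one_add hA

theorem isFunctionOfOp_g {A : X →L[ℝ] X} (hA : ‖A‖ < 1) (n : ℕ) :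
    IsFunctionOfOp A (fun t => m.g (1 / (n : ℝ)) t) (m.g (1 / (n : ℝ)) A) := by
  simp only [m.g_eq]
  exact (IsFunctionOfOp.sum _ fun i _ => (m.isFunctionOfOp_base hA).pow i).mul
    (m.isFunctionOfOp_factor hA)

theorem mul_g_op {A : X →L[ℝ] X} (hA : ‖A‖ < 1) (n : ℕ) :
    m.g (1 / (n : ℝ)) A * A = 1 - m.base A ^ m.order n := by
  have hc := (m.isFunctionOfOp_factor hA).commute (IsFunctionOfOp.self A)
  rw [m.g_eq, mul_assoc, hc, ← m.one_sub_base (isUnit_one_add_op hA), mul_sub, mul_one]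
  have := geom_sum_mul (m.base A) (m.order n)
  rw [mul_sub, mul_one] at this
  rw [← neg_sub, this, neg_sub]

variable {T : X →L[ℝ] Y} (hT : ‖normalOp T‖ ≤ 2 / 9)
include hT

theorem isFunctionOfOp_base_pow (j : ℕ) :
    IsFunctionOfOp (normalOp T) (fun t => m.base t ^ j) (m.base (normalOp T) ^ j) :=
  (m.isFunctionOfOp_base (by linarith)).pow j

theorem norm_base_pow_apply_le (j : ℕ) (x : X) : ‖(m.base (normalOp T) ^ j) x‖ ≤ ‖x‖ := by
  have := (m.isFunctionOfOp_base_pow hT j).norm_apply_le zero_le_one (fun t ht => by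
    rw [abs_of_nonneg (m.base_pow_nonneg ht.1 (ht.2.trans hT) j)]
    exact m.base_pow_le_one ht.1 (ht.2.trans hT) j) x
  simpa using this

theorem norm_factor_apply_le (x : X) : ‖m.factor (normalOp T) x‖ ≤ ‖x‖ := by
  have := (m.isFunctionOfOp_factor (by linarith : ‖normalOp T‖ < 1)).norm_apply_le zero_le_one
    (fun t ht => by
      rw [abs_of_nonneg (m.factor_nonneg ht.1)]
      exact m.factor_le_one ht.1) x
  simpa using this

theorem norm_map_base_pow_apply_le (j : ℕ) (x : X) :
    ‖T ((m.base (normalOp T) ^ j) x)‖ ≤ 1 / √(j + 1) * ‖x‖ :=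
  (m.isFunctionOfOp_base_pow hT j).norm_map_apply_le (by positivity) (fun t ht => by
    rw [div_pow, Real.sq_sqrt (by positivity), one_pow]
    exact m.mul_base_pow_sq_le ht.1 (ht.2.trans hT) j) x

theorem norm_map_base_order_apply_le {n : ℕ} (hn : 0 < n) (x : X) :
    ‖T ((m.base (normalOp T) ^ m.order n) x)‖ ≤ √2 / 3 / √n * ‖x‖ :=
  (m.isFunctionOfOp_base_pow hT _).norm_map_apply_le (by positivity) (fun t ht => by
    rw [div_pow, div_pow, Real.sq_sqrt (by positivity), Real.sq_sqrt (by positivity)]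
    norm_num
    simpa using m.mul_base_order_sq_le ht.1 (ht.2.trans hT) hn) x

theorem norm_map_base_pow_apply_le_norm_map (j : ℕ) (x : X) :
    ‖T ((m.base (normalOp T) ^ j) x)‖ ≤ ‖T x‖ :=
  (m.isFunctionOfOp_base_pow hT j).norm_map_le_norm_map (IsFunctionOfOp.one _) (fun _ ht =>
    pow_le_pow_left₀ (m.base_pow_nonneg ht.1 (ht.2.trans hT) j)
      (m.base_pow_le_one ht.1 (ht.2.trans hT) j) 2) x

/-- As `s ≥ 1/2`, extra powers lose at most a factor `2` each. Residuals whose exponents differ by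
at most `q` are therefore comparable. -/
theorem norm_le_two_pow_mul_norm_base_pow (j : ℕ) (x : X) :
    ‖x‖ ≤ 2 ^ j * ‖(m.base (normalOp T) ^ j) x‖ := by
  have := (IsFunctionOfOp.one _).norm_le_norm ((m.isFunctionOfOp_base_pow hT j).const_mul (2 ^ j))
    (fun t ht => by
      have h := m.half_le_base ht.1 (ht.2.trans hT)
      have : (1 : ℝ) ≤ 2 ^ j * m.base t ^ j := by
        rw [← mul_pow]
        exact one_le_pow₀ (by linarith)
      exact pow_le_pow_left₀ zero_le_one this 2) x
  simpa [norm_smul] using this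

theorem norm_le_two_mul_norm_base_order {n : ℕ} (hn : 0 < n) (hTn : ‖normalOp T‖ ≤ 2 / 9 / n)
    (x : X) : ‖x‖ ≤ 2 * ‖(m.base (normalOp T) ^ m.order n) x‖ := by
  have := (IsFunctionOfOp.one _).norm_le_norm
    ((m.isFunctionOfOp_base_pow hT (m.order n)).const_mul 2)
    (fun t ht => by
      have h := m.half_le_base_order ht.1 (ht.2.trans hT) hn (ht.2.trans hTn)
      exact pow_le_pow_left₀ zero_le_one (by linarith) 2) x
  simpa [norm_smul] using this

theorem norm_sub_base_pow_apply_le (j : ℕ) (x : X) :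
    ‖x - (m.base (normalOp T) ^ j) x‖ ≤ √j * ‖T x‖ := by
  have := ((IsFunctionOfOp.one _).sub (m.isFunctionOfOp_base_pow hT j)).norm_le_norm_map
    (IsFunctionOfOp.const _ (√j)) (fun t ht => by
      rw [Real.sq_sqrt (by positivity)]
      exact m.one_sub_base_pow_sq_le ht.1 (ht.2.trans hT) j) x
  simpa [norm_smul, abs_of_nonneg (Real.sqrt_nonneg _)] using this

theorem norm_sub_base_pow_apply_le_norm (j : ℕ) (x : X) :
    ‖x - (m.base (normalOp T) ^ j) x‖ ≤ ‖x‖ := by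
  have := ((IsFunctionOfOp.one _).sub (m.isFunctionOfOp_base_pow hT j)).norm_apply_le zero_le_one
    (fun t ht => by
      have h1 := m.base_pow_nonneg ht.1 (ht.2.trans hT) j
      have h2 := m.base_pow_le_one ht.1 (ht.2.trans hT) j
      rw [abs_le]
      constructor <;> linarith) x
  simpa using this

theorem norm_g_adjoint_apply_le {n : ℕ} (hn : 0 < n) (y : Y) :
    ‖m.g (1 / (n : ℝ)) (normalOp T) (adjoint T y)‖ ≤ √2 * √n * ‖y‖ :=
  (m.isFunctionOfOp_g (by linarith) n).norm_adjoint_apply_le (by positivity) (fun t ht => by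
    rw [mul_pow, Real.sq_sqrt (by positivity), Real.sq_sqrt (by positivity)]
    exact m.mul_g_sq_le ht.1 (ht.2.trans hT) hn) y

theorem norm_sub_map_g_adjoint_apply_le (n : ℕ) (y : Y) :
    ‖y - T (m.g (1 / (n : ℝ)) (normalOp T) (adjoint T y))‖ ≤ ‖y‖ :=
  (m.isFunctionOfOp_g (by linarith) n).norm_sub_map_adjoint_apply_le
    (fun t ht => m.g_nonneg ht.1 (ht.2.trans hT) n) (fun t ht => by
      rw [m.mul_g ht.1]
      linarith [m.base_pow_nonneg ht.1 (ht.2.trans hT) (m.order n)]) y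

theorem norm_map_base_pow_adjoint_apply_le (j : ℕ) (y : Y) :
    ‖T ((m.base (normalOp T) ^ j) (adjoint T y))‖ ≤ 1 / (j + 1) * ‖y‖ :=
  (m.isFunctionOfOp_base_pow hT j).norm_map_adjoint_apply_le (by positivity)
    (fun t ht => m.base_pow_nonneg ht.1 (ht.2.trans hT) j)
    (fun t ht => m.mul_base_pow_le ht.1 (ht.2.trans hT) j) y

theorem norm_base_pow_adjoint_apply_le (j : ℕ) (y : Y) :
    ‖(m.base (normalOp T) ^ j) (adjoint T y)‖ ≤ 1 / √(j + 1) * ‖y‖ :=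
  (m.isFunctionOfOp_base_pow hT j).norm_adjoint_apply_le (by positivity) (fun t ht => by
    rw [div_pow, Real.sq_sqrt (by positivity), one_pow]
    exact m.mul_base_pow_sq_le ht.1 (ht.2.trans hT) j) y

theorem norm_base_pow_mul_one_sub_apply_le (j : ℕ) (x : X) :
    ‖(m.base (normalOp T) ^ j * (1 - m.base (normalOp T))) x‖ ≤ 1 / (j + 1) * ‖x‖ := by
  refine ((m.isFunctionOfOp_base_pow hT j).mul ((IsFunctionOfOp.one _).sub
    (m.isFunctionOfOp_base (by linarith)))).norm_apply_le (by positivity) (fun t ht => ?_) x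
  have h1 := m.base_pow_nonneg ht.1 (ht.2.trans hT) j
  have h2 := m.base_le_one ht.1
  have h3 := m.one_sub_le_base ht.1
  have h4 := m.mul_base_pow_le ht.1 (ht.2.trans hT) j
  rw [abs_of_nonneg (mul_nonneg h1 (by linarith))]
  nlinarith

/-- Bounds for `‖p(A) s(A)^j T*‖`, where `p` is the factor and `s` the base function. -/
theorem norm_base_pow_factor_adjoint_apply_le (j : ℕ) (y : Y) :
    ‖(m.base (normalOp T) ^ j * m.factor (normalOp T)) (adjoint T y)‖ ≤ 1 / √(j + 1) * ‖y‖ := by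
  refine ((m.isFunctionOfOp_base_pow hT j).mul
    (m.isFunctionOfOp_factor (by linarith))).norm_adjoint_apply_le (by positivity)
    (fun t ht => ?_) y
  rw [div_pow, Real.sq_sqrt (by positivity), one_pow]
  have h1 := m.mul_base_pow_sq_le ht.1 (ht.2.trans hT) j
  have h2 := m.factor_nonneg ht.1
  have h3 := m.factor_le_one ht.1
  have h4 : 0 ≤ t * (m.base t ^ j) ^ 2 := mul_nonneg ht.1 (sq_nonneg _)
  have h5 : m.factor t ^ 2 ≤ 1 := pow_le_one₀ h2 h3
  calc t * (m.base t ^ j * m.factor t) ^ 2 = t * (m.base t ^ j) ^ 2 * m.factor t ^ 2 := by ring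
    _ ≤ t * (m.base t ^ j) ^ 2 * 1 := by gcongr
    _ ≤ _ := by linarith

theorem norm_map_base_pow_factor_adjoint_apply_le (j : ℕ) (y : Y) :
    ‖T ((m.base (normalOp T) ^ j * m.factor (normalOp T)) (adjoint T y))‖
      ≤ 1 / (j + 1) * ‖y‖ := by
  refine ((m.isFunctionOfOp_base_pow hT j).mul
    (m.isFunctionOfOp_factor (by linarith))).norm_map_adjoint_apply_le (by positivity)
    (fun t ht => mul_nonneg (m.base_pow_nonneg ht.1 (ht.2.trans hT) j) (m.factor_nonneg ht.1))
    (fun t ht => ?_) y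
  have h1 := m.mul_base_pow_le ht.1 (ht.2.trans hT) j
  have h2 := m.factor_nonneg ht.1
  have h3 := m.factor_le_one ht.1
  have h4 : 0 ≤ t * m.base t ^ j := mul_nonneg ht.1 (m.base_pow_nonneg ht.1 (ht.2.trans hT) j)
  nlinarith

theorem norm_sub_map_factor_adjoint_apply_le (y : Y) :
    ‖y - T (m.factor (normalOp T) (adjoint T y))‖ ≤ ‖y‖ :=
  (m.isFunctionOfOp_factor (by linarith)).norm_sub_map_adjoint_apply_le
    (fun t ht => m.factor_nonneg ht.1) (fun t ht => by
      have h1 := m.factor_le_one ht.1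
      have h2 := m.factor_nonneg ht.1
      have h3 := ht.2.trans hT
      nlinarith [ht.1]) y

end Operator

end NewtonFilter

/-! ### Telescoping sums for differences of powers. -/

section Telescoping

variable {X Z : Type*} [NormedAddCommGroup X] [NormedSpace ℝ X] [NormedAddCommGroup Z]
  [NormedSpace ℝ Z]

theorem pow_sub_pow_eq_sum {R : Type*} [Ring R] (a b : R) (N : ℕ) :
    b ^ N - a ^ N = ∑ j ∈ Finset.range N, a ^ j * (b - a) * b ^ (N - 1 - j) := by
  have h := Finset.sum_range_sub' (fun j => a ^ j * b ^ (N - j)) N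
  simp only [Nat.sub_zero, pow_zero, one_mul, Nat.sub_self, mul_one] at h
  rw [← h]
  refine Finset.sum_congr rfl fun j hj => ?_
  have hj' := Finset.mem_range.1 hj
  rw [show N - j = (N - 1 - j) + 1 by omega, show N - (j + 1) = N - 1 - j by omega, pow_succ' b,
    pow_succ a]
  noncomm_ring

variable {S : X →L[ℝ] X} {R : Z →L[ℝ] Z}

theorem ContinuousLinearMap.norm_comp_comp_le {M₁ M₂ : ℝ} (B : X →L[ℝ] X) (G : Z →L[ℝ] X)
    (C : Z →L[ℝ] Z) (h₁ : ‖B‖ ≤ M₁) (h₂ : ‖C‖ ≤ M₂) :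
    ‖B ∘L G ∘L C‖ ≤ M₁ * M₂ * ‖G‖ := by
  have h3 : 0 ≤ M₁ := (norm_nonneg _).trans h₁
  calc ‖B ∘L G ∘L C‖ ≤ ‖B‖ * (‖G‖ * ‖C‖) :=
        (B.opNorm_comp_le _).trans
          (mul_le_mul_of_nonneg_left (G.opNorm_comp_le C) (norm_nonneg _))
    _ ≤ M₁ * (‖G‖ * M₂) := by gcongr
    _ = _ := by ring

/-- Summation by parts: the difference factor moves from `S` on the left to `R` on the right, at the
price of two boundary terms. -/
theorem sum_left_sub_sum_right (G : Z →L[ℝ] X) {N k : ℕ} (hk : k ≤ N) :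
    ∑ j ∈ Finset.range k, (S ^ j * (1 - S)) ∘L G ∘L (R ^ (N - 1 - j))
      = ∑ j ∈ Finset.range k, (S ^ j) ∘L G ∘L (R ^ (N - 1 - j) * (1 - R))
        + (G ∘L (R ^ N) - (S ^ k) ∘L G ∘L (R ^ (N - k))) := by
  have h := Finset.sum_range_sub' (fun j => (S ^ j) ∘L G ∘L (R ^ (N - j))) k
  have e : (S ^ 0) ∘L G ∘L (R ^ (N - 0)) = G ∘L (R ^ N) := by
    rw [pow_zero, Nat.sub_zero]
    rfl
  rw [e] at h
  rw [← h, ← Finset.sum_add_distrib]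
  refine Finset.sum_congr rfl fun j hj => ?_
  have hj' := Finset.mem_range.1 hj
  rw [show N - j = (N - 1 - j) + 1 by omega, show N - (j + 1) = N - 1 - j by omega, pow_succ R,
    pow_succ S, mul_sub, mul_sub, mul_one, mul_one]
  simp only [ContinuousLinearMap.sub_comp, ContinuousLinearMap.comp_sub]
  abel

variable (hS : ∀ j : ℕ, ‖S ^ j‖ ≤ 1) (hR : ∀ j : ℕ, ‖R ^ j‖ ≤ 1)
  (hS' : ∀ j : ℕ, ‖S ^ j * (1 - S)‖ ≤ 1 / (j + 1))
  (hR' : ∀ j : ℕ, ‖R ^ j * (1 - R)‖ ≤ 1 / (j + 1))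
include hS hR hS' hR'

/-- Termwise bounds `1/(j+1)` would only give `log N`. For `j` in the upper half the at most `k + 1`
terms are each at most `‖G‖/(k+1)`. In the lower half summation by parts moves the difference to
`R`, whose exponent is at least `k` there. The constant is `1` for each half plus `2` for the
boundary terms. -/
theorem norm_sum_left_le (G : Z →L[ℝ] X) (N : ℕ) :
    ‖∑ j ∈ Finset.range N, (S ^ j * (1 - S)) ∘L G ∘L (R ^ (N - 1 - j))‖ ≤ 4 * ‖G‖ := by
  have hG := norm_nonneg G
  obtain ⟨k, hk1, hk2⟩ : ∃ k, 2 * k ≤ N ∧ N ≤ 2 * k + 1 := ⟨N / 2, by omega, by omega⟩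
  have hkN : k ≤ N := by omega
  rw [← Finset.sum_range_add_sum_Ico _ hkN, sum_left_sub_sum_right G hkN]
  have h1 : ‖∑ j ∈ Finset.range k, (S ^ j) ∘L G ∘L (R ^ (N - 1 - j) * (1 - R))‖ ≤ ‖G‖ := by
    have h : ∀ j ∈ Finset.range k, ‖(S ^ j) ∘L G ∘L (R ^ (N - 1 - j) * (1 - R))‖
        ≤ 1 / ((k : ℝ) + 1) * ‖G‖ := by
      intro j hj
      have hj' := Finset.mem_range.1 hj
      refine (ContinuousLinearMap.norm_comp_comp_le _ G _ (hS j) (hR' _)).trans ?_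
      rw [one_mul]
      gcongr
      exact_mod_cast (show k ≤ N - 1 - j by omega)
    refine (norm_sum_le_of_le _ h).trans ?_
    rw [Finset.sum_const, Finset.card_range, nsmul_eq_mul, ← mul_assoc, mul_one_div]
    refine mul_le_of_le_one_left hG ?_
    rw [div_le_one (by positivity)]
    linarith
  have h2 : ‖G ∘L (R ^ N)‖ ≤ ‖G‖ :=
    (G.opNorm_comp_le _).trans (mul_le_of_le_one_right hG (hR N))
  have h3 : ‖(S ^ k) ∘L G ∘L (R ^ (N - k))‖ ≤ ‖G‖ := by
    simpa using ContinuousLinearMap.norm_comp_comp_le _ G _ (hS k) (hR (N - k))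
  have h4 : ‖∑ j ∈ Finset.Ico k N, (S ^ j * (1 - S)) ∘L G ∘L (R ^ (N - 1 - j))‖ ≤ ‖G‖ := by
    have h : ∀ j ∈ Finset.Ico k N, ‖(S ^ j * (1 - S)) ∘L G ∘L (R ^ (N - 1 - j))‖
        ≤ 1 / ((k : ℝ) + 1) * ‖G‖ := by
      intro j hj
      have hj' := Finset.mem_Ico.1 hj
      refine (ContinuousLinearMap.norm_comp_comp_le _ G _ (hS' j) (hR _)).trans ?_
      rw [mul_one]
      gcongr
      exact hj'.1
    refine (norm_sum_le_of_le _ h).trans ?_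
    rw [Finset.sum_const, Nat.card_Ico, nsmul_eq_mul, ← mul_assoc, mul_one_div]
    refine mul_le_of_le_one_left hG ?_
    rw [div_le_one (by positivity)]
    exact_mod_cast (show N - k ≤ k + 1 by omega)
  calc _ ≤ ‖∑ j ∈ Finset.range k, (S ^ j) ∘L G ∘L (R ^ (N - 1 - j) * (1 - R))‖
        + (‖G ∘L (R ^ N)‖ + ‖(S ^ k) ∘L G ∘L (R ^ (N - k))‖)
        + ‖∑ j ∈ Finset.Ico k N, (S ^ j * (1 - S)) ∘L G ∘L (R ^ (N - 1 - j))‖ := by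
          refine (norm_add_le _ _).trans (add_le_add_left ((norm_add_le _ _).trans ?_) _)
          exact add_le_add_right (norm_sub_le _ _) _
    _ ≤ _ := by linarith

/-- Summation by parts over the full range reduces this to the left version: `6 = 4 + 1 + 1`. -/
theorem norm_sum_right_le (G : Z →L[ℝ] X) (N : ℕ) :
    ‖∑ j ∈ Finset.range N, (S ^ j) ∘L G ∘L (R ^ (N - 1 - j) * (1 - R))‖ ≤ 6 * ‖G‖ := by
  have hG := norm_nonneg G
  have h0 := norm_sum_left_le hS hR hS' hR' G N
  have h2 : ‖G ∘L (R ^ N)‖ ≤ ‖G‖ :=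
    (G.opNorm_comp_le _).trans (mul_le_of_le_one_right hG (hR N))
  have h3 : ‖(S ^ N) ∘L G ∘L (R ^ (N - N))‖ ≤ ‖G‖ := by
    simpa using ContinuousLinearMap.norm_comp_comp_le _ G _ (hS N) (hR (N - N))
  rw [eq_sub_of_add_eq (sum_left_sub_sum_right (S := S) (R := R) G (le_refl N)).symm]
  refine (norm_sub_le _ _).trans ?_
  linarith [norm_sub_le (G ∘L (R ^ N)) ((S ^ N) ∘L G ∘L (R ^ (N - N)))]

end Telescoping

theorem sum_one_div_sqrt_le (N : ℕ) :
    ∑ j ∈ Finset.range N, 1 / √((j : ℝ) + 1) ≤ 2 * √N := by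
  induction N with
  | zero => simp
  | succ N ih =>
    rw [Finset.sum_range_succ]
    have h1 : 0 < √((N : ℝ) + 1) := by positivity
    have h2 : √(N : ℝ) ^ 2 = N := Real.sq_sqrt (by positivity)
    have h3 : √((N : ℝ) + 1) ^ 2 = N + 1 := Real.sq_sqrt (by positivity)
    have h4 : 1 / √((N : ℝ) + 1) ≤ 2 * (√((N : ℝ) + 1) - √N) := by
      rw [div_le_iff₀ h1]
      nlinarith [sq_nonneg (√((N : ℝ) + 1) - √N)]
    push_cast
    linarith

/-- A discrete Beta integral, bounded independently of `N`. With `a = j + 1` and `b = N - j` one has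
`a + b = N + 1`, so each product is at most `2/√N` times `1/√a + 1/√b`, and each of the two sums is
at most `2√N`. -/
theorem sum_one_div_sqrt_mul_le (N : ℕ) :
    ∑ j ∈ Finset.range N, 1 / √((j : ℝ) + 1) * (1 / √((N - 1 - j : ℕ) + 1)) ≤ 8 := by
  rcases Nat.eq_zero_or_pos N with rfl | hN
  · simp
  have hN' : (0 : ℝ) < √N := by positivity
  have key : ∀ j ∈ Finset.range N, 1 / √((j : ℝ) + 1) * (1 / √((N - 1 - j : ℕ) + 1))
      ≤ 2 / √N * (1 / √((j : ℝ) + 1) + 1 / √((N - 1 - j : ℕ) + 1)) := by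
    intro j hj
    have hj' := Finset.mem_range.1 hj
    have hs : ((j : ℝ) + 1) + ((N - 1 - j : ℕ) + 1) = N + 1 := by
      exact_mod_cast (show j + 1 + (N - 1 - j + 1) = N + 1 by omega)
    generalize ((N - 1 - j : ℕ) : ℝ) + 1 = b at *
    have hb : 0 < b := by
      have : ((j : ℝ)) + 1 ≤ N := by exact_mod_cast hj'
      linarith
    have ha : (0 : ℝ) < j + 1 := by positivity
    generalize (j : ℝ) + 1 = a at *
    have hN2 : √(N : ℝ) ^ 2 = N := Real.sq_sqrt (by positivity)
    have ha2 : √a ^ 2 = a := Real.sq_sqrt ha.le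
    have hb2 : √b ^ 2 = b := Real.sq_sqrt hb.le
    have ha3 : 0 < √a := Real.sqrt_pos.2 ha
    have hb3 : 0 < √b := Real.sqrt_pos.2 hb
    have h : √N ≤ 2 * (√a + √b) := by nlinarith
    have e : 2 / √N * (1 / √a + 1 / √b) - 1 / √a * (1 / √b)
        = (2 * (√a + √b) - √N) / (√N * √a * √b) := by
      field_simp
      ring
    have : 0 ≤ (2 * (√a + √b) - √N) / (√N * √a * √b) := div_nonneg (by linarith) (by positivity)
    linarith
  refine (Finset.sum_le_sum key).trans ?_
  rw [← Finset.mul_sum, Finset.sum_add_distrib]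
  have h2 := Finset.sum_range_reflect (fun j : ℕ => 1 / √((j : ℝ) + 1)) N
  rw [h2]
  have h1 := sum_one_div_sqrt_le N
  calc 2 / √N * (∑ j ∈ Finset.range N, 1 / √((j : ℝ) + 1)
        + ∑ j ∈ Finset.range N, 1 / √((j : ℝ) + 1)) ≤ 2 / √N * (2 * √N + 2 * √N) := by gcongr
    _ = 8 := by field_simp; norm_num

/-! ### Perturbation of the residual operator. -/

namespace NewtonFilter

open ContinuousLinearMap (adjoint)

variable {X Y : Type*} [NormedAddCommGroup X] [InnerProductSpace ℝ X] [CompleteSpace X]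
  [NormedAddCommGroup Y] [InnerProductSpace ℝ Y] [CompleteSpace Y] (m : NewtonFilter)

/-- In the Lardy case this is the resolvent identity. -/
theorem base_sub_base {R : Type*} [Ring R] {a b : R} (ha : IsUnit (1 + a)) (hb : IsUnit (1 + b)) :
    m.base b - m.base a = -(m.factor a * (b - a) * m.factor b) := by
  cases m with
  | landweber => simp [base, factor]
  | lardy =>
    simp only [base, factor]
    have e : b - a = (1 + b) - (1 + a) := by abel
    rw [e, mul_sub, sub_mul, Ring.inverse_mul_cancel _ ha, mul_assoc, Ring.mul_inverse_cancel _ hb]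
    simp

variable {T T' : X →L[ℝ] Y} (hT : ‖normalOp T‖ ≤ 2 / 9) (hT' : ‖normalOp T'‖ ≤ 2 / 9)

theorem norm_base_pow_le (hT : ‖normalOp T‖ ≤ 2 / 9) (j : ℕ) :
    ‖m.base (normalOp T) ^ j‖ ≤ 1 :=
  ContinuousLinearMap.opNorm_le_bound _ zero_le_one fun x => by
    simpa only [one_mul] using m.norm_base_pow_apply_le hT j x

theorem norm_factor_le (hT : ‖normalOp T‖ ≤ 2 / 9) : ‖m.factor (normalOp T)‖ ≤ 1 :=
  ContinuousLinearMap.opNorm_le_bound _ zero_le_one fun x => by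
    simpa only [one_mul] using m.norm_factor_apply_le hT x

theorem norm_base_pow_mul_one_sub_le (hT : ‖normalOp T‖ ≤ 2 / 9) (j : ℕ) :
    ‖m.base (normalOp T) ^ j * (1 - m.base (normalOp T))‖ ≤ 1 / (j + 1) :=
  ContinuousLinearMap.opNorm_le_bound _ (by positivity)
    (m.norm_base_pow_mul_one_sub_apply_le hT j)

include hT hT'

/-- Perturbation of the residual operator under range invariance of the derivative. -/
theorem norm_base_pow_sub_base_pow_apply_le {R R' : X →L[ℝ] X} {κ : ℝ}
    (hR : T' = T ∘L R) (hR' : T = T' ∘L R') (h : ‖1 - R‖ ≤ κ) (h' : ‖1 - R'‖ ≤ κ) (N : ℕ) (x : X) :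
    ‖(m.base (normalOp T') ^ N - m.base (normalOp T) ^ N) x‖ ≤ 10 * κ * ‖x‖ := by
  set S := m.base (normalOp T) with hS
  set S' := m.base (normalOp T') with hS'
  set P := m.factor (normalOp T) with hP
  set P' := m.factor (normalOp T') with hP'
  have hu := isUnit_one_add_op (show ‖normalOp T‖ < 1 by linarith)
  have hu' := isUnit_one_add_op (show ‖normalOp T'‖ < 1 by linarith)
  -- Each term carries either `A` on the left or `A'` on the right. Together with the factors `P`,
  -- `P'` these become `1 - S` and `1 - S'`, exactly the shape of the two telescoping sums
  -- (constants `4` and `6`).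
  have hA : normalOp T' - normalOp T
      = normalOp T * (R - 1) - adjoint (R' - 1) * normalOp T' := by
    have e1 : normalOp T * R = adjoint T ∘L T' := by rw [hR]; rfl
    have e2 : adjoint R' * normalOp T' = adjoint T ∘L T' := by
      have : adjoint T = adjoint R' ∘L adjoint T' := by
        rw [← ContinuousLinearMap.adjoint_comp, ← hR']
      rw [this]
      rfl
    have e3 : adjoint (1 : X →L[ℝ] X) = 1 := ContinuousLinearMap.adjoint_id
    rw [mul_sub, map_sub, e3, sub_mul, e1, e2]
    simp
  have hc : P * normalOp T = normalOp T * P :=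
    (m.isFunctionOfOp_factor (by linarith)).commute (IsFunctionOfOp.self _)
  have hd : S' - S = (1 - S) * ((1 - R) * P') + P * adjoint (R' - 1) * (1 - S') := by
    rw [hS', hS, m.base_sub_base hu hu', m.one_sub_base hu, m.one_sub_base hu', hA, ← hP, ← hP',
      ← hc]
    noncomm_ring
  have hsum : S' ^ N - S ^ N
      = ∑ j ∈ Finset.range N, (S ^ j * (1 - S)) ∘L ((1 - R) * P') ∘L (S' ^ (N - 1 - j))
        + ∑ j ∈ Finset.range N, (S ^ j) ∘L (P * adjoint (R' - 1)) ∘L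
          (S' ^ (N - 1 - j) * (1 - S')) := by
    rw [pow_sub_pow_eq_sum, ← Finset.sum_add_distrib]
    refine Finset.sum_congr rfl fun j _ => ?_
    have hcomm : S' ^ (N - 1 - j) * (1 - S') = (1 - S') * S' ^ (N - 1 - j) := by
      rw [mul_sub, sub_mul, mul_one, one_mul, ← pow_succ, ← pow_succ']
    rw [hd, hcomm]
    change _ = (S ^ j * (1 - S)) * (((1 - R) * P') * (S' ^ (N - 1 - j)))
      + (S ^ j) * ((P * adjoint (R' - 1)) * ((1 - S') * S' ^ (N - 1 - j)))
    noncomm_ring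
  have hκ : 0 ≤ κ := (norm_nonneg _).trans h
  have h1 : ‖(1 - R) * P'‖ ≤ κ := (norm_mul_le _ _).trans
    ((mul_le_of_le_one_right (norm_nonneg _) (m.norm_factor_le hT')).trans h)
  have h2 : ‖P * adjoint (R' - 1)‖ ≤ κ := by
    refine (norm_mul_le _ _).trans
      ((mul_le_of_le_one_left (norm_nonneg _) (m.norm_factor_le hT)).trans ?_)
    rwa [LinearIsometryEquiv.norm_map, norm_sub_rev]
  have h3 : ‖S' ^ N - S ^ N‖ ≤ 10 * κ := by
    rw [hsum]
    have b1 := norm_sum_left_le (m.norm_base_pow_le hT) (m.norm_base_pow_le hT')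
      (m.norm_base_pow_mul_one_sub_le hT) (m.norm_base_pow_mul_one_sub_le hT') ((1 - R) * P') N
    have b2 := norm_sum_right_le (m.norm_base_pow_le hT) (m.norm_base_pow_le hT')
      (m.norm_base_pow_mul_one_sub_le hT) (m.norm_base_pow_mul_one_sub_le hT')
      (P * adjoint (R' - 1)) N
    refine (norm_add_le _ _).trans ?_
    linarith
  exact ((S' ^ N - S ^ N).le_opNorm x).trans (by gcongr)

/-- Perturbation of the residual operator on the range of `T*`. -/
theorem norm_base_pow_sub_base_pow_adjoint_apply_le (N : ℕ) (u : Y) :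
    ‖(m.base (normalOp T') ^ N - m.base (normalOp T) ^ N) (adjoint T u)‖
      ≤ 16 * ‖T' - T‖ * ‖u‖ := by
  set S := m.base (normalOp T) with hS
  set S' := m.base (normalOp T') with hS'
  set P := m.factor (normalOp T) with hP
  set P' := m.factor (normalOp T') with hP'
  set D := T' - T with hD
  have hu := isUnit_one_add_op (show ‖normalOp T‖ < 1 by linarith)
  have hu' := isUnit_one_add_op (show ‖normalOp T'‖ < 1 by linarith)
  -- `Q` plays the role of `s(T'T'*)` on `Y`; it intertwines with `S'` through `T'*` and inherits
  -- the contraction and difference bounds.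
  set Q : Y →L[ℝ] Y := 1 - T' ∘L P' ∘L adjoint T' with hQ
  have hA : normalOp T' - normalOp T = adjoint T ∘L D + adjoint D ∘L T' := by
    rw [hD, map_sub]
    simp only [normalOp, ContinuousLinearMap.comp_sub, ContinuousLinearMap.sub_comp]
    abel
  have hcP : ∀ i : ℕ, P' * S' ^ i = S' ^ i * P' := fun i =>
    (m.isFunctionOfOp_factor (by linarith)).commute (m.isFunctionOfOp_base_pow hT' i)
  have hcS : ∀ i : ℕ, P * S ^ i = S ^ i * P := fun i =>
    (m.isFunctionOfOp_factor (by linarith)).commute (m.isFunctionOfOp_base_pow hT i)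
  have hint : ∀ i : ℕ, (S' ^ i) ∘L adjoint T' = adjoint T' ∘L (Q ^ i) := by
    have h1 : S' ∘L adjoint T' = adjoint T' ∘L Q := by
      have : S' = 1 - normalOp T' * P' := by rw [← m.one_sub_base hu', ← hS', sub_sub_cancel]
      rw [this, hQ, ContinuousLinearMap.sub_comp, ContinuousLinearMap.comp_sub]
      rfl
    intro i
    induction i with
    | zero => rfl
    | succ i ih =>
      calc (S' ^ (i + 1)) ∘L adjoint T' = (S' ^ i) ∘L (S' ∘L adjoint T') := by
            rw [pow_succ]; rfl
        _ = ((S' ^ i) ∘L adjoint T') ∘L Q := by rw [h1]; rfl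
        _ = _ := by rw [ih, pow_succ]; rfl
  have hQi : ∀ i : ℕ, (T' ∘L (S' ^ i * P') ∘L adjoint T') = Q ^ i * (1 - Q) := by
    intro i
    have e : Q ^ i * (1 - Q) = (1 - Q) * Q ^ i := by
      rw [mul_sub, sub_mul, mul_one, one_mul, ← pow_succ, ← pow_succ']
    rw [e, ← hcP]
    have : (1 - Q) = T' ∘L P' ∘L adjoint T' := by rw [hQ, sub_sub_cancel]
    rw [this]
    change T' ∘L P' ∘L ((S' ^ i) ∘L adjoint T') = T' ∘L P' ∘L (adjoint T' ∘L (Q ^ i))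
    rw [hint]
  have hQ1 : ∀ i : ℕ, ‖Q ^ i‖ ≤ 1 := by
    have h : ‖Q‖ ≤ 1 := ContinuousLinearMap.opNorm_le_bound _ zero_le_one fun y => by
      rw [one_mul]
      exact m.norm_sub_map_factor_adjoint_apply_le hT' y
    intro i
    induction i with
    | zero => exact ContinuousLinearMap.norm_id_le
    | succ i ih =>
      rw [pow_succ]
      exact (norm_mul_le _ _).trans (mul_le_one₀ ih (norm_nonneg _) h)
  have hQ2 : ∀ i : ℕ, ‖Q ^ i * (1 - Q)‖ ≤ 1 / (i + 1) := fun i => by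
    rw [← hQi]
    exact ContinuousLinearMap.opNorm_le_bound _ (by positivity)
      (m.norm_map_base_pow_factor_adjoint_apply_le hT' i)
  -- With `T'*` next to the powers of `S'` a half power of decay becomes available. The correction
  -- `D* u` is bounded trivially by `2‖D‖‖u‖`, and the two parts of the telescoped sum contribute
  -- `8` (Beta-type sum) and `6` (summation by parts), in total `16`.
  have hsplit : adjoint T u = adjoint T' u - adjoint D u := by
    rw [hD, map_sub, sub_apply, sub_sub_cancel]
  have b0 : ‖(S' ^ N - S ^ N) (adjoint D u)‖ ≤ 2 * ‖D‖ * ‖u‖ := by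
    have h1 := m.norm_base_pow_apply_le hT N (adjoint D u)
    have h2 := m.norm_base_pow_apply_le hT' N (adjoint D u)
    have h3 := (adjoint D).le_opNorm u
    rw [LinearIsometryEquiv.norm_map] at h3
    rw [sub_apply]
    refine (norm_sub_le _ _).trans ?_
    linarith
  have hsum : (S' ^ N - S ^ N) (adjoint T' u)
      = -(∑ j ∈ Finset.range N, (S ^ j * P) (adjoint T (D ((S' ^ (N - 1 - j) * P')
          (adjoint T' u))))
        + (∑ j ∈ Finset.range N, (S ^ j) ∘L (P ∘L adjoint D) ∘L
          (Q ^ (N - 1 - j) * (1 - Q))) u) := by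
    rw [pow_sub_pow_eq_sum, sum_apply, sum_apply,
      ← Finset.sum_add_distrib, ← Finset.sum_neg_distrib]
    refine Finset.sum_congr rfl fun j _ => ?_
    rw [hS', hS, m.base_sub_base hu hu', hA, ← hP, ← hP', ← hS, ← hS', ← hQi, ← hcP]
    simp only [mul_apply_eq_comp, neg_apply, map_neg, ContinuousLinearMap.comp_apply, add_apply,
      map_add]
  have b1 : ‖∑ j ∈ Finset.range N, (S ^ j * P) (adjoint T (D ((S' ^ (N - 1 - j) * P')
      (adjoint T' u))))‖ ≤ 8 * ‖D‖ * ‖u‖ := by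
    have h : ∀ j ∈ Finset.range N, ‖(S ^ j * P) (adjoint T (D ((S' ^ (N - 1 - j) * P')
        (adjoint T' u))))‖ ≤ 1 / √((j : ℝ) + 1) * (1 / √((N - 1 - j : ℕ) + 1)) * (‖D‖ * ‖u‖) := by
      intro j _
      refine (m.norm_base_pow_factor_adjoint_apply_le hT j _).trans ?_
      have h2 := m.norm_base_pow_factor_adjoint_apply_le hT' (N - 1 - j) u
      have h3 := D.le_opNorm ((S' ^ (N - 1 - j) * P') (adjoint T' u))
      calc _ ≤ 1 / √((j : ℝ) + 1) * (‖D‖ * (1 / √((N - 1 - j : ℕ) + 1) * ‖u‖)) := by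
            refine mul_le_mul_of_nonneg_left (h3.trans ?_) (by positivity)
            exact mul_le_mul_of_nonneg_left h2 (norm_nonneg _)
        _ = _ := by ring
    refine (norm_sum_le_of_le _ h).trans ?_
    rw [← Finset.sum_mul, mul_assoc]
    exact mul_le_mul_of_nonneg_right (sum_one_div_sqrt_mul_le N) (by positivity)
  have b2 : ‖(∑ j ∈ Finset.range N, (S ^ j) ∘L (P ∘L adjoint D) ∘L
      (Q ^ (N - 1 - j) * (1 - Q))) u‖ ≤ 6 * ‖D‖ * ‖u‖ := by
    have h := norm_sum_right_le (m.norm_base_pow_le hT) hQ1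
      (m.norm_base_pow_mul_one_sub_le hT) hQ2 (P ∘L adjoint D) N
    have h2 : ‖P ∘L adjoint D‖ ≤ ‖D‖ := by
      refine (P.opNorm_comp_le _).trans
        ((mul_le_of_le_one_left (norm_nonneg _) (m.norm_factor_le hT)).trans ?_)
      rw [LinearIsometryEquiv.norm_map]
    refine (ContinuousLinearMap.le_opNorm _ u).trans ?_
    gcongr
    linarith
  rw [hsplit, map_sub, hsum]
  refine (norm_sub_le _ _).trans ?_
  rw [norm_neg]
  linarith [norm_add_le (∑ j ∈ Finset.range N, (S ^ j * P) (adjoint T (D ((S' ^ (N - 1 - j) * P')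
      (adjoint T' u))))) ((∑ j ∈ Finset.range N, (S ^ j) ∘L (P ∘L adjoint D) ∘L
      (Q ^ (N - 1 - j) * (1 - Q))) u)]

end NewtonFilter

/-! ### Convergence and rates from an oracle inequality. -/

/-- An oracle inequality for the error `E` at noise level `δ`, where `σ m` is the norm of the
residual of the initial error after `m` steps. -/
def OracleBound (σ : ℕ → ℝ) (C δ E : ℝ) : Prop :=
  ∃ N : ℕ, (∀ m ≥ N, E ≤ C * (σ m + √m * δ)) ∧
    (N = 0 ∨ ∃ M : ℕ, (N : ℝ) ≤ C * (M + 1) ∧ √((M : ℝ) + 1) * δ ≤ C * σ M)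

/-- With `r = max (2μ) 1` one has `1 + log x ≤ r x^{1/r}`, and `μ/r ≤ 1/2`. -/
theorem one_add_log_rpow_le {μ : ℝ} (hμ : 0 < μ) :
    ∃ p : ℝ, 0 < p ∧ ∀ x : ℝ, 1 ≤ x → (1 + Real.log x) ^ μ ≤ p * √x := by
  set r := max (2 * μ) 1 with hr
  have hr1 : 1 ≤ r := le_max_right _ _
  have hr2 : 2 * μ ≤ r := le_max_left _ _
  refine ⟨r ^ μ, by positivity, fun x hx => ?_⟩
  have hx0 : 0 < x := by linarith
  have hl := Real.log_nonneg hx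
  have h1 : 1 + Real.log x ≤ r * x ^ (1 / r) := by
    have h2 := Real.log_le_sub_one_of_pos (show 0 < x ^ (1 / r) by positivity)
    rw [Real.log_rpow hx0, one_div, inv_mul_le_iff₀ (by positivity)] at h2
    rw [one_div]
    linarith
  calc (1 + Real.log x) ^ μ ≤ (r * x ^ (1 / r)) ^ μ := by gcongr
    _ = r ^ μ * x ^ (1 / r * μ) := by
      rw [Real.mul_rpow (by positivity) (by positivity), ← Real.rpow_mul hx0.le]
    _ ≤ r ^ μ * x ^ (1 / 2 : ℝ) := by
      gcongr ?_ * ?_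
      refine Real.rpow_le_rpow_of_exponent_le hx ?_
      rw [one_div, inv_mul_le_iff₀ (by positivity)]
      linarith
    _ = r ^ μ * √x := by rw [Real.sqrt_eq_rpow]

namespace OracleBound

/-- The index `Z = (w/δ)^{2/(1+2ν)}` balances the two terms: both `√Z δ` and `Z^{-ν} w` equal the
optimal rate. The second half of the oracle inequality forces `M + 1`, and hence `N`, to be at most
a multiple of `Z`, so the first half may be evaluated at an index comparable to `Z`. -/
theorem holder_rate {C c ν : ℝ} (hC : 0 < C) (hc : 0 < c) (hν : 0 < ν) :
    ∃ K : ℝ, 0 < K ∧ ∀ (σ : ℕ → ℝ) (w δ E : ℝ), 0 < δ → 0 ≤ w →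
      (∀ m : ℕ, σ m ≤ c * ((m : ℝ) + 1) ^ (-ν) * w) → OracleBound σ C δ E →
      E ≤ K * w ^ (1 / (1 + 2 * ν)) * δ ^ (2 * ν / (1 + 2 * ν)) := by
  set c₂ := (C * c) ^ (2 / (1 + 2 * ν)) with hc₂
  refine ⟨C * (c + √(C * c₂ + 1)), by positivity, fun σ w δ E hδ hw hσ hE => ?_⟩
  obtain ⟨N, h1, h2⟩ := hE
  -- If `w = 0` then `σ ≤ 0`; an index `M` cannot exist, so `N = 0` and evaluation at index `0`
  -- gives `E ≤ 0`.
  rcases hw.eq_or_lt with rfl | hw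
  · rcases h2 with rfl | ⟨M, -, hM⟩
    · have h3 := h1 0 le_rfl
      have h4 := hσ 0
      simp only [mul_zero, Nat.cast_zero, Real.sqrt_zero, zero_mul, add_zero] at h3 h4
      rw [Real.zero_rpow (by positivity)]
      nlinarith
    · have h4 := hσ M
      rw [mul_zero] at h4
      have : 0 < √((M : ℝ) + 1) * δ := by positivity
      nlinarith
  set x := w / δ with hx
  have hx0 : 0 < x := by positivity
  set Z := x ^ (2 / (1 + 2 * ν)) with hZ
  have hZ0 : 0 < Z := by positivity
  set V := w ^ (1 / (1 + 2 * ν)) * δ ^ (2 * ν / (1 + 2 * ν)) with hV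
  have hxe : w = x * δ := by rw [hx]; field_simp
  have hab : 1 / (1 + 2 * ν) + 2 * ν / (1 + 2 * ν) = 1 := by field_simp
  have hV2 : V = x ^ (1 / (1 + 2 * ν)) * δ := by
    rw [hV, hxe, Real.mul_rpow hx0.le hδ.le, mul_assoc, ← Real.rpow_add hδ, hab, Real.rpow_one]
  have hZs : √Z * δ = V := by
    rw [hV2, Real.sqrt_eq_rpow, hZ, ← Real.rpow_mul hx0.le]
    congr 2
    field_simp
  have hZν : Z ^ (-ν) * w = V := by
    rw [hV2, hxe, hZ, ← Real.rpow_mul hx0.le, ← mul_assoc]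
    congr 1
    nth_rewrite 2 [← Real.rpow_one x]
    rw [← Real.rpow_add hx0]
    congr 1
    field_simp
    ring
  have hN : (N : ℝ) ≤ C * c₂ * Z := by
    rcases h2 with rfl | ⟨M, hNM, hM⟩
    · rw [Nat.cast_zero]; positivity
    · refine hNM.trans ?_
      rw [mul_assoc]
      gcongr
      have hM0 : (0 : ℝ) < M + 1 := by positivity
      have h3 : ((M : ℝ) + 1) ^ ((1 + 2 * ν) / 2) ≤ C * c * x := by
        have h4 : √((M : ℝ) + 1) * δ ≤ C * (c * ((M : ℝ) + 1) ^ (-ν) * w) :=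
          hM.trans (by gcongr; exact hσ M)
        have h5 : ((M : ℝ) + 1) ^ ((1 + 2 * ν) / 2) = √((M : ℝ) + 1) * ((M : ℝ) + 1) ^ ν := by
          rw [Real.sqrt_eq_rpow, ← Real.rpow_add hM0]
          congr 1
          ring
        have h6 : ((M : ℝ) + 1) ^ (-ν) * ((M : ℝ) + 1) ^ ν = 1 := by
          rw [← Real.rpow_add hM0]
          simp
        rw [h5, hx, ← mul_div_assoc, le_div_iff₀ hδ]
        calc √((M : ℝ) + 1) * ((M : ℝ) + 1) ^ ν * δ
            = √((M : ℝ) + 1) * δ * ((M : ℝ) + 1) ^ ν := by ring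
          _ ≤ C * (c * ((M : ℝ) + 1) ^ (-ν) * w) * ((M : ℝ) + 1) ^ ν := by gcongr
          _ = C * c * w * (((M : ℝ) + 1) ^ (-ν) * ((M : ℝ) + 1) ^ ν) := by ring
          _ = C * c * w := by rw [h6, mul_one]
      have h7 := Real.rpow_le_rpow (by positivity) h3 (show 0 ≤ 2 / (1 + 2 * ν) by positivity)
      rw [← Real.rpow_mul hM0.le, Real.mul_rpow (by positivity) hx0.le] at h7
      have h8 : (1 + 2 * ν) / 2 * (2 / (1 + 2 * ν)) = 1 := by field_simp
      rwa [h8, Real.rpow_one] at h7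
  set m := max N ⌊Z⌋₊ with hm
  have hm1 : (m : ℝ) ≤ (C * c₂ + 1) * Z := by
    have h3 : (m : ℝ) ≤ N + ⌊Z⌋₊ := by
      rw [hm]
      exact_mod_cast max_le (Nat.le_add_right _ _) (Nat.le_add_left _ _)
    linarith [Nat.floor_le hZ0.le]
  have hm2 : Z ≤ m + 1 := by
    have h3 : (⌊Z⌋₊ : ℝ) ≤ m := by exact_mod_cast le_max_right _ _
    linarith [Nat.lt_floor_add_one Z]
  calc E ≤ C * (σ m + √m * δ) := h1 m (le_max_left _ _)
    _ ≤ C * (c * Z ^ (-ν) * w + √((C * c₂ + 1) * Z) * δ) := by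
      gcongr
      refine (hσ m).trans ?_
      gcongr ?_ * ?_ * ?_
      exact Real.rpow_le_rpow_of_nonpos hZ0 hm2 (by linarith)
    _ = C * (c * (Z ^ (-ν) * w) + √(C * c₂ + 1) * (√Z * δ)) := by
      rw [Real.sqrt_mul (by positivity)]
      ring
    _ = C * (c + √(C * c₂ + 1)) * V := by rw [hZs, hZν]; ring
    _ = _ := by rw [hV]; ring

/-- The index `x = w/δ` replaces the exact balance: `√x δ = w/√x` is below the logarithmic rate, and
`log` of any index beyond `x` is at least `log x`. If `M + 1` exceeds `x`, the bound on `σ M`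
controls `√N δ` instead. -/
theorem log_rate {C c μ : ℝ} (hC : 0 < C) (hc : 0 < c) (hμ : 0 < μ) :
    ∃ K : ℝ, 0 < K ∧ ∀ (σ : ℕ → ℝ) (w δ E : ℝ), 0 < δ → δ ≤ w →
      (∀ m : ℕ, σ m ≤ c * (1 + Real.log ((m : ℝ) + 1)) ^ (-μ) * w) → OracleBound σ C δ E →
      E ≤ K * w * (1 + |Real.log (δ / w)|) ^ (-μ) := by
  obtain ⟨p, hp, hlog⟩ := one_add_log_rpow_le hμ
  refine ⟨C * (c + (√C * (p + C * c) + p)), by positivity, fun σ w δ E hδ hδw hσ hE => ?_⟩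
  obtain ⟨N, h1, h2⟩ := hE
  have hw : 0 < w := by linarith
  set x := w / δ with hx
  have hx1 : 1 ≤ x := by rwa [hx, one_le_div hδ]
  have hx0 : 0 < x := by linarith
  have hl := Real.log_nonneg hx1
  have hxe : w = x * δ := by rw [hx]; field_simp
  have habs : |Real.log (δ / w)| = Real.log x := by
    rw [← inv_div, ← hx, Real.log_inv, abs_neg, abs_of_nonneg hl]
  rw [habs]
  set ℓ := (1 + Real.log x) ^ (-μ) with hℓ
  have hℓ0 : 0 < ℓ := by positivity
  set V := w * ℓ with hV
  have hinv : ∀ y : ℝ, 1 ≤ y → (1 + Real.log y) ^ (-μ) * (1 + Real.log y) ^ μ = 1 := by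
    intro y hy
    have := Real.log_nonneg hy
    rw [← Real.rpow_add (by positivity)]
    simp
  have hxs : √x * δ ≤ p * V := by
    have h3 := hlog x hx1
    have h4 : 1 ≤ p * √x * ℓ := by
      rw [← hinv x hx1, mul_comm]
      gcongr
    have h5 : √x * √x = x := Real.mul_self_sqrt hx0.le
    calc √x * δ = √x * δ * 1 := by ring
      _ ≤ √x * δ * (p * √x * ℓ) := by gcongr
      _ = p * (√x * √x * δ * ℓ) := by ring
      _ = p * V := by rw [h5, ← hxe]
  have hN : √(N : ℝ) * δ ≤ √C * (p + C * c) * V := by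
    rcases h2 with rfl | ⟨M, hNM, hM⟩
    · rw [Nat.cast_zero, Real.sqrt_zero, zero_mul]; positivity
    · have h3 : √((M : ℝ) + 1) * δ ≤ (p + C * c) * V := by
        rcases le_total ((M : ℝ) + 1) x with h | h
        · have h4 : √((M : ℝ) + 1) * δ ≤ √x * δ := by gcongr
          have : 0 ≤ C * c * V := by positivity
          linarith
        · have h4 : (1 + Real.log ((M : ℝ) + 1)) ^ (-μ) ≤ ℓ :=
            Real.rpow_le_rpow_of_nonpos (by positivity)
              (by linarith [Real.log_le_log hx0 h]) (by linarith)
          have h5 : C * σ M ≤ C * (c * ℓ * w) := by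
            gcongr
            exact (hσ M).trans (by gcongr)
          have : 0 ≤ p * V := by positivity
          have e : C * (c * ℓ * w) = C * c * V := by rw [hV]; ring
          linarith
      calc √(N : ℝ) * δ ≤ √(C * (M + 1)) * δ := by gcongr
        _ = √C * (√((M : ℝ) + 1) * δ) := by rw [Real.sqrt_mul hC.le]; ring
        _ ≤ √C * ((p + C * c) * V) := by gcongr
        _ = _ := by ring
  set m := max N ⌊x⌋₊ with hm
  have hm1 : √(m : ℝ) * δ ≤ (√C * (p + C * c) + p) * V := by
    have hV0 : 0 < V := by positivity
    rcases le_total N ⌊x⌋₊ with h | h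
    · rw [hm, max_eq_right h]
      have h3 : √(⌊x⌋₊ : ℝ) * δ ≤ √x * δ := by
        gcongr
        exact Nat.floor_le hx0.le
      have : 0 ≤ √C * (p + C * c) * V := by positivity
      linarith
    · rw [hm, max_eq_left h]
      have : 0 ≤ p * V := by positivity
      linarith
  have hm2 : x ≤ m + 1 := by
    have h3 : (⌊x⌋₊ : ℝ) ≤ m := by exact_mod_cast le_max_right _ _
    linarith [Nat.lt_floor_add_one x]
  have h4 : (1 + Real.log ((m : ℝ) + 1)) ^ (-μ) ≤ ℓ :=
    Real.rpow_le_rpow_of_nonpos (by positivity)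
      (by linarith [Real.log_le_log hx0 hm2]) (by linarith)
  calc E ≤ C * (σ m + √m * δ) := h1 m (le_max_left _ _)
    _ ≤ C * (c * ℓ * w + (√C * (p + C * c) + p) * V) := by
      gcongr
      exact (hσ m).trans (by gcongr)
    _ = _ := by rw [hV]; ring

/-- Choose `m₀` with `σ < κ` from there on. If `max N m₀` is bounded by a fixed number, small `δ`
suffices. Otherwise `N` is so large that `M ≥ m₀`, and then `√N δ ≤ √C · C σ_M` is small without any
rate. -/
theorem tendsto_zero {C : ℝ} (hC : 0 < C) {σ : ℕ → ℝ} (hσ : Tendsto σ atTop (𝓝 0)) {ε : ℝ}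
    (hε : 0 < ε) : ∃ δ₀ : ℝ, 0 < δ₀ ∧ ∀ δ E : ℝ, 0 < δ → δ ≤ δ₀ → OracleBound σ C δ E →
      E ≤ ε := by
  set κ := ε / (C * (1 + √C * C)) with hκ
  have hκ0 : 0 < κ := by positivity
  obtain ⟨m₀, hm₀⟩ := eventually_atTop.1 (hσ.eventually (gt_mem_nhds hκ0))
  set B := √(C * (m₀ + 1) + m₀) with hB
  have hB0 : 0 < B := by positivity
  refine ⟨√C * C * κ / B, by positivity, fun δ E hδ hδ₀ hE => ?_⟩
  obtain ⟨N, h1, h2⟩ := hE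
  have hBδ : B * δ ≤ √C * C * κ := by
    rw [le_div_iff₀ hB0] at hδ₀
    linarith
  set m := max N m₀ with hm
  have h3 : √(m : ℝ) * δ ≤ √C * C * κ := by
    by_cases h : (m : ℝ) ≤ C * (m₀ + 1) + m₀
    · exact (mul_le_mul_of_nonneg_right (Real.sqrt_le_sqrt h) hδ.le).trans hBδ
    · push Not at h
      have hCm : 0 < C * (m₀ + 1) := by positivity
      have hmN : m = N := by
        rcases max_choice N m₀ with h' | h'
        · exact h'
        · rw [hm, h'] at h
          linarith
      rw [hmN] at h ⊢
      rcases h2 with rfl | ⟨M, hNM, hM⟩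
      · rw [Nat.cast_zero, Real.sqrt_zero, zero_mul]
        positivity
      · have hMm : m₀ ≤ M := by
          by_contra hlt
          push Not at hlt
          have : (M : ℝ) ≤ m₀ := by exact_mod_cast hlt.le
          have : C * (M + 1) ≤ C * ((m₀ : ℝ) + 1) := by gcongr
          have : (0 : ℝ) ≤ m₀ := Nat.cast_nonneg _
          linarith
        calc √(N : ℝ) * δ ≤ √(C * (M + 1)) * δ := by gcongr
          _ = √C * (√((M : ℝ) + 1) * δ) := by rw [Real.sqrt_mul hC.le]; ring
          _ ≤ √C * (C * σ M) := by gcongr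
          _ ≤ √C * (C * κ) := by gcongr; exact (hm₀ M hMm).le
          _ = _ := by ring
  calc E ≤ C * (σ m + √m * δ) := h1 m (le_max_left _ _)
    _ ≤ C * (κ + √C * C * κ) := by
      gcongr
      exact (hm₀ m (le_max_right _ _)).le
    _ = ε := by rw [hκ]; field_simp

end OracleBound

/-! ### Decay of the residual under source conditions. -/

namespace NewtonFilter

open ContinuousLinearMap (adjoint)

section Scalar

variable {t : ℝ} (m : NewtonFilter)

/-- Taking the power `ν` of `y ≤ e^y` at `y = (j+1) t / (2ν)` gives `y^ν ≤ e^{(j+1)t/2}`, and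
`e^{t/2} ≤ 1 + t` turns this into at most `2 (1 + t)^j`, which the filter cancels. -/
theorem base_pow_mul_rpow_le (h0 : 0 ≤ t) (h1 : t ≤ 2 / 9) {ν : ℝ} (hν : 0 < ν) (j : ℕ) :
    m.base t ^ j * t ^ ν ≤ 2 * (2 * ν) ^ ν * ((j : ℝ) + 1) ^ (-ν) := by
  have hj : (0 : ℝ) < j + 1 := by positivity
  have h2 : Real.exp (t / 2) ≤ 1 + t := by
    have h3 := Real.add_one_le_exp (-(t / (1 + t)))
    have h4 : -(t / (1 + t)) + 1 = (1 + t)⁻¹ := by field_simp; ring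
    rw [h4, Real.exp_neg, inv_le_inv₀ (by positivity) (by positivity)] at h3
    refine le_trans (Real.exp_le_exp.2 ?_) h3
    gcongr
    linarith
  have h3 : (((j : ℝ) + 1) * t / (2 * ν)) ^ ν ≤ Real.exp (((j : ℝ) + 1) * t / 2) := by
    have h4 : ((j : ℝ) + 1) * t / (2 * ν) ≤ Real.exp (((j : ℝ) + 1) * t / (2 * ν)) := by
      linarith [Real.add_one_le_exp (((j : ℝ) + 1) * t / (2 * ν))]
    refine (Real.rpow_le_rpow (by positivity) h4 hν.le).trans_eq ?_
    rw [← Real.exp_mul]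
    congr 1
    field_simp
  have h4 : Real.exp (((j : ℝ) + 1) * t / 2) ≤ 2 * (1 + t) ^ j := by
    have e : ((j : ℝ) + 1) * t / 2 = ((j + 1 : ℕ) : ℝ) * (t / 2) := by push_cast; ring
    rw [e, Real.exp_nat_mul]
    calc Real.exp (t / 2) ^ (j + 1) ≤ (1 + t) ^ (j + 1) := by gcongr
      _ = (1 + t) * (1 + t) ^ j := by ring
      _ ≤ 2 * (1 + t) ^ j := by gcongr; linarith
  rw [Real.div_rpow (by positivity) (by positivity), div_le_iff₀ (by positivity),
    Real.mul_rpow hj.le h0] at h3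
  have h5 : t ^ ν ≤ 2 * (2 * ν) ^ ν * ((j : ℝ) + 1) ^ (-ν) * (1 + t) ^ j := by
    rw [Real.rpow_neg hj.le]
    have h6 : ((j : ℝ) + 1) ^ ν * t ^ ν ≤ 2 * (1 + t) ^ j * (2 * ν) ^ ν :=
      h3.trans (by gcongr)
    calc t ^ ν = (((j : ℝ) + 1) ^ ν)⁻¹ * (((j : ℝ) + 1) ^ ν * t ^ ν) := by
          field_simp
      _ ≤ (((j : ℝ) + 1) ^ ν)⁻¹ * (2 * (1 + t) ^ j * (2 * ν) ^ ν) := by gcongr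
      _ = _ := by ring
  have h6 := m.base_pow_le h0 h1 j
  calc m.base t ^ j * t ^ ν
      ≤ ((1 + t) ^ j)⁻¹ * (2 * (2 * ν) ^ ν * ((j : ℝ) + 1) ^ (-ν) * (1 + t) ^ j) := by gcongr
    _ = _ := by field_simp

/-- Split at `t √(j+1) = 1`. For smaller `t`, `-log t` is at least `log (j+1) / 2` and the source
function decays. For larger `t`, the filter is at most `1/√(j+1)`, which beats every power of the
logarithm. The bound `t ≤ 2/9 < 1/e` keeps `-log t ≥ 1`. -/
theorem exists_base_pow_mul_log_le {μ : ℝ} (hμ : 0 < μ) : ∃ c : ℝ, 0 < c ∧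
    ∀ (m : NewtonFilter) (t : ℝ), 0 ≤ t → t ≤ 2 / 9 → ∀ j : ℕ,
      0 ≤ (if t = 0 then 0 else (-Real.log t) ^ (-μ)) ∧
      m.base t ^ j * (if t = 0 then 0 else (-Real.log t) ^ (-μ))
        ≤ c * (1 + Real.log ((j : ℝ) + 1)) ^ (-μ) := by
  obtain ⟨p, hp, hlog⟩ := one_add_log_rpow_le hμ
  refine ⟨3 ^ μ + p, by positivity, fun m t h0 h1 j => ?_⟩
  have hy : (1 : ℝ) ≤ j + 1 := by
    have : (0 : ℝ) ≤ j := Nat.cast_nonneg j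
    linarith
  have hl := Real.log_nonneg hy
  set y := (j : ℝ) + 1 with hyd
  have hy0 : 0 < y := by linarith
  set ℓ := (1 + Real.log y) ^ (-μ) with hℓ
  have hℓ0 : 0 < ℓ := by positivity
  split_ifs with ht
  · simp only [le_refl, mul_zero, true_and]
    positivity
  have ht0 : 0 < t := lt_of_le_of_ne h0 (Ne.symm ht)
  have hlt : 1 ≤ -Real.log t := by
    have h2 : t ≤ Real.exp (-1) := by
      rw [Real.exp_neg, ← one_div, le_div_iff₀ (Real.exp_pos 1)]
      nlinarith [Real.exp_one_lt_d9]
    have h3 := Real.log_le_log ht0 h2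
    rw [Real.log_exp] at h3
    linarith
  have hlt0 : 0 < -Real.log t := by linarith
  have hf1 : (-Real.log t) ^ (-μ) ≤ 1 := Real.rpow_le_one_of_one_le_of_nonpos hlt (by linarith)
  refine ⟨by positivity, ?_⟩
  have hb0 := m.base_pow_nonneg h0 h1 j
  have hb1 := m.base_pow_le_one h0 h1 j
  rcases le_total (t * √y) 1 with h | h
  · have h2 : Real.log t + Real.log y / 2 ≤ 0 := by
      have h3 := Real.log_nonpos (by positivity) h
      rwa [Real.log_mul ht0.ne' (by positivity), Real.log_sqrt hy0.le] at h3
    have h3 : (1 + Real.log y) / 3 ≤ -Real.log t := by linarith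
    have h4 : (-Real.log t) ^ (-μ) ≤ 3 ^ μ * ℓ := by
      refine (Real.rpow_le_rpow_of_nonpos (by positivity) h3 (by linarith)).trans_eq ?_
      rw [Real.div_rpow (by positivity) (by positivity), Real.rpow_neg (by norm_num : (0:ℝ) ≤ 3),
        div_inv_eq_mul, mul_comm]
    calc m.base t ^ j * (-Real.log t) ^ (-μ) ≤ 1 * (3 ^ μ * ℓ) := by gcongr
      _ ≤ (3 ^ μ + p) * ℓ := by nlinarith [mul_pos hp hℓ0]
  · have h2 : m.base t ^ j * √y ≤ 1 := by
      have h3 := m.mul_base_pow_le h0 h1 j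
      rw [← hyd, le_div_iff₀ hy0] at h3
      have h4 : √y * √y = y := Real.mul_self_sqrt hy0.le
      calc m.base t ^ j * √y = m.base t ^ j * √y * 1 := by ring
        _ ≤ m.base t ^ j * √y * (t * √y) := by gcongr
        _ = t * m.base t ^ j * (√y * √y) := by ring
        _ ≤ 1 := by rwa [h4]
    have h3 : 1 ≤ p * √y * ℓ := by
      have : ℓ * (1 + Real.log y) ^ μ = 1 := by
        rw [hℓ, ← Real.rpow_add (by positivity)]
        simp
      rw [← this, mul_comm]
      gcongr
      exact hlog y hy
    calc m.base t ^ j * (-Real.log t) ^ (-μ) ≤ m.base t ^ j * 1 := by gcongr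
      _ = m.base t ^ j * 1 := by ring
      _ ≤ m.base t ^ j * (p * √y * ℓ) := by gcongr
      _ = m.base t ^ j * √y * (p * ℓ) := by ring
      _ ≤ 1 * (p * ℓ) := by gcongr
      _ ≤ (3 ^ μ + p) * ℓ := by
        have : 0 < (3 : ℝ) ^ μ * ℓ := by positivity
        linarith

end Scalar

section Source

set_option linter.unusedSectionVars false

variable {X Y : Type*} [NormedAddCommGroup X] [InnerProductSpace ℝ X] [CompleteSpace X]
  [NormedAddCommGroup Y] [InnerProductSpace ℝ Y] [CompleteSpace Y] (m : NewtonFilter)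
  {T : X →L[ℝ] Y} (hT : ‖normalOp T‖ ≤ 2 / 9)
include hT

theorem norm_base_pow_apply_le_of_holderSource {ν : ℝ} (hν : 0 < ν) {e ω : X}
    (he : HolderSource T ν e ω) (j : ℕ) :
    ‖(m.base (normalOp T) ^ j) e‖ ≤ 2 * (2 * ν) ^ ν * ((j : ℝ) + 1) ^ (-ν) * ‖ω‖ := by
  obtain ⟨S, hS, rfl⟩ := he
  refine ((m.isFunctionOfOp_base_pow hT j).mul hS).norm_apply_le (by positivity)
    (fun t ht => ?_) ω
  rw [abs_of_nonneg (mul_nonneg (m.base_pow_nonneg ht.1 (ht.2.trans hT) j)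
    (Real.rpow_nonneg ht.1 ν))]
  exact m.base_pow_mul_rpow_le ht.1 (ht.2.trans hT) hν j

theorem norm_base_pow_apply_le_of_logSource {μ c : ℝ}
    (hc : ∀ (m : NewtonFilter) (t : ℝ), 0 ≤ t → t ≤ 2 / 9 → ∀ j : ℕ,
      0 ≤ (if t = 0 then 0 else (-Real.log t) ^ (-μ)) ∧
      m.base t ^ j * (if t = 0 then 0 else (-Real.log t) ^ (-μ))
        ≤ c * (1 + Real.log ((j : ℝ) + 1)) ^ (-μ)) (hc0 : 0 < c) {e ω : X}
    (he : LogSource T μ e ω) (j : ℕ) :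
    ‖(m.base (normalOp T) ^ j) e‖ ≤ c * (1 + Real.log ((j : ℝ) + 1)) ^ (-μ) * ‖ω‖ := by
  obtain ⟨S, hS, rfl⟩ := he
  have hl : 0 ≤ Real.log ((j : ℝ) + 1) := Real.log_nonneg (by
    have : (0 : ℝ) ≤ j := Nat.cast_nonneg j
    linarith)
  refine ((m.isFunctionOfOp_base_pow hT j).mul hS).norm_apply_le (by positivity)
    (fun t ht => ?_) ω
  have h := hc m t ht.1 (ht.2.trans hT) j
  rw [abs_of_nonneg (mul_nonneg (m.base_pow_nonneg ht.1 (ht.2.trans hT) j) h.1)]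
  exact h.2

/-- The orthogonal complement of the kernel is the closure of the range of `T*`. On that range the
residual decays like `1/√(j+1)`, and contractivity passes the convergence to the closure. -/
theorem tendsto_norm_base_pow_apply {e : X} (he : e ∈ (LinearMap.ker T.toLinearMap)ᗮ) :
    Tendsto (fun j : ℕ => ‖(m.base (normalOp T) ^ j) e‖) atTop (𝓝 0) := by
  have hcl : e ∈ closure (Set.range (adjoint T)) := by
    have h := T.orthogonal_ker
    rw [show (LinearMap.ker T.toLinearMap) = T.ker from rfl, h] at he
    exact he
  rw [Metric.tendsto_atTop]
  intro ε hε
  obtain ⟨_, ⟨y, rfl⟩, hy⟩ := Metric.mem_closure_iff.1 hcl (ε / 2) (by positivity)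
  have hlim : Tendsto (fun j : ℕ => 1 / √((j : ℝ) + 1) * ‖y‖) atTop (𝓝 0) := by
    have h1 : Tendsto (fun j : ℕ => √((j : ℝ) + 1)) atTop atTop :=
      Real.tendsto_sqrt_atTop.comp
        (tendsto_atTop_add_const_right _ _ tendsto_natCast_atTop_atTop)
    simpa using ((tendsto_const_nhds (x := (1 : ℝ))).div_atTop h1).mul_const ‖y‖
  obtain ⟨j₀, hj₀⟩ := eventually_atTop.1 (hlim.eventually (gt_mem_nhds (half_pos hε)))
  refine ⟨j₀, fun j hj => ?_⟩
  rw [Real.dist_0_eq_abs, abs_norm]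
  have h1 := m.norm_base_pow_apply_le hT j (e - adjoint T y)
  have h2 := m.norm_base_pow_adjoint_apply_le hT j y
  have h3 := hj₀ j hj
  rw [map_sub, ← dist_eq_norm e] at h1
  have h4 := norm_le_norm_add_norm_sub' ((m.base (normalOp T) ^ j) e)
    ((m.base (normalOp T) ^ j) (adjoint T y))
  linarith

end Source

end NewtonFilter

/-! ### Comparability of consecutive regularization parameters. -/

namespace StepIntegers

variable {q : ℕ} {n : ℕ → ℕ} (h : StepIntegers q n)
include h

theorem sqrt_pos (k : ℕ) : 0 < √(n k : ℝ) := Real.sqrt_pos.2 (by exact_mod_cast h.pos k)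

theorem sqrt_le_succ (k : ℕ) : √(n k : ℝ) ≤ √(n (k + 1) : ℝ) :=
  Real.sqrt_le_sqrt (by exact_mod_cast h.mono k)

theorem succ_le_mul (k : ℕ) : (n (k + 1) : ℝ) ≤ (1 + q) * n k := by
  have h1 : (n (k + 1) : ℝ) ≤ n k + q := by exact_mod_cast h.step k
  have h2 : (1 : ℝ) ≤ n k := by exact_mod_cast h.pos k
  have h3 : (0 : ℝ) ≤ q := Nat.cast_nonneg q
  nlinarith

theorem sqrt_succ_le (k : ℕ) : √(n (k + 1) : ℝ) ≤ √(1 + q) * √(n k : ℝ) := by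
  rw [← Real.sqrt_mul (by positivity)]
  exact Real.sqrt_le_sqrt (h.succ_le_mul k)

end StepIntegers

/-! ### The abstract error recursion and its oracle inequality. -/

namespace NewtonFilter

set_option linter.unusedSectionVars false

variable {X Y : Type*} [NormedAddCommGroup X] [InnerProductSpace ℝ X] [CompleteSpace X]
  [NormedAddCommGroup Y] [InnerProductSpace ℝ Y] [CompleteSpace Y] (m : NewtonFilter)

/-- The constant in the comparison of the error with the residual of the initial error. -/
noncomputable def errorConst (q : ℕ) : ℝ := 2 ^ (q + 1) + 3

theorem one_le_errorConst (q : ℕ) : 1 ≤ errorConst q := by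
  have : (0 : ℝ) < 2 ^ (q + 1) := by positivity
  unfold errorConst
  linarith

/-- The norm of the residual of `e` after half of the steps, scaled by `α_k ^ (1 / 2)`. -/
noncomputable def halfResidual (T : X →L[ℝ] Y) (n : ℕ → ℕ) (e : X) (k : ℕ) : ℝ :=
  ‖(m.base (normalOp T) ^ (m.order (n k) / 2)) e‖ / √(n k : ℝ)

variable {T : X →L[ℝ] Y} (hT : ‖normalOp T‖ ≤ 2 / 9)
include hT

theorem norm_base_pow_anti {i j : ℕ} (hij : i ≤ j) (x : X) :
    ‖(m.base (normalOp T) ^ j) x‖ ≤ ‖(m.base (normalOp T) ^ i) x‖ := by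
  obtain ⟨d, rfl⟩ := Nat.exists_eq_add_of_le' hij
  rw [pow_add]
  exact m.norm_base_pow_apply_le hT d _

theorem norm_base_pow_le_two_pow_mul {i j q : ℕ} (hji : j ≤ i + q) (x : X) :
    ‖(m.base (normalOp T) ^ i) x‖ ≤ 2 ^ q * ‖(m.base (normalOp T) ^ j) x‖ := by
  refine le_trans ?_ (mul_le_mul_of_nonneg_left (m.norm_base_pow_anti hT hji x) (by positivity))
  rw [add_comm, pow_add]
  exact m.norm_le_two_pow_mul_norm_base_pow hT q _

variable {q : ℕ} {n : ℕ → ℕ} (hn : StepIntegers q n)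
include hn

theorem halfResidual_nonneg (e : X) (k : ℕ) : 0 ≤ m.halfResidual T n e k := by
  unfold halfResidual
  positivity

theorem halfResidual_succ_le (e : X) (k : ℕ) :
    m.halfResidual T n e (k + 1) ≤ m.halfResidual T n e k := by
  have := hn.sqrt_pos k
  unfold halfResidual
  exact div_le_div₀ (norm_nonneg _) (m.norm_base_pow_anti hT
    (Nat.div_le_div_right (m.order_mono (hn.mono k))) e) this (hn.sqrt_le_succ k)

theorem halfResidual_le_succ (e : X) (k : ℕ) :
    m.halfResidual T n e k ≤ (1 + q) * 2 ^ q * m.halfResidual T n e (k + 1) := by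
  have h1 := hn.sqrt_pos k
  have h2 := hn.sqrt_pos (k + 1)
  have h3 : m.order (n (k + 1)) / 2 ≤ m.order (n k) / 2 + q := by
    have h4 := m.order_mono (hn.step k)
    rw [order_add] at h4
    omega
  have h4 := m.norm_base_pow_le_two_pow_mul hT h3 e
  have h5 : √((1 : ℝ) + q) ≤ 1 + q := by
    rw [Real.sqrt_le_left (by positivity)]
    have : (0 : ℝ) ≤ q := Nat.cast_nonneg q
    nlinarith
  unfold halfResidual
  rw [← mul_div_assoc, div_le_div_iff₀ h1 h2]
  calc _ ≤ (2 ^ q * ‖(m.base (normalOp T) ^ (m.order (n (k + 1)) / 2)) e‖)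
        * ((1 + q) * √(n k : ℝ)) := by
        gcongr
        exact (hn.sqrt_succ_le k).trans (by gcongr)
    _ = _ := by ring

theorem norm_base_order_le (e : X) (k : ℕ) :
    ‖(m.base (normalOp T) ^ m.order (n k)) e‖ ≤ √(n k : ℝ) * m.halfResidual T n e k := by
  have := hn.sqrt_pos k
  unfold halfResidual
  rw [mul_div_cancel₀ _ this.ne']
  exact m.norm_base_pow_anti hT (Nat.div_le_self _ _) e

/-- By induction the term `θ ‖e k‖` is absorbed into one more copy of the residual and of the noise.
This gives `2 · 2^q` residuals at the next index plus three noise terms, which is `errorConst q`. -/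
theorem norm_error_le (hT0 : ‖normalOp T‖ ≤ 2 / 9 / n 0) {e : ℕ → X} {K : ℕ} {δ θ : ℝ}
    (hδ : 0 < δ) (hθ : 0 ≤ θ) (hθb : θ * errorConst q ≤ 1)
    (hrec : ∀ k < K, ‖e (k + 1) - (m.base (normalOp T) ^ m.order (n k)) (e 0)‖
      ≤ θ * ‖e k‖ + 2 * √(n k : ℝ) * δ) :
    ∀ k ≤ K, ‖e k‖ ≤ errorConst q *
      (‖(m.base (normalOp T) ^ m.order (n k)) (e 0)‖ + √(n k : ℝ) * δ) := by
  intro k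
  induction k with
  | zero =>
    intro _
    have h1 := m.norm_le_two_mul_norm_base_order hT (hn.pos 0) hT0 (e 0)
    have h2 : 2 ≤ errorConst q := by
      have : (0 : ℝ) < 2 ^ (q + 1) := by positivity
      unfold errorConst
      linarith
    have h3 : 0 ≤ √(n 0 : ℝ) * δ := by positivity
    nlinarith [norm_nonneg ((m.base (normalOp T) ^ m.order (n 0)) (e 0))]
  | succ k ih =>
    intro hk
    have h1 := hrec k (by omega)
    have h2 := ih (by omega)
    set A := ‖(m.base (normalOp T) ^ m.order (n k)) (e 0)‖
    set B := ‖(m.base (normalOp T) ^ m.order (n (k + 1))) (e 0)‖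
    have h3 : A ≤ 2 ^ q * B := m.norm_base_pow_le_two_pow_mul hT (by
      have h4 := m.order_mono (hn.step k)
      rwa [order_add] at h4) _
    have h4 := norm_le_norm_add_norm_sub' (e (k + 1))
      ((m.base (normalOp T) ^ m.order (n k)) (e 0))
    have h5 : √(n k : ℝ) * δ ≤ √(n (k + 1) : ℝ) * δ := by
      gcongr
      exact_mod_cast hn.mono k
    have h6 : 0 ≤ √(n k : ℝ) * δ := by positivity
    have h7 : θ * ‖e k‖ ≤ A + √(n k : ℝ) * δ := by
      calc θ * ‖e k‖ ≤ θ * (errorConst q * (A + √(n k : ℝ) * δ)) := by gcongr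
        _ = (θ * errorConst q) * (A + √(n k : ℝ) * δ) := by ring
        _ ≤ 1 * (A + √(n k : ℝ) * δ) := by gcongr
        _ = _ := one_mul _
    have h8 : 0 ≤ B := norm_nonneg _
    have h9 : (2 : ℝ) ^ (q + 1) * B = 2 * (2 ^ q * B) := by ring
    have h10 : 0 ≤ (2 : ℝ) ^ (q + 1) * (√(n (k + 1) : ℝ) * δ) := by positivity
    unfold errorConst
    nlinarith

/-- Half of the power is spent on `T'` and yields `1/√n`. The other half stays on `e₀`, where it can
be compared with the unperturbed residual. -/
theorem norm_map_residual_le {T' : X →L[ℝ] Y} (hT' : ‖normalOp T'‖ ≤ 2 / 9) {e₀ : X} {θ E : ℝ}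
    (hE : ∀ j : ℕ, ‖(m.base (normalOp T') ^ j - m.base (normalOp T) ^ j) e₀‖ ≤ θ * E) (k : ℕ) :
    ‖T' ((m.base (normalOp T') ^ m.order (n k)) e₀)‖
      ≤ 2 / √(n k : ℝ) * (‖(m.base (normalOp T) ^ (m.order (n k) / 2)) e₀‖ + θ * E) := by
  set N := m.order (n k) with hN
  have hs := hn.sqrt_pos k
  have e1 : m.base (normalOp T') ^ N
      = m.base (normalOp T') ^ (N - N / 2) * m.base (normalOp T') ^ (N / 2) := by
    rw [← pow_add]
    congr 1
    omega
  have h1 := m.norm_map_base_pow_apply_le hT' (N - N / 2) ((m.base (normalOp T') ^ (N / 2)) e₀)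
  have h2 : 1 / √(((N - N / 2 : ℕ) : ℝ) + 1) ≤ 2 / √(n k : ℝ) := by
    rw [div_le_div_iff₀ (by positivity) hs, one_mul]
    have h3 : (n k : ℝ) ≤ 4 * (((N - N / 2 : ℕ) : ℝ) + 1) := by
      have := m.le_order (n k)
      exact_mod_cast (show n k ≤ 4 * (N - N / 2 + 1) by omega)
    calc √(n k : ℝ) ≤ √(4 * (((N - N / 2 : ℕ) : ℝ) + 1)) := Real.sqrt_le_sqrt h3
      _ = 2 * √(((N - N / 2 : ℕ) : ℝ) + 1) := by
        rw [Real.sqrt_mul (by norm_num), show (4 : ℝ) = 2 ^ 2 by norm_num,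
          Real.sqrt_sq (by norm_num)]
  have h4 := hE (N / 2)
  rw [sub_apply] at h4
  have h5 := norm_le_norm_add_norm_sub' ((m.base (normalOp T') ^ (N / 2)) e₀)
    ((m.base (normalOp T) ^ (N / 2)) e₀)
  rw [e1]
  refine h1.trans ?_
  gcongr
  linarith

theorem norm_map_residual_le_halfResidual {T' : X →L[ℝ] Y} (hT' : ‖normalOp T'‖ ≤ 2 / 9)
    {e₀ : X} {δ θ E : ℝ} (hθ : 0 ≤ θ) (hθb : θ * errorConst q ≤ 1) {k : ℕ}
    (hEk : E ≤ errorConst q *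
      (‖(m.base (normalOp T) ^ m.order (n k)) e₀‖ + √(n k : ℝ) * δ))
    (hE : ∀ j : ℕ, ‖(m.base (normalOp T') ^ j - m.base (normalOp T) ^ j) e₀‖ ≤ θ * E) :
    ‖T' ((m.base (normalOp T') ^ m.order (n k)) e₀)‖
      ≤ 4 * m.halfResidual T n e₀ k + 2 * errorConst q * θ * δ := by
  have hs := hn.sqrt_pos k
  have h1 := m.norm_map_residual_le hT hn hT' hE k
  have h2 := m.norm_base_order_le hT hn e₀ k
  have e1 : ‖(m.base (normalOp T) ^ (m.order (n k) / 2)) e₀‖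
      = √(n k : ℝ) * m.halfResidual T n e₀ k := by
    unfold halfResidual
    rw [mul_div_cancel₀ _ hs.ne']
  rw [e1] at h1
  have h0 := m.halfResidual_nonneg hT hn e₀ k
  set σ := m.halfResidual T n e₀ k
  have h3 : θ * E ≤ √(n k : ℝ) * (σ + errorConst q * θ * δ) := by
    calc θ * E ≤ θ * (errorConst q * (√(n k : ℝ) * σ + √(n k : ℝ) * δ)) := by
          gcongr
          refine hEk.trans ?_
          have := one_le_errorConst q
          gcongr
      _ = √(n k : ℝ) * ((θ * errorConst q) * σ + errorConst q * θ * δ) := by ring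
      _ ≤ √(n k : ℝ) * (1 * σ + errorConst q * θ * δ) := by gcongr
      _ = _ := by rw [one_mul]
  calc _ ≤ _ := h1
    _ ≤ 2 / √(n k : ℝ) * (√(n k : ℝ) * σ + √(n k : ℝ) * (σ + errorConst q * θ * δ)) := by gcongr
    _ = _ := by field_simp; ring

/-- The oracle inequality for a sequence of errors `e k` that is stopped at index `K`. -/
theorem oracleBound_of_recursion (hT0 : ‖normalOp T‖ ≤ 2 / 9 / n 0) {e : ℕ → X} {K : ℕ}
    {δ θ τ cs C₂ : ℝ} {s p : ℕ → ℝ} (hδ : 0 < δ) (hτ : 1 < τ) (hθ : 0 ≤ θ) (hC₂ : 0 ≤ C₂)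
    (hcs : 0 ≤ cs) (hθb : θ * errorConst q ≤ 1 / 8)
    (hθs : θ * (2 * errorConst q + 16 * cs) ≤ (τ - 1) / 2)
    (hrec : ∀ k < K, ‖e (k + 1) - (m.base (normalOp T) ^ m.order (n k)) (e 0)‖
      ≤ θ * ‖e k‖ + 2 * √(n k : ℝ) * δ)
    (hTK : ‖T (e K)‖ ≤ C₂ * δ)
    (hp : ∀ k < K, p k ≤ 4 * m.halfResidual T n (e 0) k + 2 * errorConst q * θ * δ)
    (hs : ∀ k ≤ K, s k ≤ cs * (m.halfResidual T n (e 0) k + δ))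
    (h0 : 0 < K → (τ - 1) * δ ≤ 2 * ‖T (e 0)‖)
    (hres : ∀ k, k + 1 < K → τ * δ ≤ p k + δ + 8 * θ * (s k + s (k + 1))) :
    OracleBound (fun j => ‖(m.base (normalOp T) ^ j) (e 0)‖)
      (3 * C₂ + 12 + (q + 2) + 4 * (4 + τ) / (τ - 1)) δ ‖e K‖ := by
  have hτ0 : 0 < τ - 1 := by linarith
  have hq0 : (0 : ℝ) ≤ q := Nat.cast_nonneg q
  have hd0 : 0 < 4 * (4 + τ) / (τ - 1) := div_pos (by linarith) hτ0
  set C := 3 * C₂ + 12 + (q + 2) + 4 * (4 + τ) / (τ - 1) with hC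
  rcases Nat.eq_zero_or_pos K with rfl | hK
  -- Immediate stopping: `e 0` differs from its residual by at most `√j ‖T (e 0)‖`, which is `O(√j
  -- δ)`.
  · refine ⟨0, fun j _ => ?_, Or.inl rfl⟩
    have h1 := m.norm_sub_base_pow_apply_le hT j (e 0)
    have h2 := norm_le_norm_add_norm_sub' (e 0) ((m.base (normalOp T) ^ j) (e 0))
    have h3 : √(j : ℝ) * ‖T (e 0)‖ ≤ √(j : ℝ) * (C₂ * δ) := by gcongr
    have h4 : 0 ≤ √(j : ℝ) * δ := by positivity
    have h5 : C₂ * (√(j : ℝ) * δ) ≤ C * (√(j : ℝ) * δ) := by gcongr; linarith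
    have h6 : 1 * ‖(m.base (normalOp T) ^ j) (e 0)‖ ≤ C * ‖(m.base (normalOp T) ^ j) (e 0)‖ := by
      gcongr
      linarith
    show ‖e 0‖ ≤ _
    linarith
  obtain ⟨k, rfl⟩ := Nat.exists_eq_add_of_lt hK
  rw [zero_add] at *
  -- Now `K = k + 1`, and `e K` is close to `x = s(A)^N e₀` with `N = m.order (n k)`. For `j = d +
  -- N` the residual of `e₀` is `s(A)^d x`.
  refine ⟨m.order (n k), fun j hj => ?_, Or.inr ?_⟩
  · have h1 := hrec k (by omega)
    have h2 := m.norm_error_le hT hn hT0 hδ hθ (by linarith) hrec k (by omega)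
    set x := (m.base (normalOp T) ^ m.order (n k)) (e 0) with hx
    obtain ⟨d, rfl⟩ := Nat.exists_eq_add_of_le' hj
    have e1 : (m.base (normalOp T) ^ (d + m.order (n k))) (e 0)
        = (m.base (normalOp T) ^ d) x := by rw [pow_add]; rfl
    set J : ℝ := √((d + m.order (n k) : ℕ) : ℝ) with hJ
    have hJn : √(n k : ℝ) ≤ J := by
      refine Real.sqrt_le_sqrt ?_
      have := m.le_order (n k)
      exact_mod_cast (by omega : n k ≤ d + m.order (n k))
    have hJd : √(d : ℝ) ≤ J := by
      refine Real.sqrt_le_sqrt ?_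
      exact_mod_cast (by omega : d ≤ d + m.order (n k))
    have h3 : ‖e (k + 1) - x‖ ≤ ‖x‖ / 8 + 3 * (J * δ) := by
      have h4 : θ * ‖e k‖ ≤ 1 / 8 * (‖x‖ + √(n k : ℝ) * δ) := by
        calc θ * ‖e k‖ ≤ θ * (errorConst q * (‖x‖ + √(n k : ℝ) * δ)) := by gcongr
          _ = (θ * errorConst q) * (‖x‖ + √(n k : ℝ) * δ) := by ring
          _ ≤ _ := by gcongr
      have h5 : √(n k : ℝ) * δ ≤ J * δ := by gcongr
      have h6 : 0 ≤ √(n k : ℝ) * δ := by positivity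
      linarith
    have h4 : ‖x‖ ≤ ‖(m.base (normalOp T) ^ d) x‖ + J * (C₂ * δ) + ‖e (k + 1) - x‖ := by
      have h5 := m.norm_sub_base_pow_apply_le hT d (e (k + 1))
      have h6 := m.norm_sub_base_pow_apply_le_norm hT d (e (k + 1) - x)
      have h7 : √(d : ℝ) * ‖T (e (k + 1))‖ ≤ J * (C₂ * δ) := by gcongr
      -- The operator `I - s(A)^d` is applied to `e K`, where `‖T e_K‖ = O(δ)` helps, and to `e K -
      -- x`, where it is a contraction. The latter is at most `‖x‖/8` plus noise, so it can be
      -- absorbed.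
      have h8 : x = (m.base (normalOp T) ^ d) x
          + ((e (k + 1) - (m.base (normalOp T) ^ d) (e (k + 1)))
            - ((e (k + 1) - x) - (m.base (normalOp T) ^ d) (e (k + 1) - x))) := by
        rw [map_sub]
        abel
      have h9 : ‖x‖ ≤ ‖(m.base (normalOp T) ^ d) x‖
          + (‖e (k + 1) - (m.base (normalOp T) ^ d) (e (k + 1))‖
            + ‖(e (k + 1) - x) - (m.base (normalOp T) ^ d) (e (k + 1) - x)‖) := by
        nth_rewrite 1 [h8]
        exact (norm_add_le _ _).trans (add_le_add_right (norm_sub_le _ _) _)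
      linarith
    have h5 := norm_le_norm_add_norm_sub' (e (k + 1)) x
    have hJ0 : 0 ≤ J * δ := by positivity
    have hx0 : 0 ≤ ‖(m.base (normalOp T) ^ d) x‖ := norm_nonneg _
    have h6 : (3 * C₂ + 12) * (J * δ) ≤ C * (J * δ) := by gcongr; linarith
    have h7 : 3 * ‖(m.base (normalOp T) ^ d) x‖ ≤ C * ‖(m.base (normalOp T) ^ d) x‖ := by
      gcongr
      linarith
    have h8 : 0 ≤ C₂ * (J * δ) := by positivity
    simp only [e1]
    have h9 : J * (C₂ * δ) = C₂ * (J * δ) := by ring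
    rw [h9] at h4
    linarith
  -- The discrepancy was too large before `K`. If `K = 1` only the initial guess can be used, with
  -- `M = m.order (n 0)`; if `K = i + 2`, the index `i + 1` is used, with `M = m.order (n i) / 2`.
  · rcases Nat.eq_zero_or_pos k with rfl | hk
    · refine ⟨m.order (n 0), ?_, ?_⟩
      · have : (0 : ℝ) ≤ m.order (n 0) := Nat.cast_nonneg _
        nlinarith
      · have h1 := h0 hK
        have h2 := m.norm_le_two_mul_norm_base_order hT (hn.pos 0) hT0 (e 0)
        have hs0 := hn.sqrt_pos 0
        set x := ‖(m.base (normalOp T) ^ m.order (n 0)) (e 0)‖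
        have h3 : √(n 0 : ℝ) * ‖T (e 0)‖ ≤ x := by
          have h4 : ‖T‖ ≤ 1 / 2 / √(n 0 : ℝ) := by
            refine abs_le_of_sq_le_sq' ?_ (by positivity) |>.2
            rw [sq, ← norm_normalOp, div_pow, Real.sq_sqrt (by positivity)]
            refine hT0.trans ?_
            gcongr
            norm_num
          calc √(n 0 : ℝ) * ‖T (e 0)‖ ≤ √(n 0 : ℝ) * (1 / 2 / √(n 0 : ℝ) * ‖e 0‖) := by
                gcongr
                exact (T.le_opNorm _).trans (by gcongr)
            _ = ‖e 0‖ / 2 := by field_simp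
            _ ≤ x := by linarith
        have h4 : √((m.order (n 0) : ℝ) + 1) ≤ 2 * √(n 0 : ℝ) := by
          rw [Real.sqrt_le_left (by positivity), mul_pow, Real.sq_sqrt (by positivity)]
          have h5 := m.order_le (n 0)
          have h6 := hn.pos 0
          norm_num
          exact_mod_cast (by omega : m.order (n 0) + 1 ≤ 4 * n 0)
        have h5 : (τ - 1) * (√((m.order (n 0) : ℝ) + 1) * δ) ≤ 4 * x := by
          calc (τ - 1) * (√((m.order (n 0) : ℝ) + 1) * δ)
              ≤ (τ - 1) * (2 * √(n 0 : ℝ) * δ) := by gcongr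
            _ = 2 * √(n 0 : ℝ) * ((τ - 1) * δ) := by ring
            _ ≤ 2 * √(n 0 : ℝ) * (2 * ‖T (e 0)‖) := by gcongr
            _ = 4 * (√(n 0 : ℝ) * ‖T (e 0)‖) := by ring
            _ ≤ 4 * x := by gcongr
        have h6 : √((m.order (n 0) : ℝ) + 1) * δ ≤ 4 / (τ - 1) * x := by
          rw [div_mul_eq_mul_div, le_div_iff₀ hτ0]
          linarith
        refine h6.trans ?_
        gcongr
        have h7 : 4 / (τ - 1) ≤ 4 * (4 + τ) / (τ - 1) := by gcongr; linarith
        linarith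
    · obtain ⟨i, rfl⟩ := Nat.exists_eq_add_of_lt hk
      rw [zero_add] at *
      refine ⟨m.order (n i) / 2, ?_, ?_⟩
      · have h1 := m.order_mono (hn.step i)
        rw [order_add] at h1
        have h2 : (m.order (n (i + 1)) : ℝ) ≤ (q + 2) * ((m.order (n i) / 2 : ℕ) + 1) := by
          have : m.order (n (i + 1)) ≤ (q + 2) * (m.order (n i) / 2 + 1) := by
            have : m.order (n i) < 2 * (m.order (n i) / 2 + 1) := by omega
            nlinarith [Nat.zero_le (q * (m.order (n i) / 2))]
          exact_mod_cast this
        refine h2.trans ?_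
        gcongr
        linarith
      · have h1 := hres i (by omega)
        have h2 := hp i (by omega)
        have h3 := hs i (by omega)
        have h4 := hs (i + 1) (by omega)
        have h5 := m.halfResidual_succ_le hT hn (e 0) i
        have h0' := m.halfResidual_nonneg hT hn (e 0) i
        have hsi := hn.sqrt_pos i
        have e1 : ‖(m.base (normalOp T) ^ (m.order (n i) / 2)) (e 0)‖
            = √(n i : ℝ) * m.halfResidual T n (e 0) i := by
          unfold halfResidual
          rw [mul_div_cancel₀ _ hsi.ne']
        show _ ≤ C * ‖(m.base (normalOp T) ^ (m.order (n i) / 2)) (e 0)‖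
        rw [e1]
        set σ := m.halfResidual T n (e 0) i
        have h6 : s i + s (i + 1) ≤ 2 * cs * (σ + δ) := by
          have : cs * (m.halfResidual T n (e 0) (i + 1) + δ) ≤ cs * (σ + δ) := by gcongr
          linarith
        have h7 : 8 * θ * (s i + s (i + 1)) ≤ 8 * θ * (2 * cs * (σ + δ)) := by gcongr
        have h8 : θ * (2 * errorConst q + 16 * cs) * δ ≤ (τ - 1) / 2 * δ := by gcongr
        have hb := one_le_errorConst q
        have h9 : θ * (16 * cs) ≤ (τ - 1) / 2 := by
          have : 0 ≤ θ * (2 * errorConst q) := by positivity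
          linarith
        have h10 : θ * (16 * cs) * σ ≤ (τ - 1) / 2 * σ := by gcongr
        -- By `hθs` the small terms take up at most half of `(τ - 1) δ`.
        have h11 : (τ - 1) * δ ≤ 2 * (4 + τ) * σ := by nlinarith
        have h12 : √(((m.order (n i) / 2 : ℕ) : ℝ) + 1) ≤ 2 * √(n i : ℝ) := by
          rw [Real.sqrt_le_left (by positivity), mul_pow, Real.sq_sqrt (by positivity)]
          have h5 := m.order_le (n i)
          have h6 := hn.pos i
          norm_num
          exact_mod_cast (by omega : m.order (n i) / 2 + 1 ≤ 4 * n i)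
        have h13 : √(((m.order (n i) / 2 : ℕ) : ℝ) + 1) * δ
            ≤ 4 * (4 + τ) / (τ - 1) * (√(n i : ℝ) * σ) := by
          rw [div_mul_eq_mul_div, le_div_iff₀ hτ0]
          calc _ ≤ 2 * √(n i : ℝ) * δ * (τ - 1) := by gcongr
            _ = 2 * √(n i : ℝ) * ((τ - 1) * δ) := by ring
            _ ≤ 2 * √(n i : ℝ) * (2 * (4 + τ) * σ) := by gcongr
            _ = _ := by ring
        refine h13.trans ?_
        gcongr
        linarith

end NewtonFilter

/-! ### Estimates for a single Newton step. -/

section NewtonStep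

set_option linter.unusedSectionVars false

open ContinuousLinearMap (adjoint)

variable {X Y : Type*} [NormedAddCommGroup X] [InnerProductSpace ℝ X] [CompleteSpace X]
  [NormedAddCommGroup Y] [InnerProductSpace ℝ Y] [CompleteSpace Y]

theorem OperatorConditions.norm_normalOp_le {m : NewtonFilter} {n : ℕ} {F : X → Y}
    {F' : X → X →L[ℝ] Y} {xd : X} {ρ : ℝ} (h : OperatorConditions m (1 / (n : ℝ)) F F' xd ρ)
    {x : X} (hx : x ∈ Metric.ball xd ρ) : ‖normalOp (F' x)‖ ≤ 2 / 9 / n := by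
  obtain ⟨β₀, -, -, -, hb⟩ := h.scaling
  have h1 : ‖F' x‖ ≤ √2 / 3 * √(1 / (n : ℝ)) := (hb x hx).trans (min_le_left _ _)
  rw [norm_normalOp, ← sq]
  calc ‖F' x‖ ^ 2 ≤ (√2 / 3 * √(1 / (n : ℝ))) ^ 2 := pow_le_pow_left₀ (norm_nonneg _) h1 2
    _ = 2 / 9 / n := by
      rw [mul_pow, div_pow, Real.sq_sqrt (by positivity), Real.sq_sqrt (by positivity)]
      ring

theorem OperatorConditions.norm_normalOp_le' {m : NewtonFilter} {n : ℕ} (hn : 0 < n) {F : X → Y}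
    {F' : X → X →L[ℝ] Y} {xd : X} {ρ : ℝ} (h : OperatorConditions m (1 / (n : ℝ)) F F' xd ρ)
    {x : X} (hx : x ∈ Metric.ball xd ρ) : ‖normalOp (F' x)‖ ≤ 2 / 9 := by
  refine (h.norm_normalOp_le hx).trans (div_le_self (by norm_num) ?_)
  exact_mod_cast hn

/-- A bound for the error of the linearization from a bound for the derivative along a segment. -/
theorem norm_sub_sub_le_of_hasFDerivAt {F : X → Y} {F' : X → X →L[ℝ] Y} {xd : X} {ρ C : ℝ}
    (hF : ∀ x ∈ Metric.ball xd ρ, HasFDerivAt F (F' x) x) {x z : X}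
    (hx : x ∈ Metric.ball xd ρ) (hz : z ∈ Metric.ball xd ρ)
    (hC : ∀ t ∈ Set.Icc (0 : ℝ) 1, z + t • (x - z) ∈ Metric.ball xd ρ →
      ‖(F' (z + t • (x - z)) - F' z) (x - z)‖ ≤ C) :
    ‖F x - F z - F' z (x - z)‖ ≤ C := by
  have hseg : ∀ t ∈ Set.Icc (0 : ℝ) 1, z + t • (x - z) ∈ Metric.ball xd ρ := fun t ht =>
    (convex_ball xd ρ).add_smul_sub_mem hz hx ht
  have hd : ∀ t ∈ Set.Icc (0 : ℝ) 1, HasDerivWithinAt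
      (fun t : ℝ => F (z + t • (x - z)) - t • F' z (x - z))
      ((F' (z + t • (x - z)) - F' z) (x - z)) (Set.Icc 0 1) t := by
    intro t ht
    have h1 : HasDerivAt (fun t : ℝ => z + t • (x - z)) (x - z) t := by
      simpa using ((hasDerivAt_id t).smul_const (x - z)).const_add z
    have h2 := (hF _ (hseg t ht)).comp_hasDerivAt t h1
    have h3 : HasDerivAt (fun t : ℝ => t • F' z (x - z)) (F' z (x - z)) t := by
      simpa using (hasDerivAt_id t).smul_const (F' z (x - z))
    exact (h2.sub h3).hasDerivWithinAt
  have h := norm_image_sub_le_of_norm_deriv_le_segment_01' hd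
    (fun t ht => hC t ⟨ht.1, ht.2.le⟩ (hseg t ⟨ht.1, ht.2.le⟩))
  simp only [one_smul, zero_smul, add_zero, sub_zero, add_sub_cancel] at h
  rwa [sub_right_comm] at h

theorem LipschitzDeriv.norm_sub_sub_le {F : X → Y} {F' : X → X →L[ℝ] Y} {xd : X} {ρ L : ℝ}
    (hF : ∀ x ∈ Metric.ball xd ρ, HasFDerivAt F (F' x) x) (hL0 : 0 ≤ L)
    (hL : LipschitzDeriv F' xd ρ L) {x z : X}
    (hx : x ∈ Metric.ball xd ρ) (hz : z ∈ Metric.ball xd ρ) :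
    ‖F x - F z - F' z (x - z)‖ ≤ L * ‖x - z‖ ^ 2 := by
  refine norm_sub_sub_le_of_hasFDerivAt hF hx hz fun t ht hmem => ?_
  have h1 := hL _ hmem z hz
  rw [add_sub_cancel_left, norm_smul, Real.norm_of_nonneg ht.1] at h1
  refine (ContinuousLinearMap.le_opNorm _ _).trans ?_
  rw [sq, ← mul_assoc]
  gcongr
  refine h1.trans ?_
  gcongr
  exact mul_le_of_le_one_left (norm_nonneg _) ht.2

theorem DerivBound.norm_sub_sub_le {F : X → Y} {F' : X → X →L[ℝ] Y} {xd : X} {ρ K₁ K₂ : ℝ}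
    (hF : ∀ x ∈ Metric.ball xd ρ, HasFDerivAt F (F' x) x) (hK₁ : 0 < K₁) (hK₂ : 0 < K₂)
    (hD : DerivBound F' xd ρ K₁ K₂) {x z : X}
    (hx : x ∈ Metric.ball xd ρ) (hz : z ∈ Metric.ball xd ρ) :
    ‖F x - F z - F' z (x - z)‖ ≤ (K₁ + K₂) * ‖x - z‖ * ‖F' z (x - z)‖ := by
  refine norm_sub_sub_le_of_hasFDerivAt hF hx hz fun t ht hmem => ?_
  have h1 := hD _ hmem z hz (x - z)
  rw [add_sub_cancel_left, map_smul, norm_smul, norm_smul, Real.norm_of_nonneg ht.1] at h1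
  refine h1.trans ?_
  have h2 : 0 ≤ ‖x - z‖ * ‖F' z (x - z)‖ := by positivity
  calc _ = t * ((K₁ + K₂) * (‖x - z‖ * ‖F' z (x - z)‖)) := by ring
    _ ≤ 1 * ((K₁ + K₂) * (‖x - z‖ * ‖F' z (x - z)‖)) := by
      gcongr
      exact ht.2
    _ = _ := by ring

/-- The linear part of the update acts on `x₀ - x†` through `g(A_k) A_k = 1 - s(A_k)^N`, leaving the
residual operator; what remains is the noise minus the Taylor remainder. -/
theorem newtonIterate_succ_sub (m : NewtonFilter) (n : ℕ → ℕ) (F : X → Y) (F' : X → X →L[ℝ] Y)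
    (x₀ xd : X) (yδ : Y) (k : ℕ)
    (hT : ‖normalOp (F' (newtonIterate m n F F' x₀ yδ k))‖ ≤ 2 / 9) :
    newtonIterate m n F F' x₀ yδ (k + 1) - xd
      = (m.base (normalOp (F' (newtonIterate m n F F' x₀ yδ k))) ^ m.order (n k)) (x₀ - xd)
        + m.g (1 / (n k : ℝ)) (normalOp (F' (newtonIterate m n F F' x₀ yδ k)))
          (adjoint (F' (newtonIterate m n F F' x₀ yδ k)) ((yδ - F xd)
            - (F (newtonIterate m n F F' x₀ yδ k) - F xd
              - F' (newtonIterate m n F F' x₀ yδ k) (newtonIterate m n F F' x₀ yδ k - xd)))) := by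
  set x := newtonIterate m n F F' x₀ yδ k with hx
  have h1 := m.mul_g_op (show ‖normalOp (F' x)‖ < 1 by linarith) (n k)
  have h2 : m.g (1 / (n k : ℝ)) (normalOp (F' x)) (adjoint (F' x) (F' x (x₀ - xd)))
      = (x₀ - xd) - (m.base (normalOp (F' x)) ^ m.order (n k)) (x₀ - xd) := by
    have := congrArg (fun B : X →L[ℝ] X => B (x₀ - xd)) h1
    simp only [mul_apply_eq_comp, sub_apply, one_apply_eq_self] at this
    exact this
  have h3 : newtonIterate m n F F' x₀ yδ (k + 1) = x₀ - m.g (1 / (n k : ℝ)) (normalOp (F' x))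
      (adjoint (F' x) (F x - yδ - F' x (x - x₀))) := rfl
  have h4 : F x - yδ - F' x (x - x₀)
      = F' x (x₀ - xd) - ((yδ - F xd) - (F x - F xd - F' x (x - xd))) := by
    simp only [map_sub]
    abel
  rw [h3, h4, map_sub, map_sub, h2]
  abel

variable (m : NewtonFilter) {T₁ : X →L[ℝ] Y} (hT₁ : ‖normalOp T₁‖ ≤ 2 / 9) {n : ℕ} (hn : 0 < n)
  {e₀ e' : X} {v r : Y} {δ : ℝ} (hv : ‖v‖ ≤ δ)
  (he' : e' = (m.base (normalOp T₁) ^ m.order n) e₀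
    + m.g (1 / (n : ℝ)) (normalOp T₁) (adjoint T₁ (v - r)))
include hT₁ hn hv he'

theorem norm_newtonStep_sub_le :
    ‖e' - (m.base (normalOp T₁) ^ m.order n) e₀‖ ≤ √2 * √n * (δ + ‖r‖) := by
  rw [he', add_sub_cancel_left]
  refine (m.norm_g_adjoint_apply_le hT₁ hn _).trans ?_
  gcongr
  exact (norm_sub_le _ _).trans (by gcongr)

theorem norm_map_newtonStep_le :
    ‖T₁ e'‖ ≤ ‖T₁ ((m.base (normalOp T₁) ^ m.order n) e₀)‖ + 2 * (δ + ‖r‖) := by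
  have h1 := m.norm_sub_map_g_adjoint_apply_le hT₁ n (v - r)
  have h2 := norm_le_norm_add_norm_sub
    (v - r) (T₁ (m.g (1 / (n : ℝ)) (normalOp T₁) (adjoint T₁ (v - r))))
  have h3 := norm_sub_le v r
  rw [he', map_add]
  refine (norm_add_le _ _).trans ?_
  gcongr
  linarith

/-- The noise enters only through `v - T₁ g T₁* v`, a contraction of `v`, so `δ` appears with
coefficient exactly `1`. This is what permits every `τ > 1`. -/
theorem norm_map_newtonStep_sub_le (T : X →L[ℝ] Y) :
    ‖T e' - v‖ ≤ ‖T₁ ((m.base (normalOp T₁) ^ m.order n) e₀)‖ + δ + 2 * ‖r‖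
      + ‖(T₁ - T) e'‖ := by
  have h1 := m.norm_sub_map_g_adjoint_apply_le hT₁ n v
  have h2 := m.norm_sub_map_g_adjoint_apply_le hT₁ n r
  have h3 := norm_le_norm_add_norm_sub
    r (T₁ (m.g (1 / (n : ℝ)) (normalOp T₁) (adjoint T₁ r)))
  set G := fun z : Y => T₁ (m.g (1 / (n : ℝ)) (normalOp T₁) (adjoint T₁ z)) with hG
  have e1 : T₁ e' = T₁ ((m.base (normalOp T₁) ^ m.order n) e₀) + (G v - G r) := by
    rw [he', hG]
    simp only [map_add, map_sub]
  have e2 : T e' - v = T₁ ((m.base (normalOp T₁) ^ m.order n) e₀) - (v - G v) - G r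
      - (T₁ - T) e' := by
    rw [sub_apply, e1]
    abel
  rw [e2]
  have t1 := norm_sub_le (T₁ ((m.base (normalOp T₁) ^ m.order n) e₀) - (v - G v) - G r)
    ((T₁ - T) e')
  have t2 := norm_sub_le (T₁ ((m.base (normalOp T₁) ^ m.order n) e₀) - (v - G v)) (G r)
  have t3 := norm_sub_le (T₁ ((m.base (normalOp T₁) ^ m.order n) e₀)) (v - G v)
  simp only [hG] at *
  linarith

end NewtonStep

/-- Lets finitely many smallness conditions on one parameter be met simultaneously. -/
theorem eventually_mul_le (c : ℝ) {d : ℝ} (hd : 0 < d) : ∀ᶠ θ in 𝓝[>] (0 : ℝ), θ * c ≤ d := by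
  have h : Tendsto (fun θ : ℝ => θ * c) (𝓝 0) (𝓝 (0 * c)) := tendsto_id.mul_const c
  rw [zero_mul] at h
  exact ((h.eventually (gt_mem_nhds hd)).filter_mono nhdsWithin_le_nhds).mono fun _ h => h.le

/-- A bound for the discrepancy at an index `k'` bounds the stopping index. -/
theorem IsDiscrepancyIndex.le_of_le {X Y : Type*} [NormedAddCommGroup X] [InnerProductSpace ℝ X]
    [CompleteSpace X] [NormedAddCommGroup Y] [InnerProductSpace ℝ Y] [CompleteSpace Y]
    {m : NewtonFilter} {n : ℕ → ℕ} {F : X → Y} {F' : X → X →L[ℝ] Y} {x₀ xd : X} {ρ τ δ : ℝ}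
    {yδ : Y} {k k' : ℕ} (h : IsDiscrepancyIndex m n F F' x₀ xd ρ τ δ yδ k)
    (h' : (∀ j ≤ k', newtonIterate m n F F' x₀ yδ j ∈ Metric.ball xd ρ) →
      ‖F (newtonIterate m n F F' x₀ yδ k') - yδ‖ ≤ τ * δ) : k ≤ k' := by
  by_contra! hlt
  exact absurd (h' fun j hj => h.2.2 j (by omega)) (not_le.2 (h.2.1 k' hlt))

theorem exists_isDiscrepancyIndex {X Y : Type*} [NormedAddCommGroup X] [InnerProductSpace ℝ X]
    [CompleteSpace X] [NormedAddCommGroup Y] [InnerProductSpace ℝ Y] [CompleteSpace Y]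
    {m : NewtonFilter} {n : ℕ → ℕ} {F : X → Y} {F' : X → X →L[ℝ] Y} {x₀ xd : X} {ρ τ δ : ℝ}
    {yδ : Y} {k' : ℕ} (hball : ∀ j ≤ k', newtonIterate m n F F' x₀ yδ j ∈ Metric.ball xd ρ)
    (h' : ‖F (newtonIterate m n F F' x₀ yδ k') - yδ‖ ≤ τ * δ) :
    ∃ k, IsDiscrepancyIndex m n F F' x₀ xd ρ τ δ yδ k := by
  classical
  have hex : ∃ k, ‖F (newtonIterate m n F F' x₀ yδ k) - yδ‖ ≤ τ * δ := ⟨k', h'⟩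
  exact ⟨Nat.find hex, Nat.find_spec hex, fun j hj => not_le.1 (Nat.find_min hex hj),
    fun j hj => hball j (hj.trans (Nat.find_min' hex h'))⟩

/-! ### Structural conditions: iterates and discrepancy. -/

section Structural

set_option linter.unusedSectionVars false

open ContinuousLinearMap (adjoint)

variable {X Y : Type*} [NormedAddCommGroup X] [InnerProductSpace ℝ X] [CompleteSpace X]
  [NormedAddCommGroup Y] [InnerProductSpace ℝ Y] [CompleteSpace Y]
  {m : NewtonFilter} {q : ℕ} {n : ℕ → ℕ} {F : X → Y} {F' : X → X →L[ℝ] Y} {x₀ xd : X}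
  {ρ K₀ K₁ K₂ θ : ℝ}

/-- Used with base point `x†`, the derivative bound makes `F'(x) e` comparable to `F'(x†) e` for `e
= x - x†`; used with base point `x`, it controls the remainder at `x`. Every error is thus a small
factor times the image of `e`. -/
theorem structural_estimates {x : X}
    (hF : ∀ x ∈ Metric.ball xd ρ, HasFDerivAt F (F' x) x)
    (hK₀ : 0 < K₀) (hK₁ : 0 < K₁) (hK₂ : 0 < K₂) (hD : DerivBound F' xd ρ K₁ K₂)
    (hxd : xd ∈ Metric.ball xd ρ) (hx : x ∈ Metric.ball xd ρ) (hθ : θ ≤ 1 / 16)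
    (he : (K₀ + K₁ + K₂) * ‖x - xd‖ ≤ θ) :
    ‖F x - F xd - F' x (x - xd)‖ ≤ 2 * ((K₀ + K₁ + K₂) * ‖x - xd‖) * ‖F' xd (x - xd)‖ ∧
    ‖F x - F xd - F' xd (x - xd)‖ ≤ θ * ‖F' xd (x - xd)‖ ∧
    ∀ w, ‖(F' x - F' xd) w‖ ≤ θ * ‖F' x w‖
      + (K₀ + K₁ + K₂) * ‖w‖ * (2 * ‖F' xd (x - xd)‖) := by
  set e := x - xd with hed
  set κ := K₀ + K₁ + K₂ with hκ
  have he0 : 0 ≤ ‖e‖ := norm_nonneg _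
  have ht0 : 0 ≤ ‖F' xd e‖ := norm_nonneg _
  have hT1 : ‖F' x e‖ ≤ 2 * ‖F' xd e‖ := by
    have h1 := hD x hx xd hxd e
    rw [← hed] at h1
    have h2 := norm_le_norm_add_norm_sub' (F' x e) (F' xd e)
    rw [sub_apply] at h1
    have h3 : K₁ * ‖e‖ * ‖F' xd e‖ + K₂ * ‖F' xd e‖ * ‖e‖ ≤ κ * ‖e‖ * ‖F' xd e‖ := by
      have : 0 ≤ K₀ * ‖e‖ * ‖F' xd e‖ := by positivity
      rw [hκ]
      linarith
    have h4 : κ * ‖e‖ * ‖F' xd e‖ ≤ 1 * ‖F' xd e‖ := by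
      gcongr
      linarith
    linarith
  refine ⟨?_, ?_, fun w => ?_⟩
  · have h1 := hD.norm_sub_sub_le hF hK₁ hK₂ hxd hx
    have h2 : F x - F xd - F' x e = -(F xd - F x - F' x (xd - x)) := by
      rw [hed]
      simp only [map_sub]
      abel
    rw [h2, norm_neg]
    refine h1.trans ?_
    have h3 : ‖F' x (xd - x)‖ = ‖F' x e‖ := by rw [hed, ← neg_sub, map_neg, norm_neg]
    rw [h3, norm_sub_rev, ← hed]
    calc (K₁ + K₂) * ‖e‖ * ‖F' x e‖ ≤ κ * ‖e‖ * (2 * ‖F' xd e‖) := by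
          gcongr
          linarith
      _ = _ := by ring
  · refine (hD.norm_sub_sub_le hF hK₁ hK₂ hx hxd).trans ?_
    rw [← hed]
    gcongr
    refine le_trans ?_ he
    gcongr
    linarith
  · have h1 := hD xd hxd x hx w
    have h3 : ‖F' x (xd - x)‖ = ‖F' x e‖ := by rw [hed, ← neg_sub, map_neg, norm_neg]
    rw [h3, norm_sub_rev xd x, ← hed, ← neg_sub (F' x), neg_apply, norm_neg] at h1
    refine h1.trans ?_
    have h4 : K₁ * ‖e‖ ≤ θ := le_trans (by gcongr; linarith) he
    calc K₁ * ‖e‖ * ‖F' x w‖ + K₂ * ‖F' x e‖ * ‖w‖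
        ≤ θ * ‖F' x w‖ + κ * (2 * ‖F' xd e‖) * ‖w‖ := by
          gcongr
          linarith
      _ = _ := by ring

variable (hn : StepIntegers q n) (hop : OperatorConditions m (1 / (n 0 : ℝ)) F F' xd ρ)
  (hK₀ : 0 < K₀) (hK₁ : 0 < K₁) (hK₂ : 0 < K₂) (hD : DerivBound F' xd ρ K₁ K₂)
  {yδ : Y} {δ : ℝ} (hδ : 0 < δ) (hy : ‖yδ - F xd‖ ≤ δ) (hθ : θ ≤ 1 / 16)
include hn hop hK₀ hK₁ hK₂ hD hδ hy hθ

/-- Remainders are bounded by `θ` times images of errors, so `‖F'(x†) e_k‖` satisfies a recursion of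
its own with a small coefficient. -/
theorem structural_step (k : ℕ) {x x' : X} (hxdef : x = newtonIterate m n F F' x₀ yδ k)
    (hxdef' : x' = newtonIterate m n F F' x₀ yδ (k + 1)) (hx : x ∈ Metric.ball xd ρ)
    (he : (K₀ + K₁ + K₂) * ‖x - xd‖ ≤ θ) :
    ‖x' - xd - (m.base (normalOp (F' x)) ^ m.order (n k)) (x₀ - xd)‖
      ≤ √2 * √(n k : ℝ) * (δ + 2 * ((K₀ + K₁ + K₂) * ‖x - xd‖) * ‖F' xd (x - xd)‖) ∧
    ((K₀ + K₁ + K₂) * ‖x' - xd‖ ≤ θ →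
      ‖F' xd (x' - xd)‖ ≤ 2 * ‖F' x ((m.base (normalOp (F' x)) ^ m.order (n k)) (x₀ - xd))‖
        + 4 * δ + 10 * θ * ‖F' xd (x - xd)‖ ∧
      (x' ∈ Metric.ball xd ρ → ‖F x' - yδ‖
        ≤ ‖F' x ((m.base (normalOp (F' x)) ^ m.order (n k)) (x₀ - xd))‖ + δ
          + 7 * θ * (‖F' xd (x - xd)‖ + ‖F' xd (x' - xd)‖))) := by
  have hxd : xd ∈ Metric.ball xd ρ := Metric.mem_ball_self hop.radius_pos
  have hT₁ := hop.norm_normalOp_le' (hn.pos 0) hx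
  obtain ⟨hr, -, hw⟩ := structural_estimates hop.hasFDerivAt hK₀ hK₁ hK₂ hD hxd hx hθ he
  have he' := newtonIterate_succ_sub m n F F' x₀ xd yδ k (by rw [← hxdef]; exact hT₁)
  rw [← hxdef, ← hxdef'] at he'
  set κ := K₀ + K₁ + K₂ with hκ
  have hκ0 : 0 < κ := by positivity
  set r := F x - F xd - F' x (x - xd)
  set t := ‖F' xd (x - xd)‖
  have ht0 : 0 ≤ t := norm_nonneg _
  have hθ0 : 0 ≤ θ := le_trans (by positivity) he
  have hr' : ‖r‖ ≤ 2 * θ * t := hr.trans (by gcongr)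
  refine ⟨(norm_newtonStep_sub_le m hT₁ (hn.pos k) hy he').trans (by gcongr), fun hκe => ?_⟩
  have h1 := norm_map_newtonStep_le m hT₁ (hn.pos k) hy he'
  have h2 := norm_map_newtonStep_sub_le m hT₁ (hn.pos k) hy he' (F' xd)
  have h3 := hw (x' - xd)
  have h4 : κ * ‖x' - xd‖ * (2 * t) ≤ θ * (2 * t) := by gcongr
  have h5 := norm_le_norm_add_norm_sub (F' x (x' - xd)) (F' xd (x' - xd))
  have h6 := norm_le_norm_add_norm_sub' (F' x (x' - xd)) (F' xd (x' - xd))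
  rw [sub_apply] at h3 h2
  set t' := ‖F' xd (x' - xd)‖
  set p := ‖F' x ((m.base (normalOp (F' x)) ^ m.order (n k)) (x₀ - xd))‖
  set b := ‖F' x (x' - xd)‖
  have hp0 : 0 ≤ p := norm_nonneg _
  have hb0 : 0 ≤ b := norm_nonneg _
  have h7 : θ * b ≤ 1 / 16 * b := by gcongr
  have hθt : 0 ≤ θ * t := by positivity
  refine ⟨by linarith, fun hx' => ?_⟩
  obtain ⟨-, hr2, -⟩ := structural_estimates hop.hasFDerivAt hK₀ hK₁ hK₂ hD hxd hx' hθ hκe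
  have e1 : F x' - yδ = (F x' - F xd - F' xd (x' - xd)) + (F' xd (x' - xd) - (yδ - F xd)) := by
    abel
  rw [e1]
  refine (norm_add_le _ _).trans ?_
  have h8 : b ≤ 2 * t' + t := by
    have : θ * t ≤ 1 / 16 * t := by gcongr
    linarith
  have h9 : θ * b ≤ θ * (2 * t' + t) := by gcongr
  have h10 : 0 ≤ θ * t' := by positivity
  linarith

/-- Bounds for the iterates as long as the noise does not dominate. -/
theorem structural_bounds {γ : ℝ} (hγ : 0 < γ)
    (hρ : 2 * (1 + √2 * γ) * ‖x₀ - xd‖ < ρ)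
    (hκM : (K₀ + K₁ + K₂) * (2 * (1 + √2 * γ) * ‖x₀ - xd‖) ≤ θ)
    (hθc : θ * (√(1 + q) * (3 + 4 * γ)) ≤ 1 / 10) {kt : ℕ}
    (hkt : ∀ j < kt, √(n j : ℝ) * δ ≤ γ * ‖x₀ - xd‖) :
    ∀ k ≤ kt, ‖newtonIterate m n F F' x₀ yδ k - xd‖ ≤ 2 * (1 + √2 * γ) * ‖x₀ - xd‖ ∧
      √(n k : ℝ) * ‖F' xd (newtonIterate m n F F' x₀ yδ k - xd)‖
        ≤ √(1 + q) * (3 + 4 * γ) * ‖x₀ - xd‖ := by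
  have hxd : xd ∈ Metric.ball xd ρ := Metric.mem_ball_self hop.radius_pos
  have hT := hop.norm_normalOp_le' (hn.pos 0) hxd
  have hT0 := hop.norm_normalOp_le hxd
  set E := ‖x₀ - xd‖ with hE
  have hE0 : 0 ≤ E := norm_nonneg _
  set c := √(1 + q) * (3 + 4 * γ) with hc
  have hsq : (1 : ℝ) ≤ √(1 + q) := by
    rw [Real.one_le_sqrt]
    have : (0 : ℝ) ≤ q := Nat.cast_nonneg q
    linarith
  have hs2 : √(2 : ℝ) ≤ 2 := by
    rw [Real.sqrt_le_left (by norm_num)]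
    norm_num
  have hκ0 : 0 < K₀ + K₁ + K₂ := by positivity
  have hθ0 : 0 ≤ θ := le_trans (by positivity) hκM
  intro k
  induction k with
  | zero =>
    intro _
    refine ⟨?_, ?_⟩
    · change E ≤ _
      have : 0 ≤ √2 * γ * E := by positivity
      nlinarith
    · have h4 : ‖F' xd‖ ≤ 1 / 2 / √(n 0 : ℝ) := by
        refine abs_le_of_sq_le_sq' ?_ (by positivity) |>.2
        rw [sq, ← norm_normalOp, div_pow, Real.sq_sqrt (by positivity)]
        refine hT0.trans ?_
        gcongr
        norm_num
      have hs0 := hn.sqrt_pos 0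
      change √(n 0 : ℝ) * ‖F' xd (x₀ - xd)‖ ≤ c * E
      calc √(n 0 : ℝ) * ‖F' xd (x₀ - xd)‖ ≤ √(n 0 : ℝ) * (1 / 2 / √(n 0 : ℝ) * E) := by
            gcongr
            exact (ContinuousLinearMap.le_opNorm _ _).trans (by gcongr)
        _ = 1 / 2 * E := by field_simp
        _ ≤ c * E := by
          gcongr
          nlinarith
  | succ k ih =>
    intro hk
    obtain ⟨ih1, ih2⟩ := ih (by omega)
    have hnoise := hkt k (by omega)
    generalize hxdef : newtonIterate m n F F' x₀ yδ k = x at ih1 ih2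
    have hxball : x ∈ Metric.ball xd ρ := by
      rw [Metric.mem_ball, dist_eq_norm]
      linarith
    have hκe : (K₀ + K₁ + K₂) * ‖x - xd‖ ≤ θ := le_trans (by gcongr) hκM
    obtain ⟨s1, s2⟩ := structural_step hn hop hK₀ hK₁ hK₂ hD hδ hy hθ k hxdef.symm rfl hxball hκe
    have hT₁ := hop.norm_normalOp_le' (hn.pos 0) hxball
    generalize newtonIterate m n F F' x₀ yδ (k + 1) = x' at s1 s2 ⊢
    have hsk := hn.sqrt_pos k
    set t := ‖F' xd (x - xd)‖
    have ht0 : 0 ≤ t := norm_nonneg _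
    -- The induction hypothesis on the image together with the smallness `hθc` makes all remainders
    -- a fixed fraction of `E`, which closes both inductions.
    have hst : θ * (√(n k : ℝ) * t) ≤ 1 / 10 * E := by
      calc θ * (√(n k : ℝ) * t) ≤ θ * (c * E) := by gcongr
        _ = θ * c * E := by ring
        _ ≤ _ := by gcongr
    have h1 : ‖x' - xd‖ ≤ 2 * (1 + √2 * γ) * E := by
      have h2 := m.norm_base_pow_apply_le hT₁ (m.order (n k)) (x₀ - xd)
      have h3 := norm_le_norm_add_norm_sub' (x' - xd)
        ((m.base (normalOp (F' x)) ^ m.order (n k)) (x₀ - xd))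
      have h4 : √2 * √(n k : ℝ) * (δ + 2 * ((K₀ + K₁ + K₂) * ‖x - xd‖) * t)
          ≤ √2 * (γ * E) + 4 * (1 / 10 * E) := by
        calc _ ≤ √2 * √(n k : ℝ) * (δ + 2 * θ * t) := by gcongr
          _ = √2 * (√(n k : ℝ) * δ) + √2 * 2 * (θ * (√(n k : ℝ) * t)) := by ring
          _ ≤ √2 * (γ * E) + 2 * 2 * (1 / 10 * E) := by gcongr
          _ = _ := by ring
      have : 0 ≤ √2 * γ * E := by positivity
      linarith
    refine ⟨h1, ?_⟩
    obtain ⟨s3, -⟩ := s2 (le_trans (by gcongr) hκM)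
    have h2 := m.norm_map_base_order_apply_le hT₁ (hn.pos k) (x₀ - xd)
    set p := ‖F' x ((m.base (normalOp (F' x)) ^ m.order (n k)) (x₀ - xd))‖
    have h3 : √(n k : ℝ) * p ≤ 2 / 3 * E := by
      calc √(n k : ℝ) * p ≤ √(n k : ℝ) * (√2 / 3 / √(n k : ℝ) * E) := by gcongr
        _ = √2 / 3 * E := by field_simp
        _ ≤ _ := by gcongr
    set t' := ‖F' xd (x' - xd)‖
    have h4 : √(n k : ℝ) * t' ≤ (3 + 4 * γ) * E := by
      calc √(n k : ℝ) * t' ≤ √(n k : ℝ) * (2 * p + 4 * δ + 10 * θ * t) := by gcongr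
        _ = 2 * (√(n k : ℝ) * p) + 4 * (√(n k : ℝ) * δ)
            + 10 * (θ * (√(n k : ℝ) * t)) := by ring
        _ ≤ 2 * (2 / 3 * E) + 4 * (γ * E) + 10 * (1 / 10 * E) := by
          linarith
        _ ≤ _ := by linarith
    calc √(n (k + 1) : ℝ) * t' ≤ √(1 + q) * √(n k : ℝ) * t' := by
          gcongr
          exact hn.sqrt_succ_le k
      _ = √(1 + q) * (√(n k : ℝ) * t') := by ring
      _ ≤ √(1 + q) * ((3 + 4 * γ) * E) := mul_le_mul_of_nonneg_left h4 (Real.sqrt_nonneg _)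
      _ = c * E := by rw [hc]; ring

/-- The discrepancy at the index where the noise begins to dominate. -/
theorem structural_discrepancy {γ τ : ℝ} (hγ : 0 < γ)
    (hρ : 2 * (1 + √2 * γ) * ‖x₀ - xd‖ < ρ)
    (hκM : (K₀ + K₁ + K₂) * (2 * (1 + √2 * γ) * ‖x₀ - xd‖) ≤ θ)
    (hθc : θ * (√(1 + q) * (3 + 4 * γ)) ≤ 1 / 10)
    (hθτ : √(1 + q) / γ * (√2 / 3 + 14 * (θ * (√(1 + q) * (3 + 4 * γ)))) ≤ τ - 1) {kt : ℕ}
    (hkt : ∀ j < kt, √(n j : ℝ) * δ ≤ γ * ‖x₀ - xd‖)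
    (hkt' : γ * ‖x₀ - xd‖ < √(n kt : ℝ) * δ) :
    ‖F (newtonIterate m n F F' x₀ yδ kt) - yδ‖ ≤ τ * δ := by
  have hxd : xd ∈ Metric.ball xd ρ := Metric.mem_ball_self hop.radius_pos
  have hb := structural_bounds hn hop hK₀ hK₁ hK₂ hD hδ hy hθ hγ hρ hκM hθc hkt
  have hT := hop.norm_normalOp_le' (hn.pos 0) hxd
  have hT0 := hop.norm_normalOp_le hxd
  set E := ‖x₀ - xd‖ with hE
  have hE0 : 0 ≤ E := norm_nonneg _
  set c := √(1 + q) * (3 + 4 * γ) with hc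
  have hsq : (1 : ℝ) ≤ √(1 + q) := by
    rw [Real.one_le_sqrt]
    have : (0 : ℝ) ≤ q := Nat.cast_nonneg q
    linarith
  have hc3 : 3 ≤ c := by
    have : 0 ≤ √(1 + (q : ℝ)) * (4 * γ) := by positivity
    rw [hc]
    linarith
  have hκ0 : 0 < K₀ + K₁ + K₂ := by positivity
  have hθ0 : 0 ≤ θ := le_trans (by positivity) hκM
  have hball : ∀ k ≤ kt, newtonIterate m n F F' x₀ yδ k ∈ Metric.ball xd ρ := fun k hk => by
    rw [Metric.mem_ball, dist_eq_norm]
    linarith [(hb k hk).1]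
  have hκe : ∀ k ≤ kt, (K₀ + K₁ + K₂) * ‖newtonIterate m n F F' x₀ yδ k - xd‖ ≤ θ :=
    fun k hk => le_trans (by gcongr; exact (hb k hk).1) hκM
  -- At `kt = 0` there is no preceding step; the scaling bound `‖F'(x†)‖ ≤ √2/3/√n₀` replaces the
  -- residual estimate.
  rcases Nat.eq_zero_or_pos kt with rfl | hpos
  · have h1 := hball 0 le_rfl
    change x₀ ∈ _ at h1
    have h2 := hκe 0 le_rfl
    change _ * ‖x₀ - xd‖ ≤ θ at h2
    obtain ⟨-, hr2, -⟩ := structural_estimates hop.hasFDerivAt hK₀ hK₁ hK₂ hD hxd h1 hθ h2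
    have hs0 := hn.sqrt_pos 0
    have h4 : ‖F' xd‖ ≤ √2 / 3 / √(n 0 : ℝ) := by
      refine abs_le_of_sq_le_sq' ?_ (by positivity) |>.2
      rw [sq, ← norm_normalOp, div_pow, div_pow, Real.sq_sqrt (by positivity),
        Real.sq_sqrt (by positivity)]
      refine hT0.trans_eq ?_
      norm_num
    have h5 : ‖F' xd (x₀ - xd)‖ ≤ √2 / 3 * (δ / γ) := by
      calc ‖F' xd (x₀ - xd)‖ ≤ √2 / 3 / √(n 0 : ℝ) * E :=
            (ContinuousLinearMap.le_opNorm _ _).trans (by gcongr)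
        _ = √2 / 3 * (E / √(n 0 : ℝ)) := by ring
        _ ≤ _ := by
          refine mul_le_mul_of_nonneg_left ?_ (by positivity)
          rw [div_le_div_iff₀ hs0 hγ]
          linarith
    have hs2 : √(2 : ℝ) ≤ 2 := by
      rw [Real.sqrt_le_left (by norm_num)]
      norm_num
    set t := ‖F' xd (x₀ - xd)‖
    change ‖F x₀ - yδ‖ ≤ τ * δ
    have e1 : F x₀ - yδ = (F x₀ - F xd - F' xd (x₀ - xd)) + F' xd (x₀ - xd) - (yδ - F xd) := by
      abel
    have h6 : ‖F x₀ - yδ‖ ≤ θ * t + t + δ := by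
      rw [e1]
      refine (norm_sub_le _ _).trans (add_le_add ((norm_add_le _ _).trans ?_) hy)
      exact add_le_add_left hr2 _
    have h7 : θ * t + t ≤ √(1 + q) / γ * (√2 / 3 + 14 * (θ * c)) * δ := by
      calc θ * t + t = (θ + 1) * t := by ring
        _ ≤ (θ + 1) * (√2 / 3 * (δ / γ)) := by gcongr
        _ = 1 / γ * (√2 / 3 + θ * (√2 / 3)) * δ := by ring
        _ ≤ √(1 + q) / γ * (√2 / 3 + 14 * (θ * c)) * δ := by
          have h8 : θ * (√2 / 3) ≤ 14 * (θ * c) := by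
            have : θ * (√2 / 3) ≤ θ * (14 * c) := by
              gcongr
              linarith
            linarith
          refine mul_le_mul_of_nonneg_right (mul_le_mul ?_ ?_ ?_ ?_) hδ.le
          · gcongr
          · linarith
          · positivity
          · positivity
    have h8 : √(1 + q) / γ * (√2 / 3 + 14 * (θ * c)) * δ ≤ (τ - 1) * δ := by gcongr
    linarith
  · obtain ⟨k, rfl⟩ := Nat.exists_eq_add_of_lt hpos
    rw [zero_add] at *
    have hxb := hball k (by omega)
    have hxb' := hball (k + 1) le_rfl
    have ⟨_, s2⟩ := structural_step hn hop hK₀ hK₁ hK₂ hD hδ hy hθ k rfl rfl hxb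
      (hκe k (by omega))
    have ⟨_, s3⟩ := s2 (hκe (k + 1) le_rfl)
    have s4 := s3 hxb'
    have b1 := (hb k (by omega)).2
    have b2 := (hb (k + 1) le_rfl).2
    have hT₁ := hop.norm_normalOp_le' (hn.pos 0) hxb
    generalize newtonIterate m n F F' x₀ yδ (k + 1) = x' at *
    generalize newtonIterate m n F F' x₀ yδ k = x at *
    have h2 := m.norm_map_base_order_apply_le hT₁ (hn.pos k) (x₀ - xd)
    have hsk := hn.sqrt_pos k
    have hsk' := hn.sqrt_pos (k + 1)
    -- Noise dominates at `k + 1` and `n (k+1) ≤ (1 + q) n k`. Times the residual constant `√2/3`,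
    -- this is where the lower bound on `γ₁` originates.
    have hEn : E / √(n k : ℝ) ≤ √(1 + q) / γ * δ := by
      calc E / √(n k : ℝ) ≤ (√(n (k + 1) : ℝ) * δ / γ) / √(n k : ℝ) := by
            gcongr
            rw [le_div_iff₀ hγ]
            linarith
        _ ≤ (√(1 + q) * √(n k : ℝ) * δ / γ) / √(n k : ℝ) := by
            gcongr
            exact hn.sqrt_succ_le k
        _ = _ := by field_simp
    have t1 : ‖F' xd (x - xd)‖ ≤ c * (E / √(n k : ℝ)) := by
      rw [← mul_div_assoc, le_div_iff₀ hsk]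
      linarith
    have t2 : ‖F' xd (x' - xd)‖ ≤ c * (E / √(n k : ℝ)) := by
      rw [← mul_div_assoc, le_div_iff₀ hsk]
      refine le_trans ?_ b2
      rw [mul_comm]
      gcongr
      exact_mod_cast hn.mono k
    have h3 : √2 / 3 / √(n k : ℝ) * ‖x₀ - xd‖ = √2 / 3 * (E / √(n k : ℝ)) := by
      rw [hE]
      ring
    rw [h3] at h2
    calc ‖F x' - yδ‖ ≤ _ := s4
      _ ≤ √2 / 3 * (E / √(n k : ℝ)) + δ + 7 * θ * (c * (E / √(n k : ℝ))
          + c * (E / √(n k : ℝ))) := by gcongr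
      _ = δ + (√2 / 3 + 14 * (θ * c)) * (E / √(n k : ℝ)) := by ring
      _ ≤ δ + (√2 / 3 + 14 * (θ * c)) * (√(1 + q) / γ * δ) := by gcongr
      _ = δ + √(1 + q) / γ * (√2 / 3 + 14 * (θ * c)) * δ := by ring
      _ ≤ δ + (τ - 1) * δ := by gcongr
      _ = τ * δ := by ring

end Structural

/-! ### Structural conditions: oracle inequality. -/

section StructuralOracle

set_option linter.unusedSectionVars false

open ContinuousLinearMap (adjoint)

variable {X Y : Type*} [NormedAddCommGroup X] [InnerProductSpace ℝ X] [CompleteSpace X]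
  [NormedAddCommGroup Y] [InnerProductSpace ℝ Y] [CompleteSpace Y]

theorem RangeInvariance.norm_base_pow_sub_base_pow_apply_le (m : NewtonFilter)
    {F' : X → X →L[ℝ] Y} {xd x : X} {ρ K₀ : ℝ} (hR : RangeInvariance F' xd ρ K₀)
    (hx : x ∈ Metric.ball xd ρ) (hxd : xd ∈ Metric.ball xd ρ)
    (hT : ‖normalOp (F' xd)‖ ≤ 2 / 9) (hT' : ‖normalOp (F' x)‖ ≤ 2 / 9) (N : ℕ) (z : X) :
    ‖(m.base (normalOp (F' x)) ^ N - m.base (normalOp (F' xd)) ^ N) z‖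
      ≤ 10 * (K₀ * ‖x - xd‖) * ‖z‖ := by
  obtain ⟨R, hR1, hR2⟩ := hR x hx xd hxd
  obtain ⟨R', hR1', hR2'⟩ := hR xd hxd x hx
  rw [norm_sub_rev xd x] at hR2'
  exact m.norm_base_pow_sub_base_pow_apply_le hT hT' hR1 hR1' hR2 hR2' N z

/-- The scaled norm of the initial error is controlled by its residual. -/
theorem StepIntegers.norm_div_sqrt_le_halfResidual {q : ℕ} {n : ℕ → ℕ} (hn : StepIntegers q n)
    (m : NewtonFilter) {T : X →L[ℝ] Y} (hT : ‖normalOp T‖ ≤ 2 / 9)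
    (hT0 : ‖normalOp T‖ ≤ 2 / 9 / n 0) (e : X) : ‖e‖ / √(n 0 : ℝ) ≤ 2 * m.halfResidual T n e 0 := by
  have h1 := m.norm_le_two_mul_norm_base_order hT (hn.pos 0) hT0 e
  have h2 := m.norm_base_pow_anti hT (Nat.div_le_self (m.order (n 0)) 2) e
  have hs := hn.sqrt_pos 0
  unfold NewtonFilter.halfResidual
  rw [← mul_div_assoc]
  gcongr
  linarith

variable {m : NewtonFilter} {q : ℕ} {n : ℕ → ℕ} {F : X → Y} {F' : X → X →L[ℝ] Y} {x₀ xd : X}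
  {ρ K₀ K₁ K₂ : ℝ}

/-- Used with `φ = √·` in the structural case and `φ = id` in the Lipschitz case. -/
theorem exists_index_noise_dominates {n : ℕ → ℕ} (hn : Tendsto n atTop atTop) {φ : ℝ → ℝ}
    (hφ : Tendsto φ atTop atTop) {δ : ℝ} (hδ : 0 < δ) (c : ℝ) :
    ∃ kt, (∀ j < kt, φ (n j) * δ ≤ c) ∧ c < φ (n kt) * δ := by
  classical
  have h1 : Tendsto (fun k => φ (n k) * δ) atTop atTop :=
    (hφ.comp (tendsto_natCast_atTop_atTop.comp hn)).atTop_mul_const hδ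
  have hex : ∃ k, c < φ (n k) * δ := (h1.eventually_gt_atTop c).exists
  exact ⟨Nat.find hex, fun j hj => not_lt.1 (Nat.find_min hex hj), Nat.find_spec hex⟩

/-- The oracle inequality for the method under the structural conditions. -/
theorem structural_oracleBound (hn : StepIntegers q n)
    (hop : OperatorConditions m (1 / (n 0 : ℝ)) F F' xd ρ)
    (hK₀ : 0 < K₀) (hK₁ : 0 < K₁) (hK₂ : 0 < K₂) (hR : RangeInvariance F' xd ρ K₀)
    (hD : DerivBound F' xd ρ K₁ K₂) {γ τ θ c cs : ℝ} (hτ : 1 < τ) (hγ : 0 < γ)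
    (hc : c = √(1 + q) * (3 + 4 * γ)) (hcs : cs = 9 * ((1 + q) * 2 ^ q))
    (hρ : 2 * (1 + √2 * γ) * ‖x₀ - xd‖ < ρ)
    (hκM : (K₀ + K₁ + K₂) * (2 * (1 + √2 * γ) * ‖x₀ - xd‖) ≤ θ) (hθ : θ ≤ 1 / 16)
    (hθc : θ * c ≤ 1 / 10) (hθτ : √(1 + q) / γ * (√2 / 3 + 14 * (θ * c)) ≤ τ - 1)
    (hθb : θ * (6 * c + 10) * NewtonFilter.errorConst q ≤ 1 / 8)
    (hθs : θ * (6 * c + 10) * (2 * NewtonFilter.errorConst q + 16 * cs) ≤ (τ - 1) / 2)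
    (hθcs : θ * (10 * cs) ≤ 1)
    {yδ : Y} {δ : ℝ} (hδ : 0 < δ) (hy : ‖yδ - F xd‖ ≤ δ) :
    (∃ k, IsDiscrepancyIndex m n F F' x₀ xd ρ τ δ yδ k) ∧
    ∀ K, IsDiscrepancyIndex m n F F' x₀ xd ρ τ δ yδ K →
      OracleBound (fun j => ‖(m.base (normalOp (F' xd)) ^ j) (x₀ - xd)‖)
        (3 * (2 * (τ + 1)) + 12 + (q + 2) + 4 * (4 + τ) / (τ - 1)) δ
        ‖newtonIterate m n F F' x₀ yδ K - xd‖ := by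
  obtain ⟨kt, hkt, hkt'⟩ := exists_index_noise_dominates hn.tendsto Real.tendsto_sqrt_atTop hδ
    (γ * ‖x₀ - xd‖)
  have hb := structural_bounds hn hop hK₀ hK₁ hK₂ hD hδ hy hθ hγ hρ hκM (hc ▸ hθc) hkt
  have hdisc := structural_discrepancy hn hop hK₀ hK₁ hK₂ hD hδ hy hθ hγ hρ hκM (hc ▸ hθc)
    (hc ▸ hθτ) hkt hkt'
  rw [← hc] at hb
  have hball : ∀ k ≤ kt, newtonIterate m n F F' x₀ yδ k ∈ Metric.ball xd ρ := fun k hk => by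
    rw [Metric.mem_ball, dist_eq_norm]
    linarith [(hb k hk).1]
  refine ⟨exists_isDiscrepancyIndex hball hdisc, fun K hK => ?_⟩
  have hKkt : K ≤ kt := hK.le_of_le fun _ => hdisc
  have hxd : xd ∈ Metric.ball xd ρ := Metric.mem_ball_self hop.radius_pos
  have hT := hop.norm_normalOp_le' (hn.pos 0) hxd
  have hT0 := hop.norm_normalOp_le hxd
  have hκ0 : 0 < K₀ + K₁ + K₂ := by positivity
  have hθ0 : 0 ≤ θ := le_trans (by positivity) hκM
  have hc0 : 0 ≤ c := by rw [hc]; positivity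
  have hcs0 : 9 ≤ cs := by
    have h1 : (1 : ℝ) ≤ 2 ^ q := one_le_pow₀ (by norm_num)
    have h2 : (1 : ℝ) ≤ 1 + q := by
      have := Nat.cast_nonneg (α := ℝ) q
      linarith
    have := one_le_mul_of_one_le_of_one_le h2 h1
    linarith
  have hb0 := NewtonFilter.one_le_errorConst q
  set κ := K₀ + K₁ + K₂ with hκdef
  -- The `10` comes from perturbing the residual operator; the multiple of `c` covers the Taylor
  -- remainder.
  set Θ := θ * (6 * c + 10) with hΘdef
  have hΘ0 : 0 ≤ Θ := by positivity
  have hΘθ : 10 * θ ≤ Θ := by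
    have : 0 ≤ θ * c := by positivity
    rw [hΘdef]
    linarith
  have hE0 : 0 ≤ ‖x₀ - xd‖ := norm_nonneg _
  have hκE : κ * ‖x₀ - xd‖ ≤ θ := by
    refine le_trans ?_ hκM
    gcongr
    have : 0 ≤ √2 * γ * ‖x₀ - xd‖ := by positivity
    linarith
  have hκe : ∀ k ≤ K, κ * ‖newtonIterate m n F F' x₀ yδ k - xd‖ ≤ θ :=
    fun k hk => le_trans (by gcongr; exact (hb k (hk.trans hKkt)).1) hκM
  have hballK : ∀ k ≤ K, newtonIterate m n F F' x₀ yδ k ∈ Metric.ball xd ρ := hK.2.2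
  -- In the perturbation bound `‖x_k - x†‖ ‖x₀ - x†‖`, the initial error supplies the smallness and
  -- the current error remains as a factor.
  have hpert : ∀ k ≤ K, ∀ j : ℕ,
      ‖(m.base (normalOp (F' (newtonIterate m n F F' x₀ yδ k))) ^ j
        - m.base (normalOp (F' xd)) ^ j) (x₀ - xd)‖
        ≤ (10 * θ) * ‖newtonIterate m n F F' x₀ yδ k - xd‖ := by
    intro k hk j
    refine (hR.norm_base_pow_sub_base_pow_apply_le m (hballK k hk) hxd hT
      (hop.norm_normalOp_le' (hn.pos 0) (hballK k hk)) j _).trans ?_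
    have h1 : K₀ * ‖x₀ - xd‖ ≤ θ := by
      refine le_trans ?_ hκE
      gcongr
      linarith
    calc 10 * (K₀ * ‖newtonIterate m n F F' x₀ yδ k - xd‖) * ‖x₀ - xd‖
        = 10 * (K₀ * ‖x₀ - xd‖) * ‖newtonIterate m n F F' x₀ yδ k - xd‖ := by ring
      _ ≤ _ := by gcongr
  have hstep := fun k (hk : k ≤ K) => structural_step hn hop hK₀ hK₁ hK₂ hD hδ hy hθ k rfl rfl
    (hballK k hk) (hκe k hk)
  generalize hx : newtonIterate m n F F' x₀ yδ = x at *
  have hx0 : x 0 = x₀ := by rw [← hx]; rfl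
  have hrec : ∀ k < K, ‖x (k + 1) - xd - (m.base (normalOp (F' xd)) ^ m.order (n k)) (x₀ - xd)‖
      ≤ Θ * ‖x k - xd‖ + 2 * √(n k : ℝ) * δ := by
    intro k hk
    have h1 := (hstep k hk.le).1
    have h2 := hpert k hk.le (m.order (n k))
    have h3 := (hb k (hk.le.trans hKkt)).2
    have hsk := hn.sqrt_pos k
    have hs2 : √(2 : ℝ) ≤ 2 := by
      rw [Real.sqrt_le_left (by norm_num)]
      norm_num
    have h4 : √2 * √(n k : ℝ) * (δ + 2 * (κ * ‖x k - xd‖) * ‖F' xd (x k - xd)‖)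
        ≤ 2 * √(n k : ℝ) * δ + 4 * c * θ * ‖x k - xd‖ := by
      calc _ = √2 * √(n k : ℝ) * δ + √2 * 2 * (κ * ‖x k - xd‖)
              * (√(n k : ℝ) * ‖F' xd (x k - xd)‖) := by ring
        _ ≤ 2 * √(n k : ℝ) * δ + 2 * 2 * (κ * ‖x k - xd‖) * (c * ‖x₀ - xd‖) := by gcongr
        _ = 2 * √(n k : ℝ) * δ + 4 * c * (κ * ‖x₀ - xd‖) * ‖x k - xd‖ := by ring
        _ ≤ _ := by gcongr
    rw [sub_apply] at h2
    have h5 := norm_sub_le_norm_sub_add_norm_sub (x (k + 1) - xd)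
      ((m.base (normalOp (F' (x k))) ^ m.order (n k)) (x₀ - xd))
      ((m.base (normalOp (F' xd)) ^ m.order (n k)) (x₀ - xd))
    have h6 : 0 ≤ c * θ * ‖x k - xd‖ := by positivity
    have h7 : Θ * ‖x k - xd‖ = 6 * (c * θ * ‖x k - xd‖) + 10 * θ * ‖x k - xd‖ := by
      rw [hΘdef]
      ring
    linarith
  have herr := m.norm_error_le hT hn hT0 (e := fun k => x k - xd) hδ hΘ0
    (show Θ * NewtonFilter.errorConst q ≤ 1 by linarith) (by simpa only [hx0] using hrec)
  simp only [hx0] at herr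
  have hp : ∀ k < K, ‖F' (x k) ((m.base (normalOp (F' (x k))) ^ m.order (n k)) (x₀ - xd))‖
      ≤ 4 * m.halfResidual (F' xd) n (x₀ - xd) k + 2 * NewtonFilter.errorConst q * Θ * δ := by
    intro k hk
    refine m.norm_map_residual_le_halfResidual hT hn
      (hop.norm_normalOp_le' (hn.pos 0) (hballK k hk.le)) hΘ0 (by linarith) (herr k hk.le)
      fun j => (hpert k hk.le j).trans ?_
    gcongr
  -- The `9` in `cs` is `8` from twice the mapped residual plus `1` from the absorbed previous term;
  -- `(1 + q) 2^q` pays for passing to the next index.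
  have hs : ∀ k ≤ K, ‖F' xd (x k - xd)‖
      ≤ cs * (m.halfResidual (F' xd) n (x₀ - xd) k + δ) := by
    intro k
    induction k with
    | zero =>
      intro _
      have h1 := hn.norm_div_sqrt_le_halfResidual m hT hT0 (x₀ - xd)
      have hs0 := hn.sqrt_pos 0
      have h4 : ‖F' xd‖ ≤ 1 / 2 / √(n 0 : ℝ) := by
        refine abs_le_of_sq_le_sq' ?_ (by positivity) |>.2
        rw [sq, ← norm_normalOp, div_pow, Real.sq_sqrt (by positivity)]
        refine hT0.trans ?_
        gcongr
        norm_num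
      have h5 : ‖F' xd (x₀ - xd)‖ ≤ 1 / 2 / √(n 0 : ℝ) * ‖x₀ - xd‖ :=
        (ContinuousLinearMap.le_opNorm _ _).trans (by gcongr)
      have h6 : 1 / 2 / √(n 0 : ℝ) * ‖x₀ - xd‖ = 1 / 2 * (‖x₀ - xd‖ / √(n 0 : ℝ)) := by ring
      have h7 := m.halfResidual_nonneg hT hn (x₀ - xd) 0
      rw [hx0]
      nlinarith
    | succ k ih =>
      intro hk
      have ih := ih (by omega)
      have h1 := ((hstep k (by omega)).2 (hκe (k + 1) hk)).1
      have h2 := hp k (by omega)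
      have h3 := m.halfResidual_le_succ hT hn (x₀ - xd) k
      have h4 := m.halfResidual_nonneg hT hn (x₀ - xd) k
      have h5 := m.halfResidual_nonneg hT hn (x₀ - xd) (k + 1)
      set σ := m.halfResidual (F' xd) n (x₀ - xd) k
      set σ' := m.halfResidual (F' xd) n (x₀ - xd) (k + 1)
      have h6 : 10 * θ * ‖F' xd (x k - xd)‖ ≤ σ + δ := by
        calc 10 * θ * ‖F' xd (x k - xd)‖ ≤ 10 * θ * (cs * (σ + δ)) := by gcongr
          _ = θ * (10 * cs) * (σ + δ) := by ring
          _ ≤ 1 * (σ + δ) := by gcongr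
          _ = _ := one_mul _
      have h7 : 2 * NewtonFilter.errorConst q * Θ * δ ≤ 1 / 4 * δ := by
        calc 2 * NewtonFilter.errorConst q * Θ * δ = 2 * (Θ * NewtonFilter.errorConst q) * δ := by ring
          _ ≤ 2 * (1 / 8) * δ := by gcongr
          _ = _ := by ring
      have h8 : 9 * σ ≤ cs * σ' := by
        rw [hcs]
        linarith
      have h9 : 9 * δ ≤ cs * δ := by gcongr
      linarith
  have hest := fun k (hk : k ≤ K) => (structural_estimates hop.hasFDerivAt hK₀ hK₁ hK₂ hD hxd
    (hballK k hk) hθ (hκe k hk)).2.1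
  have hmain := m.oracleBound_of_recursion hT hn hT0 (e := fun k => x k - xd) (K := K) (δ := δ)
    (θ := Θ) (τ := τ) (cs := cs) (C₂ := 2 * (τ + 1)) (s := fun k => ‖F' xd (x k - xd)‖)
    (p := fun k => ‖F' (x k) ((m.base (normalOp (F' (x k))) ^ m.order (n k)) (x₀ - xd))‖)
    hδ hτ hΘ0 (by linarith) (by linarith) hθb hθs
  simp only [hx0] at hmain
  refine hmain hrec ?_ hp hs ?_ ?_
  -- At the stopping index `(1 - θ) ‖F'(x†) e_K‖ ≤ (τ + 1) δ`, hence the constant `2 (τ + 1)`.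
  · have h1 := hK.1
    rw [hx] at h1
    have h2 := hest K le_rfl
    have e1 : F' xd (x K - xd) = (F (x K) - yδ) - (F (x K) - F xd - F' xd (x K - xd))
        + (yδ - F xd) := by abel
    have h3 : ‖F' xd (x K - xd)‖ ≤ τ * δ + θ * ‖F' xd (x K - xd)‖ + δ := by
      nth_rw 1 [e1]
      exact (norm_add_le _ _).trans (add_le_add ((norm_sub_le _ _).trans (add_le_add h1 h2)) hy)
    have h4 : θ * ‖F' xd (x K - xd)‖ ≤ 1 / 16 * ‖F' xd (x K - xd)‖ := by gcongr
    linarith [norm_nonneg (F' xd (x K - xd))]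
  · intro hK0
    have h1 := hK.2.1 0 hK0
    rw [hx, hx0] at h1
    have h2 := hest 0 hK0.le
    rw [hx0] at h2
    have e1 : F x₀ - yδ = (F x₀ - F xd - F' xd (x₀ - xd)) + F' xd (x₀ - xd) - (yδ - F xd) := by
      abel
    have h3 : ‖F x₀ - yδ‖ ≤ θ * ‖F' xd (x₀ - xd)‖ + ‖F' xd (x₀ - xd)‖ + δ := by
      rw [e1]
      refine (norm_sub_le _ _).trans (add_le_add ((norm_add_le _ _).trans ?_) hy)
      exact add_le_add_left h2 _
    have h4 : θ * ‖F' xd (x₀ - xd)‖ ≤ 1 / 16 * ‖F' xd (x₀ - xd)‖ := by gcongr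
    linarith [norm_nonneg (F' xd (x₀ - xd))]
  · intro k hk
    have h1 := hK.2.1 (k + 1) hk
    rw [hx] at h1
    have h2 := ((hstep k (by omega)).2 (hκe (k + 1) hk.le)).2 (hballK (k + 1) hk.le)
    have h3 : 7 * θ * (‖F' xd (x k - xd)‖ + ‖F' xd (x (k + 1) - xd)‖)
        ≤ 8 * Θ * (‖F' xd (x k - xd)‖ + ‖F' xd (x (k + 1) - xd)‖) :=
      mul_le_mul_of_nonneg_right (by linarith) (by positivity)
    linarith

end StructuralOracle

/-! ### Lipschitz derivative: iterates and discrepancy. -/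

section Lipschitz

set_option linter.unusedSectionVars false

open ContinuousLinearMap (adjoint)

variable {X Y : Type*} [NormedAddCommGroup X] [InnerProductSpace ℝ X] [CompleteSpace X]
  [NormedAddCommGroup Y] [InnerProductSpace ℝ Y] [CompleteSpace Y]

theorem norm_adjoint_apply_le (T : X →L[ℝ] Y) (u : Y) : ‖adjoint T u‖ ≤ ‖T‖ * ‖u‖ := by
  simpa only [LinearIsometryEquiv.norm_map] using (adjoint T).le_opNorm u

theorem norm_adjoint_apply_le_of_norm_sub_le {T T₁ : X →L[ℝ] Y} {l : ℝ} (h : ‖T₁ - T‖ ≤ l)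
    (u : Y) : ‖adjoint T u - adjoint T₁ u‖ ≤ l * ‖u‖ := by
  rw [← sub_apply, ← map_sub, norm_sub_rev] at *
  refine (norm_adjoint_apply_le _ u).trans ?_
  gcongr

/-- The residual of an element of the range of the adjoint of a perturbed operator. -/
theorem NewtonFilter.norm_base_order_adjoint_perturbed_le (m : NewtonFilter) {T T₁ : X →L[ℝ] Y}
    (hT₁ : ‖normalOp T₁‖ ≤ 2 / 9) {n : ℕ} (hn : 0 < n) {l : ℝ} (h : ‖T₁ - T‖ ≤ l) (u : Y) :
    ‖(m.base (normalOp T₁) ^ m.order n) (adjoint T u)‖ ≤ ‖u‖ / √n + l * ‖u‖ := by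
  have h1 := m.norm_base_pow_adjoint_apply_le hT₁ (m.order n) u
  have h2 := m.norm_base_pow_apply_le hT₁ (m.order n) (adjoint T u - adjoint T₁ u)
  have h3 := norm_adjoint_apply_le_of_norm_sub_le h u
  have hs : 0 < √(n : ℝ) := Real.sqrt_pos.2 (by exact_mod_cast hn)
  have h4 : 1 / √((m.order n : ℝ) + 1) * ‖u‖ ≤ ‖u‖ / √n := by
    rw [one_div_mul_eq_div]
    gcongr
    have : (n : ℝ) ≤ m.order n := by exact_mod_cast m.le_order n
    linarith
  rw [← add_sub_cancel (adjoint T₁ u) (adjoint T u), map_add]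
  refine (norm_add_le _ _).trans ?_
  linarith

theorem NewtonFilter.norm_map_base_order_adjoint_perturbed_le (m : NewtonFilter)
    {T T₁ : X →L[ℝ] Y} (hT₁ : ‖normalOp T₁‖ ≤ 2 / 9) {n : ℕ} (hn : 0 < n) {l : ℝ}
    (h : ‖T₁ - T‖ ≤ l) (u : Y) :
    ‖T₁ ((m.base (normalOp T₁) ^ m.order n) (adjoint T u))‖ ≤ ‖u‖ / n + l * ‖u‖ / √n := by
  have h1 := m.norm_map_base_pow_adjoint_apply_le hT₁ (m.order n) u
  have h2 := m.norm_map_base_order_apply_le hT₁ hn (adjoint T u - adjoint T₁ u)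
  have h3 := norm_adjoint_apply_le_of_norm_sub_le h u
  have hn' : (0 : ℝ) < n := by exact_mod_cast hn
  have hs : 0 < √(n : ℝ) := Real.sqrt_pos.2 hn'
  have hs2 : √(2 : ℝ) ≤ 2 := by
    rw [Real.sqrt_le_left (by norm_num)]
    norm_num
  have h4 : 1 / ((m.order n : ℝ) + 1) * ‖u‖ ≤ ‖u‖ / n := by
    rw [one_div_mul_eq_div]
    gcongr
    have : (n : ℝ) ≤ m.order n := by exact_mod_cast m.le_order n
    linarith
  have h5 : √2 / 3 / √(n : ℝ) * ‖adjoint T u - adjoint T₁ u‖ ≤ l * ‖u‖ / √n := by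
    rw [div_mul_eq_mul_div]
    refine div_le_div_of_nonneg_right ?_ hs.le
    nlinarith [norm_nonneg (adjoint T u - adjoint T₁ u)]
  rw [← add_sub_cancel (adjoint T₁ u) (adjoint T u), map_add, map_add]
  refine (norm_add_le _ _).trans ?_
  linarith

/-- If errors decay like `‖u‖/√N`, the quadratic remainder is of order `‖u‖/N`, the same order as
the mapped residual of `T* u`. -/
theorem mul_sq_le_of_sqrt_mul_le {L U η c N E : ℝ} (hL0 : 0 ≤ L) (hU : 0 ≤ U) (hη : L * U ≤ η)
    (hηc : η * c ^ 2 ≤ 1 / 8) (hN : 0 < N) (hE : 0 ≤ E) (h : √N * E ≤ c * U) :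
    L * E ^ 2 ≤ 1 / 8 * (U / N) := by
  have hs := Real.sqrt_pos.2 hN
  have h1 : E ≤ c * U / √N := by
    rw [le_div_iff₀ hs]
    linarith
  calc L * E ^ 2 ≤ L * (c * U / √N) ^ 2 := by gcongr
    _ = L * U * (c ^ 2 * (U / N)) := by
      rw [div_pow, Real.sq_sqrt hN.le]
      ring
    _ ≤ η * (c ^ 2 * (U / N)) := by gcongr
    _ = η * c ^ 2 * (U / N) := by ring
    _ ≤ _ := by gcongr

variable {m : NewtonFilter} {q : ℕ} {n : ℕ → ℕ} {F : X → Y} {F' : X → X →L[ℝ] Y} {x₀ xd : X}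
  {ρ L : ℝ} (hn : StepIntegers q n) (hop : OperatorConditions m (1 / (n 0 : ℝ)) F F' xd ρ)
  (hL0 : 0 ≤ L) (hL : LipschitzDeriv F' xd ρ L)
  {yδ : Y} {δ : ℝ} (hδ : 0 < δ) (hy : ‖yδ - F xd‖ ≤ δ)
include hn hop hL0 hL hδ hy

theorem lipschitz_step (k : ℕ) {x x' : X} (hxdef : x = newtonIterate m n F F' x₀ yδ k)
    (hxdef' : x' = newtonIterate m n F F' x₀ yδ (k + 1)) (hx : x ∈ Metric.ball xd ρ) :
    ‖x' - xd - (m.base (normalOp (F' x)) ^ m.order (n k)) (x₀ - xd)‖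
      ≤ √2 * √(n k : ℝ) * (δ + L * ‖x - xd‖ ^ 2) ∧
    (x' ∈ Metric.ball xd ρ → ‖F x' - yδ‖
      ≤ ‖F' x ((m.base (normalOp (F' x)) ^ m.order (n k)) (x₀ - xd))‖ + δ
        + 3 * L * (‖x - xd‖ ^ 2 + ‖x' - xd‖ ^ 2)) := by
  have hxd : xd ∈ Metric.ball xd ρ := Metric.mem_ball_self hop.radius_pos
  have hT₁ := hop.norm_normalOp_le' (hn.pos 0) hx
  have he' := newtonIterate_succ_sub m n F F' x₀ xd yδ k (by rw [← hxdef]; exact hT₁)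
  rw [← hxdef, ← hxdef'] at he'
  have hr : ‖F x - F xd - F' x (x - xd)‖ ≤ L * ‖x - xd‖ ^ 2 := by
    have h1 := hL.norm_sub_sub_le hop.hasFDerivAt hL0 hxd hx
    have h2 : F x - F xd - F' x (x - xd) = -(F xd - F x - F' x (xd - x)) := by
      simp only [map_sub]
      abel
    rwa [h2, norm_neg, norm_sub_rev x xd]
  refine ⟨(norm_newtonStep_sub_le m hT₁ (hn.pos k) hy he').trans (by gcongr), fun hx' => ?_⟩
  have h2 := norm_map_newtonStep_sub_le m hT₁ (hn.pos k) hy he' (F' xd)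
  have h3 := hL.norm_sub_sub_le hop.hasFDerivAt hL0 hx' hxd
  have h4 : ‖(F' x - F' xd) (x' - xd)‖ ≤ L * (‖x - xd‖ * ‖x' - xd‖) := by
    rw [← mul_assoc]
    exact (ContinuousLinearMap.le_opNorm _ _).trans
      (by gcongr; exact hL x hx xd hxd)
  have h5 : L * (‖x - xd‖ * ‖x' - xd‖) ≤ L * (‖x - xd‖ ^ 2 + ‖x' - xd‖ ^ 2) := by
    gcongr
    nlinarith [sq_nonneg (‖x - xd‖ - ‖x' - xd‖), sq_nonneg ‖x - xd‖, sq_nonneg ‖x' - xd‖]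
  have e1 : F x' - yδ = (F x' - F xd - F' xd (x' - xd)) + (F' xd (x' - xd) - (yδ - F xd)) := by
    abel
  rw [e1]
  refine (norm_add_le _ _).trans ?_
  have h6 : 0 ≤ L * ‖x' - xd‖ ^ 2 := by positivity
  linarith

variable {u : Y} (hu : x₀ - xd = adjoint (F' xd) u) {η c Γ : ℝ} (hη : L * ‖u‖ ≤ η)
  (hΓ : 0 < Γ) (hc : c = √(1 + q) * (3 + 2 * Γ)) (hηc : η * c ^ 2 ≤ 1 / 8)
include hu hη hΓ hc hηc

/-- The residual of `T* u` decays like `‖u‖/√n`. Perturbation and remainder preserve this rate since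
`L ‖u‖` is small, and the noise preserves it while `n_j δ ≤ Γ ‖u‖`. -/
theorem lipschitz_bound {kt : ℕ} (hkt : ∀ j < kt, (n j : ℝ) * δ ≤ Γ * ‖u‖) :
    ∀ k ≤ kt, (∀ j < k, newtonIterate m n F F' x₀ yδ j ∈ Metric.ball xd ρ) →
      √(n k : ℝ) * ‖newtonIterate m n F F' x₀ yδ k - xd‖ ≤ c * ‖u‖ := by
  have hxd : xd ∈ Metric.ball xd ρ := Metric.mem_ball_self hop.radius_pos
  have hT0 := hop.norm_normalOp_le hxd
  set U := ‖u‖ with hU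
  have hU0 : 0 ≤ U := norm_nonneg _
  have hη0 : 0 ≤ η := le_trans (by positivity) hη
  have hsq : (1 : ℝ) ≤ √(1 + q) := by
    rw [Real.one_le_sqrt]
    have : (0 : ℝ) ≤ q := Nat.cast_nonneg q
    linarith
  have hc3 : 3 ≤ c := by
    have : 0 ≤ √(1 + (q : ℝ)) * (2 * Γ) := by positivity
    rw [hc]
    linarith
  have hs2 : √(2 : ℝ) ≤ 2 := by
    rw [Real.sqrt_le_left (by norm_num)]
    norm_num
  have hηc1 : η * c ≤ 1 / 24 := by
    have : η * c * 3 ≤ η * c * c := by gcongr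
    linarith
  intro k
  induction k with
  | zero =>
    intro _ _
    have hs0 := hn.sqrt_pos 0
    have h4 : ‖F' xd‖ ≤ 1 / 2 / √(n 0 : ℝ) := by
      refine abs_le_of_sq_le_sq' ?_ (by positivity) |>.2
      rw [sq, ← norm_normalOp, div_pow, Real.sq_sqrt (by positivity)]
      refine hT0.trans ?_
      gcongr
      norm_num
    change √(n 0 : ℝ) * ‖x₀ - xd‖ ≤ _
    rw [hu]
    calc √(n 0 : ℝ) * ‖adjoint (F' xd) u‖ ≤ √(n 0 : ℝ) * (1 / 2 / √(n 0 : ℝ) * U) := by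
          gcongr
          exact (norm_adjoint_apply_le _ _).trans (by gcongr)
      _ = 1 / 2 * U := by field_simp
      _ ≤ c * U := by
        gcongr
        linarith
  | succ k ih =>
    intro hk hball
    have ih := ih (by omega) fun j hj => hball j (by omega)
    have hnoise := hkt k (by omega)
    have hx := hball k (by omega)
    have s1 := (lipschitz_step (x₀ := x₀) hn hop hL0 hL hδ hy k rfl rfl hx).1
    have hT₁ := hop.norm_normalOp_le' (hn.pos 0) hx
    generalize newtonIterate m n F F' x₀ yδ (k + 1) = x' at *
    generalize newtonIterate m n F F' x₀ yδ k = x at *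
    have h2 := m.norm_base_order_adjoint_perturbed_le hT₁ (hn.pos k) (hL x hx xd hxd) u
    rw [← hu] at h2
    have h3 := norm_le_norm_add_norm_sub' (x' - xd)
      ((m.base (normalOp (F' x)) ^ m.order (n k)) (x₀ - xd))
    have hsk := hn.sqrt_pos k
    have hss : √(n k : ℝ) * √(n k : ℝ) = n k := Real.mul_self_sqrt (by positivity)
    set E := ‖x - xd‖
    have hE0 : 0 ≤ E := norm_nonneg _
    have h4 : √(n k : ℝ) * (L * E * U) ≤ 1 / 24 * U := by
      calc √(n k : ℝ) * (L * E * U) = L * U * (√(n k : ℝ) * E) := by ring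
        _ ≤ η * (c * U) := by gcongr
        _ = η * c * U := by ring
        _ ≤ _ := by gcongr
    have h5 : √(n k : ℝ) * (√(n k : ℝ) * (L * E ^ 2)) ≤ 1 / 8 * U := by
      calc _ = L * (√(n k : ℝ) * E) * (√(n k : ℝ) * E) := by ring
        _ ≤ L * (c * U) * (c * U) := by gcongr
        _ = L * U * (c ^ 2 * U) := by ring
        _ ≤ η * (c ^ 2 * U) := by gcongr
        _ = η * c ^ 2 * U := by ring
        _ ≤ _ := by gcongr
    have h6 : √(n k : ℝ) * ‖x' - xd‖ ≤ (3 + 2 * Γ) * U := by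
      calc √(n k : ℝ) * ‖x' - xd‖
          ≤ √(n k : ℝ) * (U / √(n k : ℝ) + L * E * U
            + √2 * √(n k : ℝ) * (δ + L * E ^ 2)) := by
            gcongr
            linarith
        _ = U + √(n k : ℝ) * (L * E * U) + √2 * (√(n k : ℝ) * √(n k : ℝ) * δ
            + √(n k : ℝ) * (√(n k : ℝ) * (L * E ^ 2))) := by
            field_simp
        _ ≤ U + 1 / 24 * U + 2 * (Γ * U + 1 / 8 * U) := by
            rw [hss]
            gcongr
        _ ≤ _ := by linarith
    calc √(n (k + 1) : ℝ) * ‖x' - xd‖ ≤ √(1 + q) * √(n k : ℝ) * ‖x' - xd‖ := by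
          gcongr
          exact hn.sqrt_succ_le k
      _ = √(1 + q) * (√(n k : ℝ) * ‖x' - xd‖) := by ring
      _ ≤ √(1 + q) * ((3 + 2 * Γ) * U) := mul_le_mul_of_nonneg_left h6 (Real.sqrt_nonneg _)
      _ = c * U := by rw [hc]; ring

/-- The discrepancy at the index where the noise begins to dominate. -/
theorem lipschitz_discrepancy {τ : ℝ} (hτ : 1 < τ) (hΓτ : Γ = 3 * (1 + q) / (τ - 1)) {kt : ℕ}
    (hkt : ∀ j < kt, (n j : ℝ) * δ ≤ Γ * ‖u‖) (hkt' : Γ * ‖u‖ < n kt * δ)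
    (hball : ∀ j ≤ kt, newtonIterate m n F F' x₀ yδ j ∈ Metric.ball xd ρ) :
    ‖F (newtonIterate m n F F' x₀ yδ kt) - yδ‖ ≤ τ * δ := by
  have hxd : xd ∈ Metric.ball xd ρ := Metric.mem_ball_self hop.radius_pos
  have hT0 := hop.norm_normalOp_le hxd
  have hb := fun k (hk : k ≤ kt) => lipschitz_bound hn hop hL0 hL hδ hy hu hη hΓ hc hηc hkt k hk
    fun j hj => hball j (by omega)
  have hsqb := fun k (hk : k ≤ kt) => mul_sq_le_of_sqrt_mul_le hL0 (norm_nonneg u) hη hηc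
    (by exact_mod_cast hn.pos k) (norm_nonneg _) (hb k hk)
  set U := ‖u‖ with hU
  have hU0 : 0 ≤ U := norm_nonneg _
  have hη0 : 0 ≤ η := le_trans (by positivity) hη
  have hq0 : (0 : ℝ) ≤ q := Nat.cast_nonneg q
  have hτ1 : 0 < τ - 1 := by linarith
  have hnt : (0 : ℝ) < n kt := by exact_mod_cast hn.pos kt
  -- This is the reason for the choice of `Γ`: all terms other than `δ` add up to less than `3 U /
  -- n_k`, and `1 + q` pays for the last step.
  have hUn : 3 * (1 + q) * (U / n kt) ≤ (τ - 1) * δ := by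
    rw [hΓτ, div_mul_eq_mul_div, div_lt_iff₀ hτ1] at hkt'
    rw [← mul_div_assoc, div_le_iff₀ hnt]
    linarith
  rcases Nat.eq_zero_or_pos kt with rfl | hpos
  · have h1 := hball 0 le_rfl
    have h2 := hsqb 0 le_rfl
    change x₀ ∈ _ at h1
    change L * ‖x₀ - xd‖ ^ 2 ≤ _ at h2
    have h3 := hL.norm_sub_sub_le hop.hasFDerivAt hL0 h1 hxd
    have h4 : ‖F' xd (x₀ - xd)‖ ≤ 2 / 9 * (U / n 0) := by
      rw [hu]
      calc ‖F' xd (adjoint (F' xd) u)‖ ≤ ‖F' xd‖ * (‖F' xd‖ * U) :=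
            (ContinuousLinearMap.le_opNorm _ _).trans
              (by gcongr; exact norm_adjoint_apply_le _ _)
        _ = ‖normalOp (F' xd)‖ * U := by rw [norm_normalOp]; ring
        _ ≤ 2 / 9 / n 0 * U := by gcongr
        _ = _ := by ring
    change ‖F x₀ - yδ‖ ≤ τ * δ
    have e1 : F x₀ - yδ = (F x₀ - F xd - F' xd (x₀ - xd)) + F' xd (x₀ - xd) - (yδ - F xd) := by
      abel
    have h6 : ‖F x₀ - yδ‖ ≤ L * ‖x₀ - xd‖ ^ 2 + 2 / 9 * (U / n 0) + δ := by
      rw [e1]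
      exact (norm_sub_le _ _).trans
        (add_le_add ((norm_add_le _ _).trans (add_le_add h3 h4)) hy)
    have h7 : 0 ≤ q * (U / n 0) := by positivity
    have h8 : 0 ≤ U / n 0 := by positivity
    linarith
  · obtain ⟨k, rfl⟩ := Nat.exists_eq_add_of_lt hpos
    rw [zero_add] at *
    have hxb := hball k (by omega)
    have hxb' := hball (k + 1) le_rfl
    have s2 := (lipschitz_step (x₀ := x₀) hn hop hL0 hL hδ hy k rfl rfl hxb).2 hxb'
    have b1 := hb k (by omega)
    have q1 := hsqb k (by omega)
    have q2 := hsqb (k + 1) le_rfl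
    have hT₁ := hop.norm_normalOp_le' (hn.pos 0) hxb
    generalize newtonIterate m n F F' x₀ yδ (k + 1) = x' at *
    generalize newtonIterate m n F F' x₀ yδ k = x at *
    have h2 := m.norm_map_base_order_adjoint_perturbed_le hT₁ (hn.pos k) (hL x hxb xd hxd) u
    rw [← hu, ← hU] at h2
    have hnk : (0 : ℝ) < n k := by exact_mod_cast hn.pos k
    have hsk := hn.sqrt_pos k
    have hc3 : 3 ≤ c := by
      have hsq : (1 : ℝ) ≤ √(1 + q) := by
        rw [Real.one_le_sqrt]
        linarith
      have : 0 ≤ √(1 + (q : ℝ)) * (2 * Γ) := by positivity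
      rw [hc]
      linarith
    have hηc1 : η * c ≤ 1 / 24 := by
      have : η * c * 3 ≤ η * c * c := by gcongr
      linarith
    have h4 : L * ‖x - xd‖ * U / √(n k : ℝ) ≤ 1 / 24 * (U / n k) := by
      rw [div_le_iff₀ hsk]
      have h5 : ‖x - xd‖ ≤ c * U / √(n k : ℝ) := by
        rw [le_div_iff₀ hsk]
        linarith
      calc L * ‖x - xd‖ * U = L * U * ‖x - xd‖ := by ring
        _ ≤ η * (c * U / √(n k : ℝ)) := by gcongr
        _ = η * c * (U / √(n k : ℝ)) := by ring
        _ ≤ 1 / 24 * (U / √(n k : ℝ)) := by gcongr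
        _ = 1 / 24 * (U / (√(n k : ℝ) * √(n k : ℝ))) * √(n k : ℝ) := by field_simp
        _ = _ := by rw [Real.mul_self_sqrt hnk.le]
    have h6 : U / n (k + 1) ≤ U / n k := by
      gcongr
      exact_mod_cast hn.mono k
    have h7 : U / n k ≤ (1 + q) * (U / n (k + 1)) := by
      rw [← mul_div_assoc, div_le_div_iff₀ hnk hnt]
      have := mul_le_mul_of_nonneg_left (hn.succ_le_mul k) hU0
      linarith
    have h8 : 0 ≤ U / n k := by positivity
    linarith

end Lipschitz

/-! ### Lipschitz derivative: ball invariance and oracle inequality. -/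

section LipschitzOracle

set_option linter.unusedSectionVars false

open ContinuousLinearMap (adjoint)

variable {X Y : Type*} [NormedAddCommGroup X] [InnerProductSpace ℝ X] [CompleteSpace X]
  [NormedAddCommGroup Y] [InnerProductSpace ℝ Y] [CompleteSpace Y]
  {m : NewtonFilter} {q : ℕ} {n : ℕ → ℕ} {F : X → Y} {F' : X → X →L[ℝ] Y} {x₀ xd : X}
  {ρ L : ℝ}

theorem newtonIterate_initial (m : NewtonFilter) (n : ℕ → ℕ) (F : X → Y) (F' : X → X →L[ℝ] Y)
    (x₀ : X) (yδ : Y) : newtonIterate m n F F' x₀ yδ 0 = x₀ := rfl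

/-- The iterates stay in the ball if the noise level is small. -/
theorem lipschitz_mem_ball (hn : StepIntegers q n)
    (hop : OperatorConditions m (1 / (n 0 : ℝ)) F F' xd ρ) (hL0 : 0 ≤ L)
    (hL : LipschitzDeriv F' xd ρ L) (hρ : 4 * ‖x₀ - xd‖ < ρ) {u : Y}
    (hu : x₀ - xd = adjoint (F' xd) u) {η c Γ : ℝ} (hη : L * ‖u‖ ≤ η) (hΓ : 0 < Γ)
    (hc : c = √(1 + q) * (3 + 2 * Γ)) (hηc : η * c ^ 2 ≤ 1 / 8) (hηc1 : η * c ≤ 1 / 24)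
    {yδ : Y} {δ : ℝ} (hδ : 0 < δ) (hy : ‖yδ - F xd‖ ≤ δ)
    (hδ' : 2 * (Γ * ‖u‖) * δ ≤ ‖x₀ - xd‖ ^ 2) {kt : ℕ}
    (hkt : ∀ j < kt, (n j : ℝ) * δ ≤ Γ * ‖u‖) :
    ∀ k ≤ kt, newtonIterate m n F F' x₀ yδ k ∈ Metric.ball xd ρ := by
  suffices h : ∀ k ≤ kt, ‖newtonIterate m n F F' x₀ yδ k - xd‖ ≤ 4 * ‖x₀ - xd‖ by
    intro k hk
    rw [Metric.mem_ball, dist_eq_norm]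
    linarith [h k hk]
  have hs2 : √(2 : ℝ) ≤ 2 := by
    rw [Real.sqrt_le_left (by norm_num)]
    norm_num
  intro k
  induction k using Nat.strong_induction_on with
  | _ k ih =>
    intro hk
    cases k with
    | zero =>
      rw [newtonIterate_initial]
      linarith [norm_nonneg (x₀ - xd)]
    | succ k =>
      have hball : ∀ j < k + 1, newtonIterate m n F F' x₀ yδ j ∈ Metric.ball xd ρ := by
        intro j hj
        rw [Metric.mem_ball, dist_eq_norm]
        linarith [ih j hj (by omega)]
      have hx := hball k (by omega)
      have s1 := (lipschitz_step (x₀ := x₀) hn hop hL0 hL hδ hy k rfl rfl hx).1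
      have hb := lipschitz_bound hn hop hL0 hL hδ hy hu hη hΓ hc hηc hkt k (by omega)
        fun j hj => hball j (by omega)
      have ihk := ih k (by omega) (by omega)
      have hT₁ := hop.norm_normalOp_le' (hn.pos 0) hx
      have h2 := m.norm_base_pow_apply_le hT₁ (m.order (n k)) (x₀ - xd)
      generalize newtonIterate m n F F' x₀ yδ (k + 1) = x' at *
      generalize newtonIterate m n F F' x₀ yδ k = x at *
      have h3 := norm_le_norm_add_norm_sub' (x' - xd)
        ((m.base (normalOp (F' x)) ^ m.order (n k)) (x₀ - xd))
      -- The only place where `δ` must be small: the square of the left side is `2 (n_k δ) δ ≤ 2 Γ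
      -- ‖u‖ δ`.
      have h4 : √2 * √(n k : ℝ) * δ ≤ ‖x₀ - xd‖ := by
        refine abs_le_of_sq_le_sq' ?_ (norm_nonneg _) |>.2
        rw [mul_pow, mul_pow, Real.sq_sqrt (by norm_num), Real.sq_sqrt (by positivity)]
        have := mul_le_mul_of_nonneg_right (hkt k (by omega)) hδ.le
        linarith
      have hc0 : 0 ≤ c := by rw [hc]; positivity
      have h5 : √2 * √(n k : ℝ) * (L * ‖x - xd‖ ^ 2) ≤ 1 / 3 * ‖x₀ - xd‖ := by
        calc √2 * √(n k : ℝ) * (L * ‖x - xd‖ ^ 2)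
            = √2 * (L * (√(n k : ℝ) * ‖x - xd‖) * ‖x - xd‖) := by ring
          _ ≤ 2 * (L * (c * ‖u‖) * (4 * ‖x₀ - xd‖)) := by gcongr
          _ = 8 * (c * (L * ‖u‖)) * ‖x₀ - xd‖ := by ring
          _ ≤ 8 * (c * η) * ‖x₀ - xd‖ := by gcongr
          _ ≤ 8 * (1 / 24) * ‖x₀ - xd‖ := by
            gcongr
            linarith
          _ = _ := by ring
      linarith [norm_nonneg (x₀ - xd)]

/-- The image of the error controls the error at the stopping index. -/
theorem lipschitz_sq_le_map (hn : StepIntegers q n) (m : NewtonFilter) {T : X →L[ℝ] Y}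
    (hT : ‖normalOp T‖ ≤ 2 / 9) {e : ℕ → X} {K : ℕ} {u : Y} (hu : e 0 = adjoint T u)
    {η c δ Θ : ℝ} (hL0 : 0 ≤ L) (hη : L * ‖u‖ ≤ η) (hη1 : η ≤ 1 / 24) (hηc1 : η * c ≤ 1 / 24)
    (hc0 : 0 ≤ c) (hδ : 0 < δ) (hΘ : 0 ≤ Θ) (hΘb : Θ * NewtonFilter.errorConst q ≤ 1 / 8)
    (hrec : ∀ k < K, ‖e (k + 1) - (m.base (normalOp T) ^ m.order (n k)) (e 0)‖
      ≤ Θ * ‖e k‖ + 2 * √(n k : ℝ) * δ)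
    (herr : ∀ k ≤ K, ‖e k‖ ≤ NewtonFilter.errorConst q *
      (‖(m.base (normalOp T) ^ m.order (n k)) (e 0)‖ + √(n k : ℝ) * δ))
    (hbound : √(n K : ℝ) * ‖e K‖ ≤ c * ‖u‖) :
    L * ‖e K‖ ^ 2 ≤ 1 / 2 * ‖T (e K)‖ + δ := by
  have ht := norm_nonneg (T (e K))
  cases K with
  | zero =>
    -- Interpolation: `‖e 0‖² = ⟨T* u, e 0⟩ = ⟨u, T (e 0)⟩`.
    have h1 : ‖e 0‖ ^ 2 ≤ ‖u‖ * ‖T (e 0)‖ := by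
      rw [← real_inner_self_eq_norm_sq]
      nth_rw 1 [hu]
      rw [ContinuousLinearMap.adjoint_inner_left]
      exact real_inner_le_norm _ _
    calc L * ‖e 0‖ ^ 2 ≤ L * (‖u‖ * ‖T (e 0)‖) := by gcongr
      _ = L * ‖u‖ * ‖T (e 0)‖ := by ring
      _ ≤ 1 / 2 * ‖T (e 0)‖ := by
        gcongr
        linarith
      _ ≤ _ := by linarith
  | succ k =>
    have h1 := hrec k (by omega)
    have h2 := herr k (by omega)
    have hsk := hn.sqrt_pos k
    set w := e (k + 1) - (m.base (normalOp T) ^ m.order (n k)) (e 0) with hw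
    have h3 := norm_le_norm_add_norm_sub (e (k + 1))
      ((m.base (normalOp T) ^ m.order (n k)) (e 0))
    rw [← hw] at h3
    -- The defect `w` occurs on both sides with coefficient `1/8` on the right; dividing by `7/8`
    -- gives `1/7`.
    have h4 : ‖w‖ ≤ 1 / 7 * ‖e (k + 1)‖ + 3 * (√(n k : ℝ) * δ) := by
      have : Θ * ‖e k‖ ≤ 1 / 8 * (‖e (k + 1)‖ + ‖w‖ + √(n k : ℝ) * δ) := by
        calc Θ * ‖e k‖ ≤ Θ * (NewtonFilter.errorConst q *
              (‖(m.base (normalOp T) ^ m.order (n k)) (e 0)‖ + √(n k : ℝ) * δ)) := by gcongr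
          _ = Θ * NewtonFilter.errorConst q *
              (‖(m.base (normalOp T) ^ m.order (n k)) (e 0)‖ + √(n k : ℝ) * δ) := by ring
          _ ≤ _ := by gcongr
      have : 0 ≤ √(n k : ℝ) * δ := by positivity
      linarith
    -- The same interpolation for `e_{k+1} = s(A)^N T* u + w`, using that `s(A)^N` is symmetric and
    -- that applying it does not increase the norm of the image under `T`.
    have h5 : ‖e (k + 1)‖ ^ 2 ≤ ‖T (e (k + 1))‖ * ‖u‖ + ‖e (k + 1)‖ * ‖w‖ := by
      have e1 : e (k + 1) = (m.base (normalOp T) ^ m.order (n k)) (e 0) + w := by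
        rw [hw]
        abel
      rw [← real_inner_self_eq_norm_sq]
      nth_rw 2 [e1]
      rw [inner_add_right, ← (m.isFunctionOfOp_base_pow hT _).inner_comm, hu,
        ContinuousLinearMap.adjoint_inner_right]
      refine add_le_add ((real_inner_le_norm _ _).trans ?_) (real_inner_le_norm _ _)
      gcongr
      exact m.norm_map_base_pow_apply_le_norm_map hT _ _
    have h6 : √(n k : ℝ) * ‖e (k + 1)‖ ≤ c * ‖u‖ := by
      refine le_trans ?_ hbound
      gcongr
      exact_mod_cast hn.mono k
    set E := ‖e (k + 1)‖
    have hE0 : 0 ≤ E := norm_nonneg _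
    have h7 : E * ‖w‖ ≤ 1 / 7 * E ^ 2 + 3 * (c * ‖u‖ * δ) := by
      calc E * ‖w‖ ≤ E * (1 / 7 * E + 3 * (√(n k : ℝ) * δ)) := by gcongr
        _ = 1 / 7 * E ^ 2 + 3 * (√(n k : ℝ) * E * δ) := by ring
        _ ≤ _ := by gcongr
    have h8 : L * E ^ 2 ≤ L * (7 / 6 * (‖T (e (k + 1))‖ * ‖u‖ + 3 * (c * ‖u‖ * δ))) := by
      gcongr
      linarith
    have h9 : L * ‖u‖ * ‖T (e (k + 1))‖ ≤ 1 / 24 * ‖T (e (k + 1))‖ := by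
      gcongr
      linarith
    have h10 : c * (L * ‖u‖) * δ ≤ 1 / 24 * δ := by
      gcongr
      refine le_trans ?_ hηc1
      rw [mul_comm η]
      gcongr
    linarith

/-- The oracle inequality for the method under the Lipschitz condition. -/
theorem lipschitz_oracleBound (hn : StepIntegers q n)
    (hop : OperatorConditions m (1 / (n 0 : ℝ)) F F' xd ρ) (hL0 : 0 ≤ L)
    (hL : LipschitzDeriv F' xd ρ L) (hρ : 4 * ‖x₀ - xd‖ < ρ) {u : Y}
    (hu : x₀ - xd = adjoint (F' xd) u) {τ η c Γ : ℝ} (hτ : 1 < τ) (hη : L * ‖u‖ ≤ η)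
    (hΓ : Γ = 3 * (1 + q) / (τ - 1)) (hc : c = √(1 + q) * (3 + 2 * Γ))
    (hηc : η * c ^ 2 ≤ 1 / 8)
    (hηb : η * (2 * c + 16) * NewtonFilter.errorConst q ≤ 1 / 8)
    (hηs : η * (2 * c + 16) * (2 * NewtonFilter.errorConst q + 16 * NewtonFilter.errorConst q)
      ≤ (τ - 1) / 2) :
    (∃ δ₀ : ℝ, 0 < δ₀ ∧ ∀ δ : ℝ, 0 < δ → δ ≤ δ₀ → ∀ yδ : Y, ‖yδ - F xd‖ ≤ δ →
      ∃ k, IsDiscrepancyIndex m n F F' x₀ xd ρ τ δ yδ k) ∧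
    ∀ δ : ℝ, 0 < δ → ∀ yδ : Y, ‖yδ - F xd‖ ≤ δ →
      ∀ K, IsDiscrepancyIndex m n F F' x₀ xd ρ τ δ yδ K →
      OracleBound (fun j => ‖(m.base (normalOp (F' xd)) ^ j) (x₀ - xd)‖)
        (3 * (2 * (τ + 2)) + 12 + (q + 2) + 4 * (4 + τ) / (τ - 1)) δ
        ‖newtonIterate m n F F' x₀ yδ K - xd‖ := by
  have hxd : xd ∈ Metric.ball xd ρ := Metric.mem_ball_self hop.radius_pos
  have hT := hop.norm_normalOp_le' (hn.pos 0) hxd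
  have hT0 := hop.norm_normalOp_le hxd
  have hτ1 : 0 < τ - 1 := by linarith
  have hΓ0 : 0 < Γ := by rw [hΓ]; positivity
  have hη0 : 0 ≤ η := le_trans (by positivity) hη
  have hc3 : 3 ≤ c := by
    have hsq : (1 : ℝ) ≤ √(1 + q) := by
      rw [Real.one_le_sqrt]
      linarith [Nat.cast_nonneg (α := ℝ) q]
    have : 0 ≤ √(1 + (q : ℝ)) * (2 * Γ) := by positivity
    rw [hc]
    linarith
  have hηc1 : η * c ≤ 1 / 24 := by
    have : η * c * 3 ≤ η * c * c := by gcongr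
    linarith
  have hη1 : η ≤ 1 / 24 := by
    have : η * 3 ≤ η * c := by gcongr
    linarith
  refine ⟨?_, fun δ hδ yδ hy K hK => ?_⟩
  -- For `x₀ = x†` the threshold used below would be zero, but then index `0` already meets the
  -- discrepancy principle.
  · rcases eq_or_ne x₀ xd with rfl | hne
    · refine ⟨1, one_pos, fun δ hδ _ yδ hy => exists_isDiscrepancyIndex (k' := 0) ?_ ?_⟩
      · intro j hj
        obtain rfl : j = 0 := by omega
        exact hxd
      · rw [newtonIterate_initial, norm_sub_rev]
        exact hy.trans (le_mul_of_one_le_left hδ.le hτ.le)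
    · have hE : 0 < ‖x₀ - xd‖ := norm_pos_iff.2 (sub_ne_zero.2 hne)
      refine ⟨‖x₀ - xd‖ ^ 2 / (2 * (Γ * ‖u‖) + 1), by positivity, fun δ hδ hδ₀ yδ hy => ?_⟩
      rw [le_div_iff₀ (by positivity)] at hδ₀
      obtain ⟨kt, hkt, hkt'⟩ := exists_index_noise_dominates hn.tendsto tendsto_id hδ (Γ * ‖u‖)
      have hball := lipschitz_mem_ball hn hop hL0 hL hρ hu hη hΓ0 hc hηc hηc1 hδ hy
        (by linarith) hkt
      exact exists_isDiscrepancyIndex hball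
        (lipschitz_discrepancy hn hop hL0 hL hδ hy hu hη hΓ0 hc hηc hτ hΓ hkt hkt' hball)
  obtain ⟨kt, hkt, hkt'⟩ := exists_index_noise_dominates hn.tendsto tendsto_id hδ (Γ * ‖u‖)
  have hKkt : K ≤ kt := hK.le_of_le
    (lipschitz_discrepancy hn hop hL0 hL hδ hy hu hη hΓ0 hc hηc hτ hΓ hkt hkt')
  have hballK : ∀ k ≤ K, newtonIterate m n F F' x₀ yδ k ∈ Metric.ball xd ρ := hK.2.2
  have hb := fun k (hk : k ≤ K) => lipschitz_bound hn hop hL0 hL hδ hy hu hη hΓ0 hc hηc hkt k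
    (hk.trans hKkt) fun j hj => hballK j (by omega)
  have hb0 := NewtonFilter.one_le_errorConst q
  set b := NewtonFilter.errorConst q with hbdef
  -- The `16` is the perturbation constant on the range of `T*`; `2c` comes from the quadratic
  -- remainder.
  set Θ := η * (2 * c + 16) with hΘdef
  have hΘ0 : 0 ≤ Θ := by positivity
  have hηΘ : 16 * η ≤ Θ := by
    have : 0 ≤ η * c := by positivity
    rw [hΘdef]
    linarith
  have hstep := fun k (hk : k ≤ K) => lipschitz_step (x₀ := x₀) hn hop hL0 hL hδ hy k rfl rfl
    (hballK k hk)
  have hpert : ∀ k ≤ K, ∀ j : ℕ,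
      ‖(m.base (normalOp (F' (newtonIterate m n F F' x₀ yδ k))) ^ j
        - m.base (normalOp (F' xd)) ^ j) (x₀ - xd)‖
        ≤ 16 * η * ‖newtonIterate m n F F' x₀ yδ k - xd‖ := by
    intro k hk j
    rw [hu]
    refine (m.norm_base_pow_sub_base_pow_adjoint_apply_le hT
      (hop.norm_normalOp_le' (hn.pos 0) (hballK k hk)) j u).trans ?_
    calc 16 * ‖F' (newtonIterate m n F F' x₀ yδ k) - F' xd‖ * ‖u‖
        ≤ 16 * (L * ‖newtonIterate m n F F' x₀ yδ k - xd‖) * ‖u‖ := by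
          gcongr
          exact hL _ (hballK k hk) _ hxd
      _ = 16 * (L * ‖u‖) * ‖newtonIterate m n F F' x₀ yδ k - xd‖ := by ring
      _ ≤ _ := by gcongr
  generalize hx : newtonIterate m n F F' x₀ yδ = x at *
  have hx0 : x 0 = x₀ := by rw [← hx]; rfl
  have hsqrtL : ∀ k ≤ K, L * (√(n k : ℝ) * ‖x k - xd‖) ≤ η * c := by
    intro k hk
    calc L * (√(n k : ℝ) * ‖x k - xd‖) ≤ L * (c * ‖u‖) :=
          mul_le_mul_of_nonneg_left (hb k hk) hL0
      _ = L * ‖u‖ * c := by ring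
      _ ≤ _ := by gcongr
  have hrec : ∀ k < K, ‖x (k + 1) - xd - (m.base (normalOp (F' xd)) ^ m.order (n k)) (x₀ - xd)‖
      ≤ Θ * ‖x k - xd‖ + 2 * √(n k : ℝ) * δ := by
    intro k hk
    have h1 := (hstep k hk.le).1
    have h2 := hpert k hk.le (m.order (n k))
    have h3 := hsqrtL k hk.le
    have hsk := hn.sqrt_pos k
    have hs2 : √(2 : ℝ) ≤ 2 := by
      rw [Real.sqrt_le_left (by norm_num)]
      norm_num
    have h4 : √2 * √(n k : ℝ) * (δ + L * ‖x k - xd‖ ^ 2)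
        ≤ 2 * √(n k : ℝ) * δ + 2 * (η * c) * ‖x k - xd‖ := by
      calc _ = √2 * √(n k : ℝ) * δ + √2 * (L * (√(n k : ℝ) * ‖x k - xd‖)) * ‖x k - xd‖ := by
            ring
        _ ≤ _ := by gcongr
    rw [sub_apply] at h2
    have h5 := norm_sub_le_norm_sub_add_norm_sub (x (k + 1) - xd)
      ((m.base (normalOp (F' (x k))) ^ m.order (n k)) (x₀ - xd))
      ((m.base (normalOp (F' xd)) ^ m.order (n k)) (x₀ - xd))
    have h7 : Θ * ‖x k - xd‖ = 2 * (η * c) * ‖x k - xd‖ + 16 * η * ‖x k - xd‖ := by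
      rw [hΘdef]
      ring
    linarith
  have herr := m.norm_error_le hT hn hT0 (e := fun k => x k - xd) hδ hΘ0
    (show Θ * NewtonFilter.errorConst q ≤ 1 by linarith) (by simpa only [hx0] using hrec)
  simp only [hx0] at herr
  have hp : ∀ k < K, ‖F' (x k) ((m.base (normalOp (F' (x k))) ^ m.order (n k)) (x₀ - xd))‖
      ≤ 4 * m.halfResidual (F' xd) n (x₀ - xd) k + 2 * NewtonFilter.errorConst q * Θ * δ := by
    intro k hk
    refine m.norm_map_residual_le_halfResidual hT hn
      (hop.norm_normalOp_le' (hn.pos 0) (hballK k hk.le)) hΘ0 (by linarith) (herr k hk.le)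
      fun j => (hpert k hk.le j).trans ?_
    gcongr
  -- Here the auxiliary quantity `s` is `‖e_k‖/√n_k` rather than the image of the error, since `L
  -- ‖e_k‖² ≤ η c ‖e_k‖/√n_k`.
  have hmain := m.oracleBound_of_recursion hT hn hT0 (e := fun k => x k - xd) (K := K) (δ := δ)
    (θ := Θ) (τ := τ) (cs := b) (C₂ := 2 * (τ + 2)) (s := fun k => ‖x k - xd‖ / √(n k : ℝ))
    (p := fun k => ‖F' (x k) ((m.base (normalOp (F' (x k))) ^ m.order (n k)) (x₀ - xd))‖)
    hδ hτ hΘ0 (by linarith) (by linarith) hηb hηs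
  simp only [hx0] at hmain
  refine hmain hrec ?_ hp ?_ ?_ ?_
  · have h1 := hK.1
    rw [hx] at h1
    have h2 := hL.norm_sub_sub_le hop.hasFDerivAt hL0 (hballK K le_rfl) hxd
    have h3 := lipschitz_sq_le_map hn m hT (e := fun k => x k - xd) (K := K) (by rw [hx0]; exact hu)
      hL0 hη hη1 hηc1 (by linarith) hδ hΘ0 hηb (by simpa only [hx0] using hrec)
      (by simpa only [hx0] using herr) (hb K le_rfl)
    have e1 : F' xd (x K - xd) = (F (x K) - yδ) - (F (x K) - F xd - F' xd (x K - xd))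
        + (yδ - F xd) := by abel
    have h4 : ‖F' xd (x K - xd)‖ ≤ τ * δ + L * ‖x K - xd‖ ^ 2 + δ := by
      nth_rw 1 [e1]
      exact (norm_add_le _ _).trans (add_le_add ((norm_sub_le _ _).trans (add_le_add h1 h2)) hy)
    linarith
  · intro k hk
    have h1 := herr k hk
    have h2 := m.norm_base_order_le hT hn (x₀ - xd) k
    have hsk := hn.sqrt_pos k
    rw [div_le_iff₀ hsk]
    calc ‖x k - xd‖ ≤ _ := h1
      _ ≤ b * (√(n k : ℝ) * m.halfResidual (F' xd) n (x₀ - xd) k + √(n k : ℝ) * δ) := by gcongr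
      _ = _ := by ring
  · intro hK0
    have h1 := hK.2.1 0 hK0
    rw [hx, hx0] at h1
    have h2 := hL.norm_sub_sub_le hop.hasFDerivAt hL0 (hballK 0 hK0.le) hxd
    rw [hx0] at h2
    have h5 : L * ‖x₀ - xd‖ ^ 2 ≤ 1 / 24 * ‖F' xd (x₀ - xd)‖ := by
      have h6 : ‖x₀ - xd‖ ^ 2 ≤ ‖u‖ * ‖F' xd (x₀ - xd)‖ := by
        rw [← real_inner_self_eq_norm_sq]
        nth_rw 1 [hu]
        rw [ContinuousLinearMap.adjoint_inner_left]
        exact real_inner_le_norm _ _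
      calc L * ‖x₀ - xd‖ ^ 2 ≤ L * (‖u‖ * ‖F' xd (x₀ - xd)‖) := by gcongr
        _ = L * ‖u‖ * ‖F' xd (x₀ - xd)‖ := by ring
        _ ≤ _ := by
          gcongr
          linarith
    have e1 : F x₀ - yδ = (F x₀ - F xd - F' xd (x₀ - xd)) + F' xd (x₀ - xd) - (yδ - F xd) := by
      abel
    have h3 : ‖F x₀ - yδ‖ ≤ L * ‖x₀ - xd‖ ^ 2 + ‖F' xd (x₀ - xd)‖ + δ := by
      rw [e1]
      refine (norm_sub_le _ _).trans (add_le_add ((norm_add_le _ _).trans ?_) hy)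
      exact add_le_add_left h2 _
    linarith [norm_nonneg (F' xd (x₀ - xd))]
  · intro k hk
    have h1 := hK.2.1 (k + 1) hk
    rw [hx] at h1
    have h2 := (hstep k (by omega)).2 (hballK (k + 1) hk.le)
    have h3 : ∀ j ≤ K, L * ‖x j - xd‖ ^ 2 ≤ η * c * (‖x j - xd‖ / √(n j : ℝ)) := by
      intro j hj
      have hs := hn.sqrt_pos j
      calc L * ‖x j - xd‖ ^ 2
          = L * (√(n j : ℝ) * ‖x j - xd‖) * (‖x j - xd‖ / √(n j : ℝ)) := by field_simp
        _ ≤ _ := mul_le_mul_of_nonneg_right (hsqrtL j hj) (by positivity)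
    have h4 := h3 k (by omega)
    have h5 := h3 (k + 1) hk.le
    have h6 : 3 * (η * c) * (‖x k - xd‖ / √(n k : ℝ) + ‖x (k + 1) - xd‖ / √(n (k + 1) : ℝ))
        ≤ 8 * Θ * (‖x k - xd‖ / √(n k : ℝ) + ‖x (k + 1) - xd‖ / √(n (k + 1) : ℝ)) := by
      refine mul_le_mul_of_nonneg_right ?_ (by positivity)
      rw [hΘdef]
      have : 0 ≤ η * c := by positivity
      linarith
    linarith

end LipschitzOracle

/-! ### Choice of constants and conclusion. -/

theorem OracleBound.exists_holder_const {C : ℝ} (hC : 0 < C) (ν : ℝ) :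
    ∃ K : ℝ, 0 < K ∧ (0 < ν → ∀ (σ : ℕ → ℝ) (w δ E : ℝ), 0 < δ → 0 ≤ w →
      (∀ m : ℕ, σ m ≤ 2 * (2 * ν) ^ ν * ((m : ℝ) + 1) ^ (-ν) * w) → OracleBound σ C δ E →
      E ≤ K * w ^ (1 / (1 + 2 * ν)) * δ ^ (2 * ν / (1 + 2 * ν))) := by
  by_cases hν : 0 < ν
  · obtain ⟨K, hK, h⟩ := OracleBound.holder_rate hC
      (show 0 < 2 * (2 * ν) ^ ν by positivity) hν
    exact ⟨K, hK, fun _ => h⟩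
  -- A default positive value for `ν ≤ 0`, so that the constants can be chosen as a function on all
  -- of `ℝ`.
  · exact ⟨1, one_pos, fun h => absurd h hν⟩

theorem OracleBound.exists_log_const {C : ℝ} (hC : 0 < C) (μ : ℝ) :
    ∃ K : ℝ, 0 < K ∧ (0 < μ → ∀ {X Y : Type*} [NormedAddCommGroup X] [InnerProductSpace ℝ X]
      [CompleteSpace X] [NormedAddCommGroup Y] [InnerProductSpace ℝ Y] [CompleteSpace Y]
      (m : NewtonFilter) (T : X →L[ℝ] Y) (e ω : X) (δ E : ℝ), ‖normalOp T‖ ≤ 2 / 9 → 0 < δ →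
      δ ≤ ‖ω‖ → LogSource T μ e ω →
      OracleBound (fun j => ‖(m.base (normalOp T) ^ j) e‖) C δ E →
      E ≤ K * ‖ω‖ * (1 + |Real.log (δ / ‖ω‖)|) ^ (-μ)) := by
  by_cases hμ : 0 < μ
  · obtain ⟨c, hc, hl⟩ := NewtonFilter.exists_base_pow_mul_log_le hμ
    obtain ⟨K, hK, h⟩ := OracleBound.log_rate hC hc hμ
    refine ⟨K, hK, fun _ X Y _ _ _ _ _ _ m T e ω δ E hT hδ hδω he hE => ?_⟩
    exact h _ _ δ E hδ hδω (m.norm_base_pow_apply_le_of_logSource hT hl hc he) hE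
  · exact ⟨1, one_pos, fun h => absurd h hμ⟩

theorem corollary6p2 (τ : ℝ) (hτ : 1 < τ) (q : ℕ) (hq : 1 ≤ q) :
    -- (i) Lipschitz continuous derivative
    (∃ η₀ : ℝ, 0 < η₀ ∧ ∃ C : ℝ → ℝ, (∀ ν, 0 < C ν) ∧
      ∀ (m : NewtonFilter)
        (X : Type u) [NormedAddCommGroup X] [InnerProductSpace ℝ X] [CompleteSpace X]
        (Y : Type v) [NormedAddCommGroup Y] [InnerProductSpace ℝ Y] [CompleteSpace Y]
        (n : ℕ → ℕ) (F : X → Y) (F' : X → X →L[ℝ] Y) (x₀ xd : X) (ρ L : ℝ)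
        (ν : ℝ) (ω : X) (u : Y),
        StepIntegers q n →
        OperatorConditions m (1 / (n 0 : ℝ)) F F' xd ρ →
        0 ≤ L →
        LipschitzDeriv F' xd ρ L →
        4 * ‖x₀ - xd‖ < ρ →
        1 / 2 ≤ ν →
        HolderSource (F' xd) ν (x₀ - xd) ω →
        u ∈ (LinearMap.ker (ContinuousLinearMap.adjoint (F' xd)).toLinearMap)ᗮ →
        x₀ - xd = ContinuousLinearMap.adjoint (F' xd) u →
        L * ‖u‖ ≤ η₀ →
        -- the discrepancy principle is well defined for all small noise levels
        (∃ δ₀ : ℝ, 0 < δ₀ ∧ ∀ δ : ℝ, 0 < δ → δ ≤ δ₀ → ∀ yδ : Y, ‖yδ - F xd‖ ≤ δ →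
          ∃ k, IsDiscrepancyIndex m n F F' x₀ xd ρ τ δ yδ k) ∧
        -- whenever it is well defined, the order optimal rate holds
        (∀ δ : ℝ, 0 < δ → ∀ yδ : Y, ‖yδ - F xd‖ ≤ δ →
          ∀ k, IsDiscrepancyIndex m n F F' x₀ xd ρ τ δ yδ k →
            ‖newtonIterate m n F F' x₀ yδ k - xd‖ ≤
              C ν * ‖ω‖ ^ (1 / (1 + 2 * ν)) * δ ^ (2 * ν / (1 + 2 * ν)))) ∧
    -- (ii) structural conditions on the derivative
    (∀ γ₁ : ℝ, √2 / 3 * √(1 + (q : ℝ)) / (τ - 1) < γ₁ →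
      ∃ η₁ : ℝ, 0 < η₁ ∧ ∃ C D : ℝ → ℝ, (∀ ν, 0 < C ν) ∧ (∀ μ, 0 < D μ) ∧
      ∀ (m : NewtonFilter)
        (X : Type u) [NormedAddCommGroup X] [InnerProductSpace ℝ X] [CompleteSpace X]
        (Y : Type v) [NormedAddCommGroup Y] [InnerProductSpace ℝ Y] [CompleteSpace Y]
        (n : ℕ → ℕ) (F : X → Y) (F' : X → X →L[ℝ] Y) (x₀ xd : X) (ρ K₀ K₁ K₂ : ℝ),
        StepIntegers q n →
        OperatorConditions m (1 / (n 0 : ℝ)) F F' xd ρ →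
        0 < K₀ → 0 < K₁ → 0 < K₂ →
        RangeInvariance F' xd ρ K₀ →
        DerivBound F' xd ρ K₁ K₂ →
        2 * (1 + √2 * γ₁) * ‖x₀ - xd‖ < ρ →
        x₀ - xd ∈ (LinearMap.ker (F' xd).toLinearMap)ᗮ →
        (K₀ + K₁ + K₂) * ‖x₀ - xd‖ ≤ η₁ →
        -- the discrepancy principle is well defined for every noise level
        (∀ δ : ℝ, 0 < δ → ∀ yδ : Y, ‖yδ - F xd‖ ≤ δ →
          ∃ k, IsDiscrepancyIndex m n F F' x₀ xd ρ τ δ yδ k) ∧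
        -- convergence as the noise level tends to zero, uniformly in the data
        (∀ ε : ℝ, 0 < ε → ∃ δ₀ : ℝ, 0 < δ₀ ∧
          ∀ δ : ℝ, 0 < δ → δ ≤ δ₀ → ∀ yδ : Y, ‖yδ - F xd‖ ≤ δ →
            ∀ k, IsDiscrepancyIndex m n F F' x₀ xd ρ τ δ yδ k →
              ‖newtonIterate m n F F' x₀ yδ k - xd‖ ≤ ε) ∧
        -- order optimal rates under the Hölder source condition
        (∀ (ν : ℝ) (ω : X), 0 < ν → HolderSource (F' xd) ν (x₀ - xd) ω →
          ∀ δ : ℝ, 0 < δ → ∀ yδ : Y, ‖yδ - F xd‖ ≤ δ →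
            ∀ k, IsDiscrepancyIndex m n F F' x₀ xd ρ τ δ yδ k →
              ‖newtonIterate m n F F' x₀ yδ k - xd‖ ≤
                C ν * ‖ω‖ ^ (1 / (1 + 2 * ν)) * δ ^ (2 * ν / (1 + 2 * ν))) ∧
        -- logarithmic rates under the logarithmic source condition
        (∀ (μ : ℝ) (ω : X), 0 < μ → LogSource (F' xd) μ (x₀ - xd) ω →
          ∀ δ : ℝ, 0 < δ → δ ≤ ‖ω‖ → ∀ yδ : Y, ‖yδ - F xd‖ ≤ δ →
            ∀ k, IsDiscrepancyIndex m n F F' x₀ xd ρ τ δ yδ k →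
              ‖newtonIterate m n F F' x₀ yδ k - xd‖ ≤
                D μ * ‖ω‖ * (1 + |Real.log (δ / ‖ω‖)|) ^ (-μ))) := by
  refine ⟨?_, fun γ hγ => ?_⟩
  · set Γ : ℝ := 3 * (1 + q) / (τ - 1) with hΓ
    set c : ℝ := √(1 + q) * (3 + 2 * Γ) with hc
    have hτ1 : 0 < τ - 1 := by linarith
    obtain ⟨η, ⟨⟨h1, h2⟩, h3⟩, hη⟩ := (((eventually_mul_le (c ^ 2) (d := 1 / 8) (by norm_num)).and
      (eventually_mul_le ((2 * c + 16) * NewtonFilter.errorConst q) (d := 1 / 8)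
        (by norm_num))).and
      (eventually_mul_le ((2 * c + 16) * (2 * NewtonFilter.errorConst q
        + 16 * NewtonFilter.errorConst q)) (d := (τ - 1) / 2) (by linarith))).and
      self_mem_nhdsWithin |>.exists
    have hC : 0 < 3 * (2 * (τ + 2)) + 12 + ((q : ℝ) + 2) + 4 * (4 + τ) / (τ - 1) := by positivity
    choose C hC0 hrate using OracleBound.exists_holder_const hC
    refine ⟨η, hη, C, hC0, ?_⟩
    intro m X _ _ _ Y _ _ _ n F F' x₀ xd ρ L ν ω u hn hop hL0 hL hρ hν hs _ hu hηu
    obtain ⟨hex, hor⟩ := lipschitz_oracleBound hn hop hL0 hL hρ hu hτ hηu hΓ hc h1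
      (by rwa [mul_assoc]) (by rwa [mul_assoc])
    have hν0 : 0 < ν := by linarith
    have hT := hop.norm_normalOp_le' (hn.pos 0) (Metric.mem_ball_self hop.radius_pos)
    exact ⟨hex, fun δ hδ yδ hy K hK => hrate ν hν0 _ _ δ _ hδ (norm_nonneg ω)
      (m.norm_base_pow_apply_le_of_holderSource hT hν0 hs) (hor δ hδ yδ hy K hK)⟩
  · have hτ1 : 0 < τ - 1 := by linarith
    have hγ0 : 0 < γ := lt_of_le_of_lt (by positivity) hγ
    set c : ℝ := √(1 + q) * (3 + 4 * γ) with hc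
    set cs : ℝ := 9 * ((1 + q) * 2 ^ q) with hcs
    set M : ℝ := 2 * (1 + √2 * γ) with hM
    have hM0 : 0 < M := by positivity
    -- The strict lower bound on `γ₁` leaves room for the remainder terms proportional to `θ`.
    have hgap : 0 < τ - 1 - √(1 + q) / γ * (√2 / 3) := by
      rw [div_lt_iff₀ hτ1] at hγ
      rw [sub_pos, div_mul_eq_mul_div, div_lt_iff₀ hγ0]
      linarith
    obtain ⟨θ, ⟨⟨⟨⟨⟨h1, h2⟩, h3⟩, h4⟩, h5⟩, h6⟩, hθ⟩ :=
      ((((((eventually_mul_le 1 (d := 1 / 16) (by norm_num)).and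
      (eventually_mul_le c (d := 1 / 10) (by norm_num))).and
      (eventually_mul_le (√(1 + q) / γ * (14 * c)) hgap)).and
      (eventually_mul_le ((6 * c + 10) * NewtonFilter.errorConst q) (d := 1 / 8)
        (by norm_num))).and
      (eventually_mul_le ((6 * c + 10) * (2 * NewtonFilter.errorConst q + 16 * cs))
        (d := (τ - 1) / 2) (by linarith))).and
      (eventually_mul_le (10 * cs) one_pos)).and self_mem_nhdsWithin |>.exists
    have hθ0 : 0 < θ := hθ
    have hC : 0 < 3 * (2 * (τ + 1)) + 12 + ((q : ℝ) + 2) + 4 * (4 + τ) / (τ - 1) := by positivity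
    choose C hC0 hrate using OracleBound.exists_holder_const hC
    choose D hD0 hlog using OracleBound.exists_log_const hC
    -- Errors up to the stopping index are at most `M ‖x₀ - x†‖`, so this threshold keeps `(K₀ + K₁
    -- + K₂) ‖e_k‖` below `θ`.
    refine ⟨θ / M, by positivity, C, D, hC0, hD0, ?_⟩
    intro m X _ _ _ Y _ _ _ n F F' x₀ xd ρ K₀ K₁ K₂ hn hop hK₀ hK₁ hK₂ hR hDB hρ hker hη
    have hT := hop.norm_normalOp_le' (hn.pos 0) (Metric.mem_ball_self hop.radius_pos)
    have hκM : (K₀ + K₁ + K₂) * (M * ‖x₀ - xd‖) ≤ θ := by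
      rw [le_div_iff₀ hM0] at hη
      linarith
    have hor := fun (δ : ℝ) (hδ : 0 < δ) (yδ : Y) (hy : ‖yδ - F xd‖ ≤ δ) =>
      structural_oracleBound hn hop hK₀ hK₁ hK₂ hR hDB hτ hγ0 hc hcs hρ hκM (by linarith) h2
        (by linarith) (by rwa [mul_assoc]) (by rwa [mul_assoc]) h6 hδ hy
    refine ⟨fun δ hδ yδ hy => (hor δ hδ yδ hy).1, fun ε hε => ?_, ?_, ?_⟩
    · obtain ⟨δ₀, hδ₀, h⟩ := OracleBound.tendsto_zero hC
        (m.tendsto_norm_base_pow_apply hT hker) hε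
      exact ⟨δ₀, hδ₀, fun δ hδ hδ' yδ hy K hK => h δ _ hδ hδ' ((hor δ hδ yδ hy).2 K hK)⟩
    · exact fun ν ω hν hs δ hδ yδ hy K hK => hrate ν hν _ _ δ _ hδ (norm_nonneg ω)
        (m.norm_base_pow_apply_le_of_holderSource hT hν hs) ((hor δ hδ yδ hy).2 K hK)
    · exact fun μ ω hμ hs δ hδ hδω yδ hy K hK => hlog μ hμ m _ _ ω δ _ hT hδ hδω hs
        ((hor δ hδ yδ hy).2 K hK)
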